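/- Let $n\ge 1$ and let $\sigma$ be a finite positive Borel measure on $\mathbb{R}^n$ supported on the closed unit ball, such that for some $\alpha>0$ its Fourier transform satisfies $|\hat\sigma(\xi)|\lesssim|\xi|^{-\alpha}$ for all $\xi\neq 0$. Let $1<p<q<\infty$ be exponents such that convolution with $\sigma$ is a bounded operator from $L^p(\mathbb{R}^n)$ to $L^q(\mathbb{R}^n)$, and let $q'=q/(q-1)$. For $j\in\mathbb{Z}$ define $\sigma_j$ by $\int f\,d\sigma_j=\int f(2^jx)\,d\sigma(x)$, and set $T^*[f](x)=\sup_{j\in\mathbb{Z}}(\sigma_j*|f|)(x)$. For a cube $Q$ (axis-parallel, half-open) and $1\le r<\infty$ put $\langle|f|\rangle_{Q,r}=\big(\frac1{|Q|}\int_Q|f|^r\,dx\big)^{1/r}$, let $f_Q^0=f\cdot 1_{\{x\in Q:\,|f(x)|\le\langle|f|\rangle_{Q,r}\}}$ and, for $m>0$, $f_Q^m=f\cdot 1_{\{x\in Q:\,2^{m-1}\langle|f|\rangle_{Q,r}<|f(x)|\le 2^m\langle|f|\rangle_{Q,r}\}}$, and define the restricted-type $L^r(\log L)^4$ average $$\langle|f|\rangle_{Q,r^+}=\sum_{m\ge0}(m+1)^4\,\langle|f_Q^m|\rangle_{Q,r}.$$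 A collection $\mathcal{Q}$ of cubes is called sparse if there are pairwise disjoint measurable sets $\{F_Q\}_{Q\in\mathcal{Q}}$ with $F_Q\subset Q$ and $|F_Q|\ge\frac12|Q|$. Let $3Q$ denote the cube concentric with $Q$ with three times its sidelength. Then there is a finite constant $C$ such that for every pair of compactly supported measurable functions $f_1,f_2:\mathbb{R}^n\to\mathbb{C}$ there is a sparse collection of cubes $\mathcal{Q}$ such that $$|\langle T^*[f_1],f_2\rangle|\;\le\;\int_{\mathbb{R}^n}T^*[f_1]\,|f_2|\,dx\;\le\; C\sum_{Q\in\mathcal{Q}}|Q|\,\langle|f_1|\rangle_{Q,p^+}\,\langle|f_2|\rangle_{3Q,q'^+},$$ where the last two quantities are allowed to be $+\infty$ (with the convention $0\cdot\infty=0$), and the first inequality is to be read only when the pairing is defined. -/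

import Mathlib

open MeasureTheory
open scoped ENNReal NNReal

noncomputable section

namespace SparseMaximal

/-- A half-open cube in `ℝⁿ` with sides parallel to the axes, given by its lower corner and
its (positive) sidelength. -/
structure Cube (n : ℕ) where
  corner : EuclideanSpace ℝ (Fin n)
  side : ℝ
  side_pos : 0 < side

/-- The set of points of a cube. -/
def Cube.toSet {n : ℕ} (Q : Cube n) : Set (EuclideanSpace ℝ (Fin n)) :=
  {x | ∀ i, Q.corner i ≤ x i ∧ x i < Q.corner i + Q.side}

/-- The concentric cube `3Q` with three times the sidelength. -/
def Cube.triple {n : ℕ} (Q : Cube n) : Cube n where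
  corner := WithLp.toLp 2 (fun i => Q.corner i - Q.side)
  side := 3 * Q.side
  side_pos := mul_pos three_pos Q.side_pos

/-- A collection of cubes is sparse if there are pairwise disjoint (measurable) sets `F Q ⊆ Q`
with `|F Q| ≥ |Q| / 2`. -/
def IsSparse {n : ℕ} (𝒬 : Set (Cube n)) : Prop :=
  ∃ F : Cube n → Set (EuclideanSpace ℝ (Fin n)),
    (∀ Q ∈ 𝒬, MeasurableSet (F Q) ∧ F Q ⊆ Q.toSet ∧ volume Q.toSet / 2 ≤ volume (F Q)) ∧
    𝒬.PairwiseDisjoint F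

/-- The average `⟨|f|⟩_{Q,p} = (|Q|⁻¹ ∫_Q |f|^p)^{1/p}`, with values in `[0, ∞]`. -/
def lpAvg {n : ℕ} (Q : Cube n) (p : ℝ) (f : EuclideanSpace ℝ (Fin n) → ℂ) : ℝ≥0∞ :=
  ((volume Q.toSet)⁻¹ * ∫⁻ x in Q.toSet, ‖f x‖ₑ ^ p) ^ (1 / p)

/-- The pieces `f_Q^m` of `f` on `Q`: `f_Q^0` is the part where `|f| ≤ ⟨|f|⟩_{Q,p}`, and for
`m > 0`, `f_Q^m` is the part where `2^{m-1} ⟨|f|⟩_{Q,p} < |f| ≤ 2^m ⟨|f|⟩_{Q,p}`. -/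
def levelPiece {n : ℕ} (Q : Cube n) (p : ℝ) (f : EuclideanSpace ℝ (Fin n) → ℂ) :
    ℕ → EuclideanSpace ℝ (Fin n) → ℂ
  | 0 => {x | x ∈ Q.toSet ∧ ‖f x‖ₑ ≤ lpAvg Q p f}.indicator f
  | m + 1 => {x | x ∈ Q.toSet ∧ 2 ^ m * lpAvg Q p f < ‖f x‖ₑ ∧
      ‖f x‖ₑ ≤ 2 ^ (m + 1) * lpAvg Q p f}.indicator f

/-- The restricted-type `L^p (log L)^4` average
`⟨|f|⟩_{Q,p⁺} = ∑_{m ≥ 0} (m+1)^4 ⟨|f_Q^m|⟩_{Q,p}`. -/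
def plusAvg {n : ℕ} (Q : Cube n) (p : ℝ) (f : EuclideanSpace ℝ (Fin n) → ℂ) : ℝ≥0∞ :=
  ∑' m : ℕ, ((m : ℝ≥0∞) + 1) ^ 4 * lpAvg Q p (levelPiece Q p f m)

/-- The dilated measure `σ_j`, with `∫ f dσ_j = ∫ f(2^j x) dσ(x)`. -/
def dilate {n : ℕ} (σ : Measure (EuclideanSpace ℝ (Fin n))) (j : ℤ) :
    Measure (EuclideanSpace ℝ (Fin n)) :=
  σ.map (fun x => (2 : ℝ) ^ j • x)

/-- The lacunary maximal average `T^*[f](x) = sup_{j ∈ ℤ} (σ_j * |f|)(x)`, with values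
in `[0, ∞]`. -/
def maximalAvg {n : ℕ} (σ : Measure (EuclideanSpace ℝ (Fin n)))
    (f : EuclideanSpace ℝ (Fin n) → ℂ) (x : EuclideanSpace ℝ (Fin n)) : ℝ≥0∞ :=
  ⨆ j : ℤ, ∫⁻ y, ‖f (x - y)‖ₑ ∂(dilate σ j)

/-- The convolution `(σ * f)(x) = ∫ f(x - y) dσ(y)` of a measure and a function. -/
def measureConv {n : ℕ} (σ : Measure (EuclideanSpace ℝ (Fin n)))
    (f : EuclideanSpace ℝ (Fin n) → ℂ) (x : EuclideanSpace ℝ (Fin n)) : ℂ :=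
  ∫ y, f (x - y) ∂σ

/-- Convolution with `σ` is a bounded operator from `L^p` to `L^q`. -/
def ConvBounded {n : ℕ} (σ : Measure (EuclideanSpace ℝ (Fin n))) (p q : ℝ) : Prop :=
  ∃ A : ℝ≥0, ∀ f : EuclideanSpace ℝ (Fin n) → ℂ, MemLp f (ENNReal.ofReal p) volume →
    MemLp (measureConv σ f) (ENNReal.ofReal q) volume ∧
    eLpNorm (measureConv σ f) (ENNReal.ofReal q) volume ≤
      A * eLpNorm f (ENNReal.ofReal p) volume

/-- The Fourier transform of `σ` is `O(|ξ|^{-α})`. The normalization `∫ e^{i x·ξ} dσ(x)` of the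
Fourier transform is the one of `charFun`; any other one changes only the constant. -/
def HasFourierDecay {n : ℕ} (σ : Measure (EuclideanSpace ℝ (Fin n))) (α : ℝ) : Prop :=
  ∃ A : ℝ, ∀ ξ : EuclideanSpace ℝ (Fin n), ξ ≠ 0 → ‖charFun σ ξ‖ ≤ A * ‖ξ‖ ^ (-α)

end SparseMaximal

end

/-! The sparse family comes from a stopping time on a dyadic grid that stops `f₁` only. Fix a grid
cube containing both supports. From a cube `Q`, descend to the maximal dyadic subcubes `R` on which
some level piece of `f₁` relative to `Q` satisfies `|R|⁻¹ ∫_R |f_Q^m|^p > 4 (m+1)²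
⟨|f_Q^m|⟩_{Q,p}^p`. Since `∑ 1/(4(m+1)²) = π²/24 < 1/2`, these subcubes cover at most half of `Q`
(`volume_stoppingFamily_le`), so iterating gives a sparse collection. Averages at scales larger than
the initial cube are assigned to the growing cubes with the same corner, one for each scale, and
need only the improving bound and Hölder (`exists_single_scale_bound`).

For a scale `2^j` inside the initial cube, every point is regular, down to that scale, for some
stopping cube (`exists_mem_regularSet`). Hence `σ_j * |f₁|` is at most a sum over stopping cubes `Q`
of `σ_j * (|f₁| 1_W)`, where `W` is the regular set of `Q` down to scale `2^j`, and each term lives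
on `3Q` (`iSup_dilateConv_le`). What remains is one estimate per cube (`exists_regular_bound`),
obtained by summing `exists_localized_bound` over pairs of level pieces of `f₁` on `Q` and of `f₂`
on `3Q`.

For the pair `(m, l)`, with pieces of size at most `4^m a` and `4^l b`, let `W_t` be the regular set
at scale `2^{J-t}` and let `N` be a large multiple of `m + l`. On `W_t \ W_{t+N}` the supremum over
scales is replaced by an `ℓ^q` sum; the `L^p → L^q` bound applies scale by scale, and each point is
counted at most `N` times. On `W_{t+N}` a Calderón–Zygmund splitting along the shells `W_i \
W_{i+1}` gives means, bounded by the stopping rule, and fluctuations with mean zero on cubes more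
than `N` generations below the averaging scale. By `exists_l2_decay` such fluctuations gain
geometrically in `L²`: cancellation treats low frequencies and the decay of `σ̂` treats high ones.
The gain over `N` generations cancels `4^{m+l}`, so the loss in `(m, l)` is polynomial and is paid
for by the weights `(m+1)^4`, `(l+1)^4` of the averages. -/

noncomputable section

namespace SparseMaximal

/-! ### Plancherel's identity and the geometry of dyadic cubes. -/

section

/-- Plancherel's identity for functions in `L¹ ∩ L²`, in terms of the Fourier integral. -/
theorem lintegral_enorm_fourier_sq {E : Type*} [NormedAddCommGroup E] [InnerProductSpace ℝ E]
    [FiniteDimensional ℝ E] [MeasurableSpace E] [BorelSpace E] {F : E → ℂ}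
    (h1 : Integrable F) (h2 : MemLp F 2) :
    ∫⁻ ξ, ‖FourierTransform.fourier F ξ‖ₑ ^ (2 : ℝ) = ∫⁻ x, ‖F x‖ₑ ^ (2 : ℝ) := by
  have hcont : Continuous (FourierTransform.fourier F) :=
    VectorFourier.fourierIntegral_continuous Real.continuous_fourierChar
      (by exact continuous_inner) h1
  set G : Lp ℂ 2 (volume : Measure E) := h2.toLp F with hG
  have hGF : (G : E → ℂ) =ᵐ[volume] F := h2.coeFn_toLp
  -- The `L²` transform and the Fourier integral have the same pairing with every test function:
  -- both move the transform onto the test function.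
  have key : ((FourierTransform.fourier G : Lp ℂ 2 (volume : Measure E)) : E → ℂ)
      =ᵐ[volume] FourierTransform.fourier F := by
    refine ae_eq_of_integral_contDiff_smul_eq ?_ hcont.locallyIntegrable ?_
    · exact (Lp.memLp _).locallyIntegrable (by norm_num)
    intro g hg hgs
    have hg' : ContDiff ℝ (⊤ : ℕ∞) (fun x => (g x : ℂ)) := Complex.ofRealCLM.contDiff.comp hg
    have hgs' : HasCompactSupport (fun x => (g x : ℂ)) := hgs.comp_left (g := fun t : ℝ => (t : ℂ)) rfl
    set φ := hgs'.toSchwartzMap hg' with hφ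
    have e := congrArg (fun T => T φ) (Lp.fourier_toTemperedDistribution_eq G)
    simp only [TemperedDistribution.fourier_apply, Lp.toTemperedDistribution_apply] at e
    have e2 : ∫ x, FourierTransform.fourier φ x • (G : E → ℂ) x
        = ∫ x, φ x • FourierTransform.fourier F x := by
      rw [integral_congr_ae (g := fun x => FourierTransform.fourier (φ : E → ℂ) x • F x)]
      · have := VectorFourier.integral_fourierIntegral_smul_eq_flip (μ := (volume : Measure E))
          (ν := (volume : Measure E)) (L := innerₗ E) (f := (φ : E → ℂ)) (g := F)
          Real.continuous_fourierChar (by exact continuous_inner) φ.integrable h1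
        rw [flip_innerₗ] at this
        exact this
      · filter_upwards [hGF] with x hx
        rw [hx, SchwartzMap.fourier_coe]
    rw [e2] at e
    simpa [hφ, Complex.real_smul] using e.symm
  have n := Lp.norm_fourier_eq G
  have n2 : eLpNorm (FourierTransform.fourier F) 2 volume = eLpNorm F 2 volume := by
    rw [← eLpNorm_congr_ae key, ← eLpNorm_congr_ae hGF]
    have := congrArg ENNReal.ofReal n
    rwa [Lp.norm_def, Lp.norm_def, ENNReal.ofReal_toReal (Lp.eLpNorm_ne_top _),
      ENNReal.ofReal_toReal (Lp.eLpNorm_ne_top _)] at this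
  rw [eLpNorm_eq_lintegral_rpow_enorm_toReal (by norm_num) (by norm_num),
    eLpNorm_eq_lintegral_rpow_enorm_toReal (by norm_num) (by norm_num)] at n2
  exact (ENNReal.rpow_left_injective (x := 1 / 2) (by norm_num)) (by simpa using n2)

variable {n : ℕ}

/-- The half-open dyadic cube `c + 2^k z + [0, 2^k)ⁿ` of the grid with origin `c`. -/
def dyadicCube (c : EuclideanSpace ℝ (Fin n)) (k : ℤ) (z : Fin n → ℤ) : Cube n where
  corner := WithLp.toLp 2 (fun i => c i + (2 : ℝ) ^ k * z i)
  side := (2 : ℝ) ^ k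
  side_pos := by positivity

/-- The index of the dyadic cube of sidelength `2^k` that contains `x`. -/
def dyadicIndex (c : EuclideanSpace ℝ (Fin n)) (k : ℤ) (x : EuclideanSpace ℝ (Fin n)) :
    Fin n → ℤ := fun i => ⌊(x i - c i) / (2 : ℝ) ^ k⌋

theorem mem_dyadicCube {c : EuclideanSpace ℝ (Fin n)} {k : ℤ} {z : Fin n → ℤ}
    {x : EuclideanSpace ℝ (Fin n)} :
    x ∈ (dyadicCube c k z).toSet ↔ dyadicIndex c k x = z := by
  have h2 : (0 : ℝ) < 2 ^ k := by positivity
  simp only [Cube.toSet, dyadicCube, dyadicIndex, Set.mem_ofPred_eq, funext_iff]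
  refine forall_congr' fun i => ?_
  rw [Int.floor_eq_iff, le_div_iff₀ h2, div_lt_iff₀ h2]
  constructor
  · rintro ⟨h, h'⟩; constructor <;> nlinarith
  · rintro ⟨h, h'⟩; constructor <;> nlinarith

theorem mem_dyadicCube_index (c : EuclideanSpace ℝ (Fin n)) (k : ℤ)
    (x : EuclideanSpace ℝ (Fin n)) : x ∈ (dyadicCube c k (dyadicIndex c k x)).toSet :=
  mem_dyadicCube.2 rfl

/-- Floors compose under division by a positive integer, so passing to a coarser scale is integer
division of indices; nesting of cubes follows. -/
theorem dyadicIndex_of_le (c : EuclideanSpace ℝ (Fin n)) {k j : ℤ} (hkj : k ≤ j)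
    (x : EuclideanSpace ℝ (Fin n)) (i : Fin n) :
    dyadicIndex c j x i = dyadicIndex c k x i / ((2 ^ (j - k).toNat : ℕ) : ℤ) := by
  simp only [dyadicIndex]
  rw [← Int.floor_div_natCast, div_div]
  congr 2
  push_cast
  rw [← zpow_natCast, Int.toNat_of_nonneg (by omega), ← zpow_add₀ (by norm_num)]
  congr 1; ring

theorem dyadicIndex_eq_of_le {c : EuclideanSpace ℝ (Fin n)} {k j : ℤ} (hkj : k ≤ j)
    {x y : EuclideanSpace ℝ (Fin n)} (h : dyadicIndex c k x = dyadicIndex c k y) :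
    dyadicIndex c j x = dyadicIndex c j y := by
  ext i
  rw [dyadicIndex_of_le c hkj, dyadicIndex_of_le c hkj, h]

theorem Cube.measurableSet_toSet (Q : Cube n) : MeasurableSet Q.toSet := by
  have : Q.toSet = ⋂ i, {x : EuclideanSpace ℝ (Fin n) |
      Q.corner i ≤ x i ∧ x i < Q.corner i + Q.side} := by
    ext x; simp [Cube.toSet]
  rw [this]
  refine MeasurableSet.iInter fun i => ?_
  have hi : Measurable fun x : EuclideanSpace ℝ (Fin n) => x i := by fun_prop
  exact (measurableSet_le measurable_const hi).inter (measurableSet_lt hi measurable_const)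

theorem Cube.volume_toSet (Q : Cube n) : volume Q.toSet = ENNReal.ofReal Q.side ^ n := by
  have h := (EuclideanSpace.volume_preserving_symm_measurableEquiv_toLp (Fin n)).measure_preimage
    (s := Set.pi Set.univ fun i => Set.Ico (Q.corner i) (Q.corner i + Q.side))
    (MeasurableSet.univ_pi fun i => measurableSet_Ico).nullMeasurableSet
  have e : Q.toSet = (MeasurableEquiv.toLp 2 (Fin n → ℝ)).symm ⁻¹'
      (Set.pi Set.univ fun i => Set.Ico (Q.corner i) (Q.corner i + Q.side)) := by
    ext x; simp [Cube.toSet]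
  rw [e, h, Real.volume_pi_Ico]
  simp

theorem Cube.volume_pos (Q : Cube n) : 0 < volume Q.toSet := by
  rw [Q.volume_toSet]
  exact ENNReal.pow_pos (ENNReal.ofReal_pos.2 Q.side_pos) n

theorem Cube.volume_ne_zero (Q : Cube n) : volume Q.toSet ≠ 0 := Q.volume_pos.ne'

theorem Cube.volume_ne_top (Q : Cube n) : volume Q.toSet ≠ ∞ := by
  rw [Q.volume_toSet]
  exact ENNReal.pow_ne_top ENNReal.ofReal_ne_top

theorem Cube.volume_triple (Q : Cube n) :
    volume Q.triple.toSet = 3 ^ n * volume Q.toSet := by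
  rw [Cube.volume_toSet, Cube.volume_toSet, ← mul_pow]
  simp only [Cube.triple]
  rw [ENNReal.ofReal_mul (by norm_num)]
  simp

/-- The volume of a dyadic cube of sidelength `2^k`. -/
def dyadicVolume (n : ℕ) (k : ℤ) : ℝ≥0∞ := ENNReal.ofReal ((2 : ℝ) ^ k) ^ n

theorem volume_dyadicCube (c : EuclideanSpace ℝ (Fin n)) (k : ℤ) (z : Fin n → ℤ) :
    volume (dyadicCube c k z).toSet = dyadicVolume n k := Cube.volume_toSet _

theorem dyadicVolume_ne_zero (n : ℕ) (k : ℤ) : dyadicVolume n k ≠ 0 :=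
  (ENNReal.pow_pos (ENNReal.ofReal_pos.2 (by positivity)) n).ne'

theorem dyadicVolume_ne_top (n : ℕ) (k : ℤ) : dyadicVolume n k ≠ ∞ :=
  ENNReal.pow_ne_top ENNReal.ofReal_ne_top

theorem dyadicVolume_succ (n : ℕ) (k : ℤ) :
    dyadicVolume n (k + 1) = 2 ^ n * dyadicVolume n k := by
  rw [dyadicVolume, dyadicVolume, ← mul_pow, zpow_add₀ (by norm_num), mul_comm,
    ENNReal.ofReal_mul (by positivity)]
  simp

theorem measurable_dyadicIndex (c : EuclideanSpace ℝ (Fin n)) (k : ℤ) :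
    Measurable (dyadicIndex c k) := by
  refine measurable_pi_lambda _ fun i => ?_
  exact Int.measurable_floor.comp (by fun_prop)

theorem lintegral_eq_tsum_dyadicCube (c : EuclideanSpace ℝ (Fin n)) (k : ℤ)
    (F : EuclideanSpace ℝ (Fin n) → ℝ≥0∞) :
    ∫⁻ x, F x = ∑' z, ∫⁻ x in (dyadicCube c k z).toSet, F x := by
  rw [← lintegral_iUnion (fun z => Cube.measurableSet_toSet _), ← setLIntegral_univ]
  · congr 2
    exact (Set.eq_univ_of_forall fun x =>
      Set.mem_iUnion.2 ⟨dyadicIndex c k x, mem_dyadicCube_index c k x⟩).symm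
  · intro z w hzw
    refine Set.disjoint_left.2 fun x hx hy => hzw ?_
    rw [← mem_dyadicCube.1 hx, mem_dyadicCube.1 hy]

/-- The side determines the level and the corner lies in only one cube of that level. This permits
sums over cubes to be taken over indices. -/
theorem dyadicCube_injective (c : EuclideanSpace ℝ (Fin n)) :
    Function.Injective fun d : ℤ × (Fin n → ℤ) => dyadicCube c d.1 d.2 := by
  rintro ⟨k, z⟩ ⟨j, w⟩ h
  have hs : k = j := by
    have := congrArg Cube.side h
    simpa [dyadicCube] using this
  subst hs
  have hx : (dyadicCube c k z).corner ∈ (dyadicCube c k z).toSet := fun i =>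
    ⟨le_rfl, by linarith [(dyadicCube c k z).side_pos]⟩
  have hy : (dyadicCube c k z).corner ∈ (dyadicCube c k w).toSet := by
    have h' : dyadicCube c k z = dyadicCube c k w := h
    rwa [← h']
  rw [← mem_dyadicCube.1 hx, mem_dyadicCube.1 hy]

/-- Dyadic cubes are nested. -/
theorem dyadicCube_subset {c : EuclideanSpace ℝ (Fin n)} {k j : ℤ} (hkj : k ≤ j)
    {z w : Fin n → ℤ} {x : EuclideanSpace ℝ (Fin n)} (hx : x ∈ (dyadicCube c k z).toSet)
    (hx' : x ∈ (dyadicCube c j w).toSet) : (dyadicCube c k z).toSet ⊆ (dyadicCube c j w).toSet := by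
  intro y hy
  rw [mem_dyadicCube] at *
  rw [← hx']
  exact dyadicIndex_eq_of_le hkj (hy.trans hx.symm)

end

/-! ### Convolution with dilates, locality, and the rescaled improving bound. -/

section

variable {n : ℕ}

/-- The convolution `σ_j * h` of a dilate of `σ` with a nonnegative function. -/
def dilateConv (σ : Measure (EuclideanSpace ℝ (Fin n))) (j : ℤ)
    (h : EuclideanSpace ℝ (Fin n) → ℝ≥0∞) (x : EuclideanSpace ℝ (Fin n)) : ℝ≥0∞ :=
  ∫⁻ y, h (x - y) ∂(dilate σ j)

instance isFiniteMeasure_dilate (σ : Measure (EuclideanSpace ℝ (Fin n))) [IsFiniteMeasure σ]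
    (j : ℤ) : IsFiniteMeasure (dilate σ j) := by
  unfold dilate; infer_instance

theorem dilate_univ (σ : Measure (EuclideanSpace ℝ (Fin n))) (j : ℤ) :
    dilate σ j Set.univ = σ Set.univ := by
  rw [dilate, Measure.map_apply (by fun_prop) MeasurableSet.univ, Set.preimage_univ]

theorem lintegral_dilate (σ : Measure (EuclideanSpace ℝ (Fin n))) (j : ℤ)
    {h : EuclideanSpace ℝ (Fin n) → ℝ≥0∞} (hh : Measurable h) :
    ∫⁻ y, h y ∂(dilate σ j) = ∫⁻ y, h ((2 : ℝ) ^ j • y) ∂σ := by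
  rw [dilate, lintegral_map hh (by fun_prop)]

theorem ae_dilate_abs_le (σ : Measure (EuclideanSpace ℝ (Fin n)))
    (hsupp : σ (Metric.closedBall 0 1)ᶜ = 0) (j : ℤ) :
    ∀ᵐ y ∂(dilate σ j), ∀ i, |y i| ≤ (2 : ℝ) ^ j := by
  have hm : MeasurableSet {y : EuclideanSpace ℝ (Fin n) | ∀ i, |y i| ≤ (2 : ℝ) ^ j} := by
    have : {y : EuclideanSpace ℝ (Fin n) | ∀ i, |y i| ≤ (2 : ℝ) ^ j}
        = ⋂ i, {y : EuclideanSpace ℝ (Fin n) | |y i| ≤ (2 : ℝ) ^ j} := by ext; simp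
    rw [this]
    refine MeasurableSet.iInter fun i => ?_
    have hi : Measurable fun x : EuclideanSpace ℝ (Fin n) => |x i| := by fun_prop
    exact measurableSet_le hi measurable_const
  rw [dilate, ae_map_iff (by fun_prop) hm]
  have h1 : ∀ᵐ y ∂σ, y ∈ Metric.closedBall (0 : EuclideanSpace ℝ (Fin n)) 1 := hsupp
  filter_upwards [h1] with y hy i
  rw [mem_closedBall_zero_iff] at hy
  have h3 : |y i| ≤ 1 := (PiLp.norm_apply_le y i).trans hy
  have h2 : (0 : ℝ) < 2 ^ j := by positivity
  simp only [PiLp.smul_apply, smul_eq_mul, abs_mul, abs_of_pos h2]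
  nlinarith

variable {σ : Measure (EuclideanSpace ℝ (Fin n))}

theorem measurable_dilateConv [IsFiniteMeasure σ] (j : ℤ)
    {h : EuclideanSpace ℝ (Fin n) → ℝ≥0∞} (hh : Measurable h) :
    Measurable (dilateConv σ j h) := by
  unfold dilateConv
  exact Measurable.lintegral_prod_right' (f := fun z : _ × _ => h (z.1 - z.2)) (by fun_prop)

theorem dilateConv_mono (j : ℤ) {h h' : EuclideanSpace ℝ (Fin n) → ℝ≥0∞} (hh : ∀ x, h x ≤ h' x)
    (x : EuclideanSpace ℝ (Fin n)) : dilateConv σ j h x ≤ dilateConv σ j h' x :=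
  lintegral_mono fun _ => hh _

theorem dilateConv_add (j : ℤ) {h h' : EuclideanSpace ℝ (Fin n) → ℝ≥0∞} (hh : Measurable h)
    (x : EuclideanSpace ℝ (Fin n)) :
    dilateConv σ j (fun y => h y + h' y) x = dilateConv σ j h x + dilateConv σ j h' x :=
  lintegral_add_left (by fun_prop) _

theorem dilateConv_tsum {ι : Type*} [Countable ι] (j : ℤ)
    {h : ι → EuclideanSpace ℝ (Fin n) → ℝ≥0∞} (hh : ∀ i, Measurable (h i))
    (x : EuclideanSpace ℝ (Fin n)) :
    dilateConv σ j (fun y => ∑' i, h i y) x = ∑' i, dilateConv σ j (h i) x := by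
  unfold dilateConv
  rw [lintegral_tsum]
  intro i
  have := hh i
  fun_prop

/-- As `σ` may be singular, a Lebesgue null set `N` can have positive `σ_j` measure. But by Fubini
the integral over `x` of the `σ_j` measure of `x - N` is a multiple of `|N| = 0`, so almost every
translate is harmless. -/
theorem dilateConv_ae_congr [IsFiniteMeasure σ] (j : ℤ)
    {h h' : EuclideanSpace ℝ (Fin n) → ℝ≥0∞} (hh : h =ᵐ[volume] h') :
    dilateConv σ j h =ᵐ[volume] dilateConv σ j h' := by
  obtain ⟨N, hN, hNm, hN0⟩ := exists_measurable_superset_of_null (ae_iff.1 hh)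
  have hm : Measurable (N.indicator (fun _ => (1 : ℝ≥0∞))) := measurable_const.indicator hNm
  have h0 : ∫⁻ x, dilateConv σ j (N.indicator (fun _ => (1 : ℝ≥0∞))) x = 0 := by
    unfold dilateConv
    rw [lintegral_lintegral_swap (by fun_prop)]
    have : ∀ y, ∫⁻ x, N.indicator (fun _ => (1 : ℝ≥0∞)) (x - y) ∂(volume) = 0 := by
      intro y
      rw [lintegral_sub_right_eq_self (fun x => N.indicator (fun _ => (1 : ℝ≥0∞)) x) y,
        lintegral_indicator hNm]
      simp [hN0]
    simp [this]
  rw [lintegral_eq_zero_iff (measurable_dilateConv j hm)] at h0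
  filter_upwards [h0] with x hx
  have hx' : ∫⁻ y, N.indicator (fun _ => (1 : ℝ≥0∞)) (x - y) ∂(dilate σ j) = 0 := hx
  rw [lintegral_eq_zero_iff (by fun_prop)] at hx'
  refine lintegral_congr_ae ?_
  filter_upwards [hx'] with y hy
  by_contra hne
  have : x - y ∈ N := hN hne
  simp [this] at hy

theorem dilateConv_eq_zero (hsupp : σ (Metric.closedBall 0 1)ᶜ = 0) {j k : ℤ} (hjk : j ≤ k)
    {c : EuclideanSpace ℝ (Fin n)} {z : Fin n → ℤ} {h : EuclideanSpace ℝ (Fin n) → ℝ≥0∞}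
    (hh : ∀ x ∉ (dyadicCube c k z).toSet, h x = 0) {x : EuclideanSpace ℝ (Fin n)}
    (hx : x ∉ (dyadicCube c k z).triple.toSet) : dilateConv σ j h x = 0 := by
  unfold dilateConv
  rw [lintegral_eq_zero_of_ae_eq_zero]
  filter_upwards [ae_dilate_abs_le σ hsupp j] with y hy
  refine hh _ fun hxy => hx fun i => ?_
  have h1 := hxy i
  have h3 : (2 : ℝ) ^ j ≤ 2 ^ k := zpow_le_zpow_right₀ (by norm_num) hjk
  have h2 := abs_le.1 ((hy i).trans h3)
  simp only [Cube.triple, dyadicCube, PiLp.sub_apply] at h1 ⊢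
  constructor <;> linarith

/-- The index shifts by which neighbouring dyadic cubes differ. -/
def neighborShifts (n : ℕ) : Finset (Fin n → ℤ) := Fintype.piFinset fun _ => Finset.Icc (-1) 1

theorem card_neighborShifts (n : ℕ) : (neighborShifts n).card = 3 ^ n := by
  simp [neighborShifts]

theorem dyadicIndex_sub_mem (c : EuclideanSpace ℝ (Fin n)) (j : ℤ)
    {x y : EuclideanSpace ℝ (Fin n)} (hy : ∀ i, |y i| ≤ (2 : ℝ) ^ j) :
    dyadicIndex c j (x - y) - dyadicIndex c j x ∈ neighborShifts n := by
  simp only [neighborShifts, Fintype.mem_piFinset, Finset.mem_Icc, Pi.sub_apply, dyadicIndex,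
    PiLp.sub_apply]
  intro i
  have h2 : (0 : ℝ) < 2 ^ j := by positivity
  have h1 := abs_le.1 (hy i)
  have e : (x i - y i - c i) / (2 : ℝ) ^ j = (x i - c i) / 2 ^ j - y i / 2 ^ j := by ring
  have a1 : y i / 2 ^ j ≤ 1 := (div_le_one h2).2 h1.2
  have a2 : -1 ≤ y i / 2 ^ j := by rw [le_div_iff₀ h2]; linarith
  rw [e]
  set t := (x i - c i) / (2 : ℝ) ^ j
  have b1 : ⌊t - y i / 2 ^ j⌋ ≤ ⌊t⌋ + 1 := by
    rw [← Int.floor_add_one]; exact Int.floor_mono (by linarith)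
  have b2 : ⌊t⌋ - 1 ≤ ⌊t - y i / 2 ^ j⌋ := by
    rw [← Int.floor_sub_one]; exact Int.floor_mono (by linarith)
  omega

/-- Convexity of `t ↦ t^r` over `3^n` terms gives the constant. Extending the sum to all shifts
turns it into a sum over all cubes, independent of the cube containing `x`. -/
theorem rpow_lintegral_le_of_neighbor (c : EuclideanSpace ℝ (Fin n)) (j : ℤ)
    {φ : EuclideanSpace ℝ (Fin n) → ℝ≥0∞} {ψ : (Fin n → ℤ) → EuclideanSpace ℝ (Fin n) → ℝ≥0∞}
    (hψ : ∀ z, Measurable (ψ z)) {r : ℝ} (hr : 1 ≤ r)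
    (h : ∀ x, φ x ≤ ∑ e ∈ neighborShifts n, ψ (dyadicIndex c j x + e) x) :
    ∫⁻ x, φ x ^ r ≤ ((3 : ℝ≥0∞) ^ n) ^ (r - 1) * ∑' z, ∫⁻ x, ψ z x ^ r := by
  rw [← lintegral_tsum (fun z => ((hψ z).pow_const r).aemeasurable),
    ← lintegral_const_mul' _ _ (by
      refine ENNReal.rpow_ne_top_of_nonneg (by linarith) (ENNReal.pow_ne_top (by norm_num)))]
  refine lintegral_mono fun x => ?_
  calc φ x ^ r ≤ (∑ e ∈ neighborShifts n, ψ (dyadicIndex c j x + e) x) ^ r :=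
        ENNReal.rpow_le_rpow (h x) (by linarith)
    _ ≤ ((neighborShifts n).card : ℝ≥0∞) ^ (r - 1) *
        ∑ e ∈ neighborShifts n, ψ (dyadicIndex c j x + e) x ^ r :=
        ENNReal.rpow_sum_le_const_mul_sum_rpow _ _ hr
    _ ≤ _ := by
      rw [card_neighborShifts]
      push_cast
      gcongr
      calc ∑ e ∈ neighborShifts n, ψ (dyadicIndex c j x + e) x ^ r
          ≤ ∑' e, ψ (dyadicIndex c j x + e) x ^ r := ENNReal.sum_le_tsum _
        _ = ∑' z, ψ z x ^ r :=
          (Equiv.addLeft (dyadicIndex c j x)).tsum_eq (fun z => ψ z x ^ r)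

/-- On the support of `σ_j` every coordinate moves by at most `2^j`, one side of a cube, so only
adjacent cubes contribute. -/
theorem dilateConv_le_sum_neighbor (hsupp : σ (Metric.closedBall 0 1)ᶜ = 0) (j : ℤ)
    (c : EuclideanSpace ℝ (Fin n)) {h : EuclideanSpace ℝ (Fin n) → ℝ≥0∞} (hh : Measurable h)
    (x : EuclideanSpace ℝ (Fin n)) :
    dilateConv σ j h x ≤ ∑ e ∈ neighborShifts n,
      dilateConv σ j ((dyadicCube c j (dyadicIndex c j x + e)).toSet.indicator h) x := by
  unfold dilateConv
  rw [← lintegral_finsetSum]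
  · refine lintegral_mono_ae ?_
    filter_upwards [ae_dilate_abs_le σ hsupp j] with y hy
    refine le_trans ?_ (Finset.single_le_sum (fun _ _ => zero_le) (dyadicIndex_sub_mem c j (x := x) hy))
    rw [Set.indicator_of_mem]
    rw [mem_dyadicCube]; abel
  · intro e _
    have := hh.indicator (Cube.measurableSet_toSet (dyadicCube c j (dyadicIndex c j x + e)))
    fun_prop

theorem lintegral_comp_dilation (j : ℤ) {F : EuclideanSpace ℝ (Fin n) → ℝ≥0∞}
    (hF : Measurable F) :
    ∫⁻ x, F x = dyadicVolume n j * ∫⁻ x, F ((2 : ℝ) ^ j • x) := by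
  have h2 : (0 : ℝ) < 2 ^ j := by positivity
  have := Measure.map_addHaar_smul (volume : Measure (EuclideanSpace ℝ (Fin n))) h2.ne'
  rw [← lintegral_map (μ := volume) hF (g := fun x => (2 : ℝ) ^ j • x) (by fun_prop), this,
    lintegral_smul_measure, smul_eq_mul, ← mul_assoc]
  have e : dyadicVolume n j * ENNReal.ofReal
      |((2 ^ j) ^ Module.finrank ℝ (EuclideanSpace ℝ (Fin n)))⁻¹| = 1 := by
    rw [finrank_euclideanSpace_fin, dyadicVolume, abs_of_pos (by positivity),
      ← ENNReal.ofReal_pow h2.le, ← ENNReal.ofReal_mul (by positivity), mul_inv_cancel₀ (by positivity)]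
    simp
  rw [e, one_mul]

theorem enorm_complex_ofReal (t : ℝ) : ‖(t : ℂ)‖ₑ = ‖t‖ₑ := by
  rw [← ofReal_norm, ← ofReal_norm, Complex.norm_real]

/-- The scaled `L^p → L^q` estimate for nonnegative bounded functions. -/
theorem exists_lintegral_dilateConv_rpow_le [IsFiniteMeasure σ] {p q : ℝ} (hp : 1 < p) (hpq : p < q)
    (hconv : ConvBounded σ p q) :
    ∃ A : ℝ≥0, ∀ (j : ℤ) (h : EuclideanSpace ℝ (Fin n) → ℝ≥0∞) (H : ℝ≥0), Measurable h →
      (∀ x, h x ≤ H) → ∫⁻ x, h x ^ p ≠ ∞ →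
      ∫⁻ x, dilateConv σ j h x ^ q ≤
        (A : ℝ≥0∞) ^ q * dyadicVolume n j * ((dyadicVolume n j)⁻¹ * ∫⁻ x, h x ^ p) ^ (q / p) := by
  obtain ⟨A, hA⟩ := hconv
  have hp0 : 0 < p := by linarith
  have hq0 : 0 < q := by linarith
  refine ⟨A, ?_⟩
  -- Scale `j = 0`. The hypothesis concerns Bochner integrals of complex functions; boundedness of
  -- `h` and finiteness of `σ` make the integral defining the convolution finite, so that it agrees
  -- with the lower integral.
  have unit : ∀ (h : EuclideanSpace ℝ (Fin n) → ℝ≥0∞) (H : ℝ≥0), Measurable h →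
      (∀ x, h x ≤ H) → ∫⁻ x, h x ^ p ≠ ∞ →
      ∫⁻ x, (∫⁻ y, h (x - y) ∂σ) ^ q ≤ (A : ℝ≥0∞) ^ q * (∫⁻ x, h x ^ p) ^ (q / p) := by
    intro h H hm hH hfin
    have hlt : ∀ x, h x < ∞ := fun x => (hH x).trans_lt ENNReal.coe_lt_top
    set f : EuclideanSpace ℝ (Fin n) → ℂ := fun x => ((h x).toReal : ℂ) with hf
    have hfm : Measurable f := by fun_prop
    have hfe : ∀ x, ‖f x‖ₑ = h x := by
      intro x
      rw [hf]
      simp only [enorm_complex_ofReal]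
      rw [Real.enorm_of_nonneg ENNReal.toReal_nonneg, ENNReal.ofReal_toReal (hlt x).ne]
    have hnorm : eLpNorm f (ENNReal.ofReal p) volume = (∫⁻ x, h x ^ p) ^ (1 / p) := by
      rw [eLpNorm_eq_lintegral_rpow_enorm_toReal (by simpa using hp0) (by simp),
        ENNReal.toReal_ofReal hp0.le]
      simp [hfe]
    have hmem : MemLp f (ENNReal.ofReal p) volume := by
      refine ⟨hfm.aestronglyMeasurable, ?_⟩
      rw [hnorm]
      exact ENNReal.rpow_lt_top_of_nonneg (by positivity) hfin
    obtain ⟨-, h2⟩ := hA f hmem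
    have hcv : ∀ x, ‖measureConv σ f x‖ₑ = ∫⁻ y, h (x - y) ∂σ := by
      intro x
      unfold measureConv
      rw [hf]
      simp only
      rw [integral_complex_ofReal, integral_toReal (by fun_prop) (by simp [hlt])]
      rw [enorm_complex_ofReal, Real.enorm_of_nonneg ENNReal.toReal_nonneg, ENNReal.ofReal_toReal]
      refine ne_of_lt ?_
      calc ∫⁻ y, h (x - y) ∂σ ≤ ∫⁻ _, H ∂σ := lintegral_mono fun _ => hH _
        _ < ∞ := by rw [lintegral_const]; exact ENNReal.mul_lt_top ENNReal.coe_lt_top (measure_lt_top _ _)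
    rw [hnorm, eLpNorm_eq_lintegral_rpow_enorm_toReal (by simpa using hq0) (by simp),
      ENNReal.toReal_ofReal hq0.le] at h2
    simp only [hcv] at h2
    have h3 := ENNReal.rpow_le_rpow h2 hq0.le
    rw [← ENNReal.rpow_mul, one_div_mul_cancel hq0.ne', ENNReal.rpow_one,
      ENNReal.mul_rpow_of_nonneg _ _ hq0.le, ← ENNReal.rpow_mul] at h3
    rwa [one_div_mul_eq_div] at h3
  intro j h H hm hH hfin
  have hV0 := dyadicVolume_ne_zero n j
  have hVt := dyadicVolume_ne_top n j
  set hj : EuclideanSpace ℝ (Fin n) → ℝ≥0∞ := fun x => h ((2 : ℝ) ^ j • x) with hhj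
  have hjm : Measurable hj := by fun_prop
  have e1 : ∫⁻ x, h x ^ p = dyadicVolume n j * ∫⁻ x, hj x ^ p :=
    lintegral_comp_dilation j (F := fun x => h x ^ p) (by fun_prop)
  have e2 : (dyadicVolume n j)⁻¹ * ∫⁻ x, h x ^ p = ∫⁻ x, hj x ^ p := by
    rw [e1, ← mul_assoc, ENNReal.inv_mul_cancel hV0 hVt, one_mul]
  have hmc := measurable_dilateConv (σ := σ) j hm
  rw [lintegral_comp_dilation j (F := fun x => dilateConv σ j h x ^ q) (by fun_prop), e2]
  have e3 : ∀ x, dilateConv σ j h ((2 : ℝ) ^ j • x) = ∫⁻ y, hj (x - y) ∂σ := by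
    intro x
    unfold dilateConv
    rw [lintegral_dilate σ j (h := fun y => h ((2 : ℝ) ^ j • x - y)) (by fun_prop)]
    simp only [hhj, smul_sub]
  simp only [e3]
  calc dyadicVolume n j * ∫⁻ x, (∫⁻ y, hj (x - y) ∂σ) ^ q
      ≤ dyadicVolume n j * ((A : ℝ≥0∞) ^ q * (∫⁻ x, hj x ^ p) ^ (q / p)) := by
        gcongr
        refine unit hj H hjm (fun x => hH _) ?_
        rw [← e2]
        exact ENNReal.mul_ne_top (ENNReal.inv_ne_top.2 hV0) hfin
    _ = _ := by ring

end

/-! ### Fourier transform of convolutions and of functions with vanishing means. -/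

section

variable {n : ℕ} {σ : Measure (EuclideanSpace ℝ (Fin n))}

theorem integrable_prod_sub {μ : Measure (EuclideanSpace ℝ (Fin n))} [IsFiniteMeasure μ]
    {B : EuclideanSpace ℝ (Fin n) → ℂ} (hBm : Measurable B) (hB : Integrable B) :
    Integrable (fun z : EuclideanSpace ℝ (Fin n) × EuclideanSpace ℝ (Fin n) => B (z.1 - z.2))
      (volume.prod μ) := by
  refine ⟨(hBm.comp (by fun_prop)).aestronglyMeasurable, ?_⟩
  rw [hasFiniteIntegral_iff_enorm, lintegral_prod_symm _ (by fun_prop)]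
  have : ∀ y, ∫⁻ x, ‖B (x - y)‖ₑ ∂volume = ∫⁻ x, ‖B x‖ₑ :=
    fun y => lintegral_sub_right_eq_self (fun x => ‖B x‖ₑ) y
  simp only [this, lintegral_const]
  exact ENNReal.mul_lt_top hB.2 (measure_lt_top _ _)

/-- Fubini and a translation. The argument `-(2π) ξ` converts the kernel `e^{i⟨y,·⟩}` of `charFun`
to the kernel `e^{-2πi⟨y,ξ⟩}` of the Fourier integral. -/
theorem fourier_measureConv {μ : Measure (EuclideanSpace ℝ (Fin n))} [IsFiniteMeasure μ]
    {B : EuclideanSpace ℝ (Fin n) → ℂ} (hBm : Measurable B) (hB : Integrable B)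
    (ξ : EuclideanSpace ℝ (Fin n)) :
    FourierTransform.fourier (measureConv μ B) ξ
      = charFun μ (-(2 * Real.pi) • ξ) * FourierTransform.fourier B ξ := by
  rw [Real.fourier_eq', Real.fourier_eq', charFun_apply]
  unfold measureConv
  conv_lhs => simp only [smul_eq_mul, ← integral_const_mul]
  rw [integral_integral_swap]
  · rw [← integral_mul_const]
    refine integral_congr_ae (Filter.Eventually.of_forall fun y => ?_)
    simp only
    rw [← integral_add_right_eq_self _ y, ← integral_const_mul]
    refine integral_congr_ae (Filter.Eventually.of_forall fun x => ?_)
    simp only [add_sub_cancel_right, inner_add_left, inner_smul_right]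
    rw [smul_eq_mul, ← mul_assoc, ← Complex.exp_add]
    congr 2
    push_cast
    ring
  · have h := integrable_prod_sub (μ := μ) hBm hB
    refine h.bdd_mul (c := 1) (f := fun z : EuclideanSpace ℝ (Fin n) × EuclideanSpace ℝ (Fin n) =>
      Complex.exp (((-2 * Real.pi * inner ℝ z.1 ξ : ℝ) : ℂ) * Complex.I)) ?_ ?_
    · exact Continuous.aestronglyMeasurable (by fun_prop)
    · exact Filter.Eventually.of_forall fun z => (Complex.norm_exp_ofReal_mul_I _).le

theorem charFun_dilate (j : ℤ) (ξ : EuclideanSpace ℝ (Fin n)) :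
    charFun (dilate σ j) ξ = charFun σ ((2 : ℝ) ^ j • ξ) := charFun_map_smul _ _

theorem dist_corner_le (c : EuclideanSpace ℝ (Fin n)) (k : ℤ) {w : Fin n → ℤ}
    {x : EuclideanSpace ℝ (Fin n)} (hx : x ∈ (dyadicCube c k w).toSet) :
    ‖x - (dyadicCube c k w).corner‖ ≤ √n * 2 ^ k := by
  have h2 : (0 : ℝ) < 2 ^ k := by positivity
  rw [EuclideanSpace.norm_eq]
  refine Real.sqrt_le_iff.2 ⟨by positivity, ?_⟩
  rw [mul_pow, Real.sq_sqrt (by positivity)]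
  calc ∑ i, ‖(x - (dyadicCube c k w).corner) i‖ ^ 2 ≤ ∑ _i : Fin n, ((2 : ℝ) ^ k) ^ 2 := by
        refine Finset.sum_le_sum fun i _ => ?_
        have h1 := hx i
        have h3 : (dyadicCube c k w).side = 2 ^ k := rfl
        rw [h3] at h1
        have : ‖(x - (dyadicCube c k w).corner) i‖ ≤ 2 ^ k := by
          rw [PiLp.sub_apply, Real.norm_eq_abs, abs_of_nonneg] <;> linarith
        gcongr
    _ = _ := by simp

/-- Low frequencies of a function with vanishing means over small cubes are small. -/
theorem enorm_fourier_le_of_mean_zero (c : EuclideanSpace ℝ (Fin n)) (k : ℤ)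
    {b : EuclideanSpace ℝ (Fin n) → ℝ} (hb : Integrable b)
    (hmean : ∀ w, ∫ x in (dyadicCube c k w).toSet, b x = 0) (ξ : EuclideanSpace ℝ (Fin n)) :
    ‖FourierTransform.fourier (fun x => (b x : ℂ)) ξ‖ₑ ≤
      ENNReal.ofReal (2 * Real.pi * (√n * 2 ^ k) * ‖ξ‖) * ∫⁻ x, ‖b x‖ₑ := by
  have hB : Integrable (fun x => (b x : ℂ)) := hb.ofReal
  -- The phase is frozen at the corner of each small cube. The frozen phase is constant there, so it
  -- integrates to zero against `b`, and only the oscillation of the phase within a small cube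
  -- remains.
  set κ : EuclideanSpace ℝ (Fin n) → EuclideanSpace ℝ (Fin n) := fun x =>
    (dyadicCube c k (dyadicIndex c k x)).corner with hκ
  have hκm : Measurable κ := by
    have h1 := (measurable_of_countable (fun w : Fin n → ℤ => (dyadicCube c k w).corner))
    exact h1.comp (measurable_dyadicIndex c k)
  set e : EuclideanSpace ℝ (Fin n) → ℂ := fun x =>
    Complex.exp (((-2 * Real.pi * inner ℝ x ξ : ℝ) : ℂ) * Complex.I) with he
  have hem : Continuous e := by fun_prop
  have hen : ∀ x, ‖e x‖ ≤ 1 := fun x => (Complex.norm_exp_ofReal_mul_I _).le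
  have i1 : Integrable (fun x => e x * (b x : ℂ)) :=
    hB.bdd_mul hem.aestronglyMeasurable (Filter.Eventually.of_forall hen)
  have i2 : Integrable (fun x => e (κ x) * (b x : ℂ)) :=
    hB.bdd_mul (hem.measurable.comp hκm).aestronglyMeasurable
      (Filter.Eventually.of_forall fun x => hen _)
  have hU : (⋃ w, (dyadicCube c k w).toSet) = Set.univ :=
    Set.eq_univ_of_forall fun x => Set.mem_iUnion.2 ⟨_, mem_dyadicCube_index c k x⟩
  have z2 : ∫ x, e (κ x) * (b x : ℂ) = 0 := by
    rw [← setIntegral_univ, ← hU, integral_iUnion (fun w => Cube.measurableSet_toSet _)]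
    · have : ∀ w, ∫ x in (dyadicCube c k w).toSet, e (κ x) * (b x : ℂ) = 0 := by
        intro w
        rw [setIntegral_congr_fun (g := fun x => e (dyadicCube c k w).corner * (b x : ℂ))
          (Cube.measurableSet_toSet _)]
        · rw [integral_const_mul, integral_complex_ofReal, hmean w]
          simp
        · intro x hx
          simp only [hκ]
          rw [mem_dyadicCube.1 hx]
      simp [this]
    · intro z w hzw
      refine Set.disjoint_left.2 fun x hx hy => hzw ?_
      rw [← mem_dyadicCube.1 hx, mem_dyadicCube.1 hy]
    · exact i2.integrableOn
  have z3 : FourierTransform.fourier (fun x => (b x : ℂ)) ξ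
      = ∫ x, (e x - e (κ x)) * (b x : ℂ) := by
    rw [Real.fourier_eq']
    simp only [sub_mul]
    rw [integral_sub i1 i2, z2, sub_zero]
    rfl
  rw [z3]
  refine (enorm_integral_le_lintegral_enorm _).trans ?_
  rw [← lintegral_const_mul' _ _ ENNReal.ofReal_ne_top]
  refine lintegral_mono fun x => ?_
  simp only [enorm_mul]
  rw [enorm_complex_ofReal]
  gcongr
  rw [← ofReal_norm]
  refine ENNReal.ofReal_le_ofReal ?_
  -- A chord of the unit circle is no longer than its arc.
  have h1 : ‖e x - e (κ x)‖ ≤ |(-2 * Real.pi * inner ℝ x ξ) - (-2 * Real.pi * inner ℝ (κ x) ξ)| := by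
    have h := Real.norm_exp_I_mul_ofReal_sub_one_le
      (x := (-2 * Real.pi * inner ℝ x ξ) - (-2 * Real.pi * inner ℝ (κ x) ξ))
    rw [Real.norm_eq_abs] at h
    refine le_trans (le_of_eq ?_) h
    have : e x - e (κ x) = e (κ x) * (Complex.exp (Complex.I *
        (((-2 * Real.pi * inner ℝ x ξ) - (-2 * Real.pi * inner ℝ (κ x) ξ) : ℝ) : ℂ)) - 1) := by
      rw [mul_sub, mul_one, he]
      simp only
      rw [← Complex.exp_add]
      congr 2
      push_cast
      ring
    rw [this, norm_mul, Complex.norm_exp_ofReal_mul_I, one_mul]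
  refine h1.trans ?_
  rw [← mul_sub, ← inner_sub_left, abs_mul]
  have h2 := abs_real_inner_le_norm (x - κ x) ξ
  have h3 : ‖x - κ x‖ ≤ √n * 2 ^ k := dist_corner_le c k (mem_dyadicCube_index c k x)
  have h4 : |(-2 * Real.pi)| = 2 * Real.pi := by
    rw [abs_of_neg] <;> nlinarith [Real.pi_pos]
  rw [h4]
  calc 2 * Real.pi * |inner ℝ (x - κ x) ξ| ≤ 2 * Real.pi * (‖x - κ x‖ * ‖ξ‖) := by gcongr
    _ ≤ 2 * Real.pi * ((√n * 2 ^ k) * ‖ξ‖) := by gcongr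
    _ = _ := by ring

theorem memLp_two_of_integrable_of_bound {F : EuclideanSpace ℝ (Fin n) → ℂ} {M : ℝ}
    (hF : Integrable F) (hM : ∀ x, ‖F x‖ ≤ M) : MemLp F 2 := by
  rw [memLp_two_iff_integrable_sq_norm hF.1]
  refine Integrable.mono' (hF.norm.const_mul M) (hF.1.norm.pow 2) (Filter.Eventually.of_forall ?_)
  intro x
  rw [Real.norm_of_nonneg (by positivity), sq]
  gcongr
  exact hM x

theorem lintegral_measureConv_sq {μ : Measure (EuclideanSpace ℝ (Fin n))} [IsFiniteMeasure μ]
    {B : EuclideanSpace ℝ (Fin n) → ℂ} {H : ℝ} (hBm : Measurable B) (hB : Integrable B)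
    (hH : ∀ x, ‖B x‖ ≤ H) :
    ∫⁻ x, ‖measureConv μ B x‖ₑ ^ (2 : ℝ) =
      ∫⁻ ξ, ‖charFun μ (-(2 * Real.pi) • ξ)‖ₑ ^ (2 : ℝ) *
        ‖FourierTransform.fourier B ξ‖ₑ ^ (2 : ℝ) := by
  have hF : Integrable (measureConv μ B) := (integrable_prod_sub (μ := μ) hBm hB).integral_prod_left
  have hFb : ∀ x, ‖measureConv μ B x‖ ≤ H * μ.real Set.univ := fun x =>
    norm_integral_le_of_norm_le_const (Filter.Eventually.of_forall fun y => hH _)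
  rw [← lintegral_enorm_fourier_sq hF (memLp_two_of_integrable_of_bound hF hFb)]
  refine lintegral_congr fun ξ => ?_
  rw [fourier_measureConv hBm hB, enorm_mul, ENNReal.mul_rpow_of_nonneg _ _ (by norm_num)]

end

/-! ### The `L²` gain from cancellation and Fourier decay. -/

section

variable {n : ℕ} {σ : Measure (EuclideanSpace ℝ (Fin n))}

/-- Cauchy–Schwarz on the support. It turns the `L¹` norm in the low-frequency estimate into the
`L²` norm. -/
theorem sq_lintegral_le_of_support {S : Set (EuclideanSpace ℝ (Fin n))} (hS : MeasurableSet S)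
    {g : EuclideanSpace ℝ (Fin n) → ℝ≥0∞} (hg : Measurable g) (hsupp : ∀ x ∉ S, g x = 0) :
    (∫⁻ x, g x) ^ (2 : ℝ) ≤ volume S * ∫⁻ x, g x ^ (2 : ℝ) := by
  have h := ENNReal.lintegral_mul_le_Lp_mul_Lq (volume.restrict S) Real.HolderConjugate.two_two
    (f := fun _ => 1) (g := g) aemeasurable_const hg.aemeasurable
  have e1 : ∫⁻ x, g x = ∫⁻ x in S, g x := by
    rw [← lintegral_indicator hS]
    congr 1; ext x
    by_cases hx : x ∈ S <;> simp [hx, hsupp]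
  have h' : ∫⁻ x, g x ≤ (volume S) ^ (1 / 2 : ℝ) * (∫⁻ x in S, g x ^ (2 : ℝ)) ^ (1 / 2 : ℝ) := by
    rw [e1]
    simpa using h
  calc (∫⁻ x, g x) ^ (2 : ℝ)
      ≤ ((volume S) ^ (1 / 2 : ℝ) * (∫⁻ x in S, g x ^ (2 : ℝ)) ^ (1 / 2 : ℝ)) ^ (2 : ℝ) := by
        gcongr
    _ = volume S * ∫⁻ x in S, g x ^ (2 : ℝ) := by
        rw [ENNReal.mul_rpow_of_nonneg _ _ (by norm_num), ← ENNReal.rpow_mul, ← ENNReal.rpow_mul]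
        norm_num
    _ ≤ _ := by gcongr; exact Measure.restrict_le_self

/-- `L²` gain for averages of functions with vanishing means over dyadic cubes at a
much smaller scale. -/
theorem exists_l2_decay [IsFiniteMeasure σ] {α : ℝ} (hα : 0 < α) (hdecay : HasFourierDecay σ α) :
    ∃ (ε : ℝ) (C : ℝ≥0), 0 < ε ∧ ∀ (c : EuclideanSpace ℝ (Fin n)) (j : ℤ) (s : ℕ)
      (z : Fin n → ℤ) (b : EuclideanSpace ℝ (Fin n) → ℝ) (H : ℝ), Measurable b →
      (∀ x, |b x| ≤ H) → (∀ x ∉ (dyadicCube c j z).toSet, b x = 0) →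
      (∀ w, ∫ x in (dyadicCube c (j - s) w).toSet, b x = 0) →
      ∫⁻ x, ‖∫ y, b (x - y) ∂(dilate σ j)‖ₑ ^ (2 : ℝ) ≤
        C * ENNReal.ofReal ((2 : ℝ) ^ (-ε * s)) * ∫⁻ x, ‖b x‖ₑ ^ (2 : ℝ) := by
  obtain ⟨A, hA⟩ := hdecay
  set v1 := volume (Metric.ball (0 : EuclideanSpace ℝ (Fin n)) 1) with hv1
  have hv1t : v1 ≠ ∞ := measure_ball_lt_top.ne
  set S := σ.real Set.univ with hS
  set C1 : ℝ := S ^ 2 * (2 * Real.pi * √n) ^ 2 * v1.toReal with hC1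
  set C2 : ℝ := A ^ 2 * (2 * Real.pi) ^ (-(2 * α)) with hC2
  -- Low frequencies yield the rate `1`, high frequencies the rate `2α/(n+2)`.
  set ε : ℝ := min 1 (2 * α / (n + 2)) with hε
  have hn2 : (0 : ℝ) < n + 2 := by positivity
  have hε0 : 0 < ε := lt_min one_pos (by positivity)
  refine ⟨ε, (C1 + C2).toNNReal, hε0, ?_⟩
  intro c j s z b H hbm hbH hbs hmean
  set R := (dyadicCube c j z).toSet with hR
  have hRm : MeasurableSet R := Cube.measurableSet_toSet _
  have hVt : volume R ≠ ∞ := Cube.volume_ne_top _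
  have hbi : Integrable b := by
    have h1 : IntegrableOn b R :=
      Measure.integrableOn_of_bounded hVt hbm.aestronglyMeasurable (M := H)
        (Filter.Eventually.of_forall hbH)
    refine (integrableOn_iff_integrable_of_support_subset ?_).1 h1
    intro x hx
    by_contra hxR
    exact hx (hbs x hxR)
  set B : EuclideanSpace ℝ (Fin n) → ℂ := fun x => (b x : ℂ) with hB
  have hBm : Measurable B := by fun_prop
  have hBi : Integrable B := hbi.ofReal
  have hBH : ∀ x, ‖B x‖ ≤ H := fun x => by simpa [hB] using hbH x
  have hBe : ∀ x, ‖B x‖ₑ = ‖b x‖ₑ := fun x => enorm_complex_ofReal _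
  set I2 := ∫⁻ x, ‖b x‖ₑ ^ (2 : ℝ) with hI2
  have hpl : ∫⁻ ξ, ‖FourierTransform.fourier B ξ‖ₑ ^ (2 : ℝ) = I2 := by
    rw [lintegral_enorm_fourier_sq hBi (memLp_two_of_integrable_of_bound hBi hBH)]
    simp only [hBe, hI2]
  have hconv : ∫⁻ x, ‖∫ y, b (x - y) ∂(dilate σ j)‖ₑ ^ (2 : ℝ)
      = ∫⁻ x, ‖measureConv (dilate σ j) B x‖ₑ ^ (2 : ℝ) := by
    refine lintegral_congr fun x => ?_
    simp only [measureConv, hB]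
    rw [integral_complex_ofReal, enorm_complex_ofReal]
  rw [hconv, lintegral_measureConv_sq hBm hBi hBH]
  -- Frequencies are split at `|ξ| = ρ 2^{-j}`. The low part contributes `(ρ 2^{-s})² ρ^n`, the last
  -- factor being the volume of the frequency ball times that of the cube; with `ρ^{n+2} = 2^s` this
  -- is `2^{-s}`. The high part contributes `ρ^{-2α}`.
  set ρ : ℝ := (2 : ℝ) ^ ((s : ℝ) / (n + 2)) with hρ
  have hρ0 : 0 < ρ := by positivity
  have h2j : (0 : ℝ) < 2 ^ j := by positivity
  set r : ℝ := ρ / 2 ^ j with hr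
  have hr0 : 0 < r := by positivity
  rw [← lintegral_add_compl _ (measurableSet_ball (x := (0 : EuclideanSpace ℝ (Fin n))) (ε := r))]
  have hρpow : ρ ^ (n + 2) = (2 : ℝ) ^ (s : ℝ) := by
    rw [hρ, ← Real.rpow_natCast, ← Real.rpow_mul (by norm_num)]
    congr 1
    push_cast
    field_simp
  -- low frequencies
  have low : ∫⁻ ξ in Metric.ball (0 : EuclideanSpace ℝ (Fin n)) r,
      ‖charFun (dilate σ j) (-(2 * Real.pi) • ξ)‖ₑ ^ (2 : ℝ) *
        ‖FourierTransform.fourier B ξ‖ₑ ^ (2 : ℝ) ≤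
      ENNReal.ofReal (C1 * (2 : ℝ) ^ (-ε * s)) * I2 := by
    set D : ℝ := S * (2 * Real.pi * (√n * 2 ^ (j - s)) * r) with hD
    have hD0 : 0 ≤ D := by positivity
    have pt : ∀ ξ ∈ Metric.ball (0 : EuclideanSpace ℝ (Fin n)) r,
        ‖charFun (dilate σ j) (-(2 * Real.pi) • ξ)‖ₑ ^ (2 : ℝ) *
        ‖FourierTransform.fourier B ξ‖ₑ ^ (2 : ℝ) ≤
        ENNReal.ofReal (D ^ 2) * (volume R * I2) := by
      intro ξ hξ
      rw [mem_ball_zero_iff] at hξ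
      have a1 : ‖charFun (dilate σ j) (-(2 * Real.pi) • ξ)‖ₑ ≤ ENNReal.ofReal S := by
        rw [← ofReal_norm]
        refine ENNReal.ofReal_le_ofReal ((norm_charFun_le _).trans (le_of_eq ?_))
        rw [hS, Measure.real, Measure.real, dilate_univ]
      have a2 : ‖FourierTransform.fourier B ξ‖ₑ ≤
          ENNReal.ofReal (2 * Real.pi * (√n * 2 ^ (j - s)) * r) * ∫⁻ x, ‖b x‖ₑ := by
        refine (enorm_fourier_le_of_mean_zero c (j - s) hbi hmean ξ).trans ?_
        gcongr
      have a3 := sq_lintegral_le_of_support (g := fun x => ‖b x‖ₑ) hRm (by fun_prop)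
        (fun x hx => by simp [hbs x hx])
      calc ‖charFun (dilate σ j) (-(2 * Real.pi) • ξ)‖ₑ ^ (2 : ℝ) *
            ‖FourierTransform.fourier B ξ‖ₑ ^ (2 : ℝ)
          ≤ ENNReal.ofReal S ^ (2 : ℝ) * (ENNReal.ofReal (2 * Real.pi * (√n * 2 ^ (j - s)) * r)
            * ∫⁻ x, ‖b x‖ₑ) ^ (2 : ℝ) := by gcongr
        _ = ENNReal.ofReal (D ^ 2) * (∫⁻ x, ‖b x‖ₑ) ^ (2 : ℝ) := by
          rw [ENNReal.mul_rpow_of_nonneg _ _ (by norm_num), ← mul_assoc,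
            ← ENNReal.mul_rpow_of_nonneg _ _ (by norm_num), ← ENNReal.ofReal_mul (by positivity),
            ENNReal.rpow_two, ENNReal.rpow_two, ← ENNReal.ofReal_pow hD0]
        _ ≤ _ := by gcongr
    refine (setLIntegral_mono' measurableSet_ball pt).trans ?_
    rw [setLIntegral_const, Measure.addHaar_ball_of_pos _ _ hr0, finrank_euclideanSpace_fin, ← hv1,
      volume_dyadicCube, dyadicVolume]
    have ev : v1 = ENNReal.ofReal v1.toReal := (ENNReal.ofReal_toReal hv1t).symm
    rw [ev, ← ENNReal.ofReal_pow h2j.le]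
    calc ENNReal.ofReal (D ^ 2) * (ENNReal.ofReal ((2 ^ j) ^ n) * I2) *
          (ENNReal.ofReal (r ^ n) * ENNReal.ofReal v1.toReal)
        = (ENNReal.ofReal (D ^ 2) * ENNReal.ofReal ((2 ^ j) ^ n) *
          (ENNReal.ofReal (r ^ n) * ENNReal.ofReal v1.toReal)) * I2 := by ring
      _ = ENNReal.ofReal (D ^ 2 * (2 ^ j) ^ n * (r ^ n * v1.toReal)) * I2 := by
        rw [← ENNReal.ofReal_mul (by positivity), ← ENNReal.ofReal_mul (by positivity),
          ← ENNReal.ofReal_mul (by positivity)]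
      _ ≤ _ := by
        refine mul_le_mul' (ENNReal.ofReal_le_ofReal ?_) le_rfl
        have e1 : D ^ 2 * (2 ^ j) ^ n * (r ^ n * v1.toReal) = C1 * (2 : ℝ) ^ (-(s : ℝ)) := by
          have e2 : D = S * (2 * Real.pi * √n) * (ρ * 2 ^ (-(s : ℤ))) := by
            rw [hD, hr, zpow_sub₀ (by norm_num), zpow_neg]
            field_simp
          have e3 : (2 : ℝ) ^ (-(s : ℝ)) = ρ ^ (n + 2) * (2 ^ (-(s : ℤ))) ^ 2 := by
            rw [hρpow, zpow_neg, zpow_natCast, Real.rpow_neg (by norm_num), Real.rpow_natCast]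
            field_simp
          rw [e2, e3, hr, hC1, div_pow]
          field_simp
          try ring
        rw [e1]
        refine mul_le_mul_of_nonneg_left ?_ (by positivity)
        refine Real.rpow_le_rpow_of_exponent_le (by norm_num) ?_
        have : ε ≤ 1 := min_le_left _ _
        nlinarith [(Nat.cast_nonneg s : (0 : ℝ) ≤ s)]
  -- No cancellation is used here: the decay of `σ̂` is a pointwise multiplier bound off the ball,
  -- and Plancherel for `b` does the rest.
  have high : ∫⁻ ξ in (Metric.ball (0 : EuclideanSpace ℝ (Fin n)) r)ᶜ,
      ‖charFun (dilate σ j) (-(2 * Real.pi) • ξ)‖ₑ ^ (2 : ℝ) *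
        ‖FourierTransform.fourier B ξ‖ₑ ^ (2 : ℝ) ≤
      ENNReal.ofReal (C2 * (2 : ℝ) ^ (-ε * s)) * I2 := by
    have pt : ∀ ξ ∈ (Metric.ball (0 : EuclideanSpace ℝ (Fin n)) r)ᶜ,
        ‖charFun (dilate σ j) (-(2 * Real.pi) • ξ)‖ₑ ^ (2 : ℝ) *
        ‖FourierTransform.fourier B ξ‖ₑ ^ (2 : ℝ) ≤
        ENNReal.ofReal (C2 * (2 : ℝ) ^ (-ε * s)) * ‖FourierTransform.fourier B ξ‖ₑ ^ (2 : ℝ) := by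
      intro ξ hξ
      have hξ' : r ≤ ‖ξ‖ := by simpa using hξ
      gcongr
      rw [charFun_dilate, ← ofReal_norm, ENNReal.rpow_two, ← ENNReal.ofReal_pow (norm_nonneg _)]
      refine ENNReal.ofReal_le_ofReal ?_
      set η : EuclideanSpace ℝ (Fin n) := (2 : ℝ) ^ j • -(2 * Real.pi) • ξ with hη
      have hηn : ‖η‖ = 2 * Real.pi * (2 ^ j * ‖ξ‖) := by
        rw [hη, norm_smul, norm_smul, Real.norm_of_nonneg h2j.le, norm_neg,
          Real.norm_of_nonneg (by positivity)]
        ring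
      have hηρ : 2 * Real.pi * ρ ≤ ‖η‖ := by
        rw [hηn]
        have : ρ ≤ 2 ^ j * ‖ξ‖ := by
          rw [hr, div_le_iff₀ h2j] at hξ'; linarith
        gcongr
      have hη0 : η ≠ 0 := by
        intro h0
        rw [h0, norm_zero] at hηρ
        have : 0 < 2 * Real.pi * ρ := by positivity
        linarith
      have h1 := hA η hη0
      have h2 : ‖η‖ ^ (-α) ≤ (2 * Real.pi * ρ) ^ (-α) :=
        Real.rpow_le_rpow_of_nonpos (by positivity) hηρ (by linarith)
      have hηp : 0 ≤ ‖η‖ ^ (-α) := by positivity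
      calc ‖charFun σ η‖ ^ 2 ≤ (A * ‖η‖ ^ (-α)) ^ 2 := by gcongr
        _ = A ^ 2 * (‖η‖ ^ (-α)) ^ 2 := by ring
        _ ≤ A ^ 2 * ((2 * Real.pi * ρ) ^ (-α)) ^ 2 := by gcongr
        _ = C2 * ρ ^ (-(2 * α)) := by
          have e0 : ((2 * Real.pi * ρ) ^ (-α)) ^ 2 = (2 * Real.pi * ρ) ^ (-(2 * α)) := by
            rw [← Real.rpow_natCast, ← Real.rpow_mul (by positivity)]
            congr 1; push_cast; ring
          rw [e0, hC2, Real.mul_rpow (by positivity) (by positivity)]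
          ring
        _ ≤ C2 * (2 : ℝ) ^ (-ε * s) := by
          refine mul_le_mul_of_nonneg_left ?_ (by positivity)
          rw [hρ, ← Real.rpow_mul (by norm_num)]
          refine Real.rpow_le_rpow_of_exponent_le (by norm_num) ?_
          have h3 : ε ≤ 2 * α / (n + 2) := min_le_right _ _
          have h4 : (s : ℝ) / (n + 2) * -(2 * α) = -(2 * α / (n + 2)) * s := by ring
          rw [h4]
          nlinarith [(Nat.cast_nonneg s : (0 : ℝ) ≤ s)]
    refine (setLIntegral_mono' measurableSet_ball.compl pt).trans ?_
    rw [lintegral_const_mul' _ _ ENNReal.ofReal_ne_top]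
    gcongr
    rw [← hpl]
    exact setLIntegral_le_lintegral _ _
  refine (add_le_add low high).trans (le_of_eq ?_)
  have hC1' : 0 ≤ C1 := by positivity
  have hC2' : 0 ≤ C2 := by positivity
  rw [← add_mul, ← ENNReal.ofReal_add (by positivity) (by positivity), ← add_mul,
    ENNReal.ofReal_mul (by positivity)]
  rfl

end

/-! ### Dyadic means, fluctuations, and estimates at one scale. -/

section

variable {n : ℕ} {σ : Measure (EuclideanSpace ℝ (Fin n))}

/-- Unions of dyadic cubes of sidelength `2^k`. -/
def IsDyadicUnion (c : EuclideanSpace ℝ (Fin n)) (k : ℤ) (S : Set (EuclideanSpace ℝ (Fin n))) :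
    Prop :=
  ∀ x y, dyadicIndex c k x = dyadicIndex c k y → x ∈ S → y ∈ S

theorem IsDyadicUnion.measurableSet {c : EuclideanSpace ℝ (Fin n)} {k : ℤ}
    {S : Set (EuclideanSpace ℝ (Fin n))} (hS : IsDyadicUnion c k S) : MeasurableSet S := by
  have : S = dyadicIndex c k ⁻¹' (dyadicIndex c k '' S) := by
    ext y
    constructor
    · intro hy; exact ⟨y, hy, rfl⟩
    · rintro ⟨x, hx, hxy⟩; exact hS x y hxy hx
  rw [this]
  exact measurable_dyadicIndex c k (Set.to_countable _).measurableSet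

theorem isDyadicUnion_dyadicCube (c : EuclideanSpace ℝ (Fin n)) {k j : ℤ} (hkj : k ≤ j)
    (z : Fin n → ℤ) : IsDyadicUnion c k (dyadicCube c j z).toSet := by
  intro x y hxy hx
  rw [mem_dyadicCube] at *
  rw [← hx]
  exact (dyadicIndex_eq_of_le hkj hxy).symm

theorem IsDyadicUnion.inter {c : EuclideanSpace ℝ (Fin n)} {k : ℤ}
    {S T : Set (EuclideanSpace ℝ (Fin n))} (hS : IsDyadicUnion c k S) (hT : IsDyadicUnion c k T) :
    IsDyadicUnion c k (S ∩ T) := fun x y h hx => ⟨hS x y h hx.1, hT x y h hx.2⟩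

theorem IsDyadicUnion.diff {c : EuclideanSpace ℝ (Fin n)} {k : ℤ}
    {S T : Set (EuclideanSpace ℝ (Fin n))} (hS : IsDyadicUnion c k S) (hT : IsDyadicUnion c k T) :
    IsDyadicUnion c k (S \ T) := fun x y h hx => ⟨hS x y h hx.1, fun hy => hx.2 (hT y x h.symm hy)⟩

theorem IsDyadicUnion.of_le {c : EuclideanSpace ℝ (Fin n)} {k j : ℤ} (hkj : k ≤ j)
    {S : Set (EuclideanSpace ℝ (Fin n))} (hS : IsDyadicUnion c j S) : IsDyadicUnion c k S :=
  fun x y h hx => hS x y (dyadicIndex_eq_of_le hkj h) hx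

/-- The mean of `h` over the dyadic cube of sidelength `2^k` that contains `x`. -/
def dyadicMean (c : EuclideanSpace ℝ (Fin n)) (k : ℤ) (h : EuclideanSpace ℝ (Fin n) → ℝ≥0)
    (x : EuclideanSpace ℝ (Fin n)) : ℝ≥0∞ :=
  (dyadicVolume n k)⁻¹ * ∫⁻ y in (dyadicCube c k (dyadicIndex c k x)).toSet, h y

theorem measurable_dyadicMean (c : EuclideanSpace ℝ (Fin n)) (k : ℤ)
    (h : EuclideanSpace ℝ (Fin n) → ℝ≥0) : Measurable (dyadicMean c k h) :=
  (measurable_of_countable (fun w : Fin n → ℤ =>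
    (dyadicVolume n k)⁻¹ * ∫⁻ y in (dyadicCube c k w).toSet, (h y : ℝ≥0∞))).comp
    (measurable_dyadicIndex c k)

theorem dyadicMean_le {c : EuclideanSpace ℝ (Fin n)} {k : ℤ}
    {h : EuclideanSpace ℝ (Fin n) → ℝ≥0} {H : ℝ≥0} (hH : ∀ x, h x ≤ H)
    (x : EuclideanSpace ℝ (Fin n)) : dyadicMean c k h x ≤ H := by
  unfold dyadicMean
  calc (dyadicVolume n k)⁻¹ * ∫⁻ y in (dyadicCube c k (dyadicIndex c k x)).toSet, (h y : ℝ≥0∞)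
      ≤ (dyadicVolume n k)⁻¹ * ∫⁻ y in (dyadicCube c k (dyadicIndex c k x)).toSet, (H : ℝ≥0∞) := by
        gcongr with y; exact_mod_cast hH y
    _ = (dyadicVolume n k)⁻¹ * dyadicVolume n k * H := by
        rw [setLIntegral_const, volume_dyadicCube]; ring
    _ = H := by
        rw [ENNReal.inv_mul_cancel (dyadicVolume_ne_zero n k) (dyadicVolume_ne_top n k), one_mul]

/-- Hölder against the constant `1`; the two powers of the volume have exponents summing to one and
cancel the normalization. -/
theorem dyadicMean_le_rpow {c : EuclideanSpace ℝ (Fin n)} {k : ℤ}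
    {h : EuclideanSpace ℝ (Fin n) → ℝ≥0} (hm : Measurable h) {p : ℝ} (hp : 1 < p) {L : ℝ≥0∞}
    {x : EuclideanSpace ℝ (Fin n)}
    (hL : ∫⁻ y in (dyadicCube c k (dyadicIndex c k x)).toSet, (h y : ℝ≥0∞) ^ p
      ≤ L * dyadicVolume n k) : dyadicMean c k h x ≤ L ^ (1 / p) := by
  have hp0 : 0 < p := by linarith
  unfold dyadicMean
  set R := (dyadicCube c k (dyadicIndex c k x)).toSet
  set V := dyadicVolume n k with hV
  have hV0 : V ≠ 0 := dyadicVolume_ne_zero n k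
  have hVt : V ≠ ∞ := dyadicVolume_ne_top n k
  have hc : p.HolderConjugate (p / (p - 1)) := Real.HolderConjugate.conjExponent hp
  have h1 := ENNReal.lintegral_mul_le_Lp_mul_Lq (volume.restrict R) hc
    (f := fun y => (h y : ℝ≥0∞)) (g := fun _ => 1) (by fun_prop) aemeasurable_const
  have h2 : ∫⁻ y in R, (h y : ℝ≥0∞) ≤ (L * V) ^ (1 / p) * V ^ (1 / (p / (p - 1))) := by
    have h3 : volume R = V := volume_dyadicCube _ _ _
    simp only [Pi.mul_apply, mul_one, ENNReal.one_rpow, lintegral_const,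
      Measure.restrict_apply_univ, one_mul, h3] at h1
    refine h1.trans ?_
    gcongr
  calc V⁻¹ * ∫⁻ y in R, (h y : ℝ≥0∞) ≤ V⁻¹ * ((L * V) ^ (1 / p) * V ^ (1 / (p / (p - 1)))) := by
        gcongr
    _ = V⁻¹ * V ^ (1 / p + 1 / (p / (p - 1))) * L ^ (1 / p) := by
        rw [ENNReal.mul_rpow_of_nonneg _ _ (by positivity), ENNReal.rpow_add _ _ hV0 hVt]
        ring
    _ = L ^ (1 / p) := by
        have : 1 / p + 1 / (p / (p - 1)) = 1 := by
          have := hc.inv_add_inv_eq_one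
          simpa [one_div] using this
        rw [this, ENNReal.rpow_one, ENNReal.inv_mul_cancel hV0 hVt, one_mul]

/-- The part on `V` of the fluctuation of `h` around its means over dyadic cubes of
sidelength `2^k`. -/
def fluctuation (c : EuclideanSpace ℝ (Fin n)) (k : ℤ) (V : Set (EuclideanSpace ℝ (Fin n)))
    (h : EuclideanSpace ℝ (Fin n) → ℝ≥0) : EuclideanSpace ℝ (Fin n) → ℝ :=
  V.indicator fun x => (h x : ℝ) - (dyadicMean c k h x).toReal

theorem measurable_fluctuation (c : EuclideanSpace ℝ (Fin n)) (k : ℤ)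
    {V : Set (EuclideanSpace ℝ (Fin n))} (hV : MeasurableSet V)
    {h : EuclideanSpace ℝ (Fin n) → ℝ≥0} (hm : Measurable h) :
    Measurable (fluctuation c k V h) := by
  have := measurable_dyadicMean c k h
  exact Measurable.indicator (by fun_prop) hV

/-- Both the function and its mean lie in `[0, H]`, so their difference costs no factor `2`. -/
theorem abs_fluctuation_le (c : EuclideanSpace ℝ (Fin n)) (k : ℤ)
    (V : Set (EuclideanSpace ℝ (Fin n))) {h : EuclideanSpace ℝ (Fin n) → ℝ≥0} {H : ℝ≥0}
    (hH : ∀ x, h x ≤ H) (x : EuclideanSpace ℝ (Fin n)) : |fluctuation c k V h x| ≤ H := by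
  unfold fluctuation
  by_cases hx : x ∈ V
  · rw [Set.indicator_of_mem hx]
    have h1 : (dyadicMean c k h x).toReal ≤ H :=
      ENNReal.toReal_le_of_le_ofReal H.2 (by simpa using dyadicMean_le hH x)
    have h2 : (h x : ℝ) ≤ H := hH x
    have h3 : (0 : ℝ) ≤ h x := (h x).2
    have h4 : 0 ≤ (dyadicMean c k h x).toReal := ENNReal.toReal_nonneg
    rw [abs_le]; constructor <;> linarith
  · rw [Set.indicator_of_notMem hx]; simp

/-- Because `V` is a union of cubes of the averaging scale, such a cube is either inside `V`, where
its own mean has been subtracted, or disjoint from `V`. Cutting off to `V` thus preserves the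
cancellation. -/
theorem setIntegral_fluctuation {c : EuclideanSpace ℝ (Fin n)} {k : ℤ}
    {V : Set (EuclideanSpace ℝ (Fin n))} (hV : IsDyadicUnion c k V)
    {h : EuclideanSpace ℝ (Fin n) → ℝ≥0} (hm : Measurable h) {H : ℝ≥0} (hH : ∀ x, h x ≤ H)
    (w : Fin n → ℤ) : ∫ x in (dyadicCube c k w).toSet, fluctuation c k V h x = 0 := by
  set R := (dyadicCube c k w).toSet with hR
  have hRm : MeasurableSet R := Cube.measurableSet_toSet _
  have hRt : volume R ≠ ∞ := Cube.volume_ne_top _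
  by_cases hw : ∃ x ∈ R, x ∈ V
  · obtain ⟨x0, hx0, hx0V⟩ := hw
    set a := (dyadicMean c k h x0).toReal with ha
    have e : ∀ x ∈ R, fluctuation c k V h x = (h x : ℝ) - a := by
      intro x hx
      have hxx : dyadicIndex c k x0 = dyadicIndex c k x := by
        rw [mem_dyadicCube.1 hx, mem_dyadicCube.1 hx0]
      rw [fluctuation, Set.indicator_of_mem (hV x0 x hxx hx0V), ha, dyadicMean, dyadicMean, hxx]
    rw [setIntegral_congr_fun hRm e]
    have hi : IntegrableOn (fun x => (h x : ℝ)) R :=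
      Measure.integrableOn_of_bounded hRt (by fun_prop) (M := H)
        (Filter.Eventually.of_forall fun x => by
          rw [Real.norm_of_nonneg (h x).coe_nonneg]; exact_mod_cast hH x)
    rw [integral_sub hi (integrableOn_const hRt), setIntegral_const, sub_eq_zero]
    have h1 : ∫ x in R, (h x : ℝ) = (∫⁻ x in R, (h x : ℝ≥0∞)).toReal := by
      rw [integral_eq_lintegral_of_nonneg_ae (Filter.Eventually.of_forall fun x => (h x).coe_nonneg)
        (by fun_prop)]
      simp
    have hV1 : volume R = dyadicVolume n k := volume_dyadicCube _ _ _
    have hV0 : (dyadicVolume n k).toReal ≠ 0 :=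
      (ENNReal.toReal_pos (dyadicVolume_ne_zero n k) (dyadicVolume_ne_top n k)).ne'
    rw [h1, ha, dyadicMean, mem_dyadicCube.1 hx0, Measure.real, hV1, ENNReal.toReal_mul,
      ENNReal.toReal_inv, smul_eq_mul, ← mul_assoc, mul_inv_cancel₀ hV0, one_mul]
  · push Not at hw
    rw [setIntegral_congr_fun (g := fun _ => 0) hRm]
    · simp
    · intro x hx
      exact Set.indicator_of_notMem (hw x hx) _

theorem measurable_enorm_integral_sub {μ : Measure (EuclideanSpace ℝ (Fin n))} [IsFiniteMeasure μ]
    {b : EuclideanSpace ℝ (Fin n) → ℝ} (hb : Measurable b) :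
    Measurable fun x => ‖∫ y, b (x - y) ∂μ‖ₑ := by
  have h1 : StronglyMeasurable
      (Function.uncurry fun x y : EuclideanSpace ℝ (Fin n) => b (x - y)) :=
    (hb.comp (measurable_fst.sub measurable_snd)).stronglyMeasurable
  exact h1.integral_prod_right.measurable.enorm

theorem integrable_comp_sub_of_bound {μ : Measure (EuclideanSpace ℝ (Fin n))} [IsFiniteMeasure μ]
    {b : EuclideanSpace ℝ (Fin n) → ℝ} (hb : Measurable b) {H : ℝ} (hH : ∀ x, |b x| ≤ H)
    (x : EuclideanSpace ℝ (Fin n)) : Integrable (fun y => b (x - y)) μ :=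
  Integrable.of_bound (hb.comp (by fun_prop)).aestronglyMeasurable H
    (Filter.Eventually.of_forall fun y => hH _)

/-- The signed counterpart of `dilateConv_le_sum_neighbor`: the absolute value is taken after
integration on each cube, so cancellation inside a cube survives. -/
theorem enorm_integral_le_sum_neighbor [IsFiniteMeasure σ]
    (hsupp : σ (Metric.closedBall 0 1)ᶜ = 0) (j : ℤ)
    (c : EuclideanSpace ℝ (Fin n)) {b : EuclideanSpace ℝ (Fin n) → ℝ} (hb : Measurable b) {H : ℝ}
    (hH : ∀ x, |b x| ≤ H) (x : EuclideanSpace ℝ (Fin n)) :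
    ‖∫ y, b (x - y) ∂(dilate σ j)‖ₑ ≤ ∑ e ∈ neighborShifts n,
      ‖∫ y, (dyadicCube c j (dyadicIndex c j x + e)).toSet.indicator b (x - y) ∂(dilate σ j)‖ₑ := by
  have h1 : ∫ y, b (x - y) ∂(dilate σ j) = ∑ e ∈ neighborShifts n,
      ∫ y, (dyadicCube c j (dyadicIndex c j x + e)).toSet.indicator b (x - y) ∂(dilate σ j) := by
    rw [← integral_finsetSum]
    · refine integral_congr_ae ?_
      filter_upwards [ae_dilate_abs_le σ hsupp j] with y hy
      rw [Finset.sum_eq_single_of_mem _ (dyadicIndex_sub_mem c j (x := x) hy)]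
      · rw [Set.indicator_of_mem]
        rw [mem_dyadicCube]; abel
      · intro e _ hne
        rw [Set.indicator_of_notMem]
        rw [mem_dyadicCube]
        intro h0
        exact hne (by rw [h0]; abel)
    · intro e _
      refine integrable_comp_sub_of_bound (hb.indicator (Cube.measurableSet_toSet _)) (H := H) ?_ x
      intro y
      by_cases hy : y ∈ (dyadicCube c j (dyadicIndex c j x + e)).toSet
      · simpa [hy] using hH y
      · simpa [hy] using (abs_nonneg _).trans (hH y)
  rw [h1]
  exact enorm_sum_le _ _

/-- Localization to a cube of side `2^j` again produces a fluctuation, on a smaller union of cubes,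
so the local `L²` estimate applies cube by cube and the pieces of `V` add up. -/
theorem enorm_integral_fluctuation_sq_le [IsFiniteMeasure σ]
    (hsupp : σ (Metric.closedBall 0 1)ᶜ = 0) {c : EuclideanSpace ℝ (Fin n)} {j : ℤ} {s : ℕ}
    {h : EuclideanSpace ℝ (Fin n) → ℝ≥0} (hm : Measurable h) {H : ℝ≥0} (hH : ∀ x, h x ≤ H)
    {V : Set (EuclideanSpace ℝ (Fin n))} (hV : IsDyadicUnion c (j - s) V) {K : ℝ≥0∞}
    (hK : ∀ (z : Fin n → ℤ) (b : EuclideanSpace ℝ (Fin n) → ℝ) (H : ℝ), Measurable b →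
      (∀ x, |b x| ≤ H) → (∀ x ∉ (dyadicCube c j z).toSet, b x = 0) →
      (∀ w, ∫ x in (dyadicCube c (j - s) w).toSet, b x = 0) →
      ∫⁻ x, ‖∫ y, b (x - y) ∂(dilate σ j)‖ₑ ^ (2 : ℝ) ≤ K * ∫⁻ x, ‖b x‖ₑ ^ (2 : ℝ)) :
    ∫⁻ x, ‖∫ y, fluctuation c (j - s) V h (x - y) ∂(dilate σ j)‖ₑ ^ (2 : ℝ) ≤
      3 ^ n * K * (H ^ 2 * volume V) := by
  set b := fluctuation c (j - s) V h with hb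
  have hbm : Measurable b := measurable_fluctuation c _ hV.measurableSet hm
  have hbH : ∀ x, |b x| ≤ H := abs_fluctuation_le c _ V hH
  have hind : ∀ z, (dyadicCube c j z).toSet.indicator b
      = fluctuation c (j - s) ((dyadicCube c j z).toSet ∩ V) h := by
    intro z
    rw [hb, fluctuation, fluctuation, Set.indicator_indicator]
  have hVz : ∀ z, IsDyadicUnion c (j - s) ((dyadicCube c j z).toSet ∩ V) := fun z =>
    (isDyadicUnion_dyadicCube c (by omega) z).inter hV
  have h1 := rpow_lintegral_le_of_neighbor c j (r := 2)
    (φ := fun x => ‖∫ y, b (x - y) ∂(dilate σ j)‖ₑ)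
    (ψ := fun z x => ‖∫ y, (dyadicCube c j z).toSet.indicator b (x - y) ∂(dilate σ j)‖ₑ)
    (fun z => measurable_enorm_integral_sub (hbm.indicator (Cube.measurableSet_toSet _)))
    (by norm_num) (fun x => enorm_integral_le_sum_neighbor hsupp j c hbm hbH x)
  refine h1.trans ?_
  have e2 : ((3 : ℝ≥0∞) ^ n) ^ ((2 : ℝ) - 1) = 3 ^ n := by norm_num
  rw [e2, mul_assoc]
  gcongr
  calc ∑' z, ∫⁻ x, ‖∫ y, (dyadicCube c j z).toSet.indicator b (x - y) ∂(dilate σ j)‖ₑ ^ (2 : ℝ)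
      ≤ ∑' z, K * (H ^ 2 * volume ((dyadicCube c j z).toSet ∩ V)) := by
        refine ENNReal.tsum_le_tsum fun z => ?_
        rw [hind z]
        refine (hK z _ H (measurable_fluctuation c _ (hVz z).measurableSet hm)
          (abs_fluctuation_le c _ _ hH) ?_ (setIntegral_fluctuation (hVz z) hm hH)).trans ?_
        · intro x hx
          exact Set.indicator_of_notMem (fun h' => hx h'.1) _
        · gcongr
          rw [← setLIntegral_const, ← lintegral_indicator (hVz z).measurableSet]
          refine lintegral_mono fun x => ?_
          by_cases hx : x ∈ (dyadicCube c j z).toSet ∩ V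
          · rw [Set.indicator_of_mem hx, ENNReal.rpow_two]
            gcongr
            rw [← ofReal_norm, Real.norm_eq_abs]
            exact ENNReal.ofReal_le_of_le_toReal (abs_fluctuation_le c _ _ hH x)
          · rw [fluctuation, Set.indicator_of_notMem hx]
            simp
    _ = K * (H ^ 2 * volume V) := by
        rw [ENNReal.tsum_mul_left, ENNReal.tsum_mul_left]
        congr 2
        have := lintegral_eq_tsum_dyadicCube c j (V.indicator fun _ => (1 : ℝ≥0∞))
        rw [lintegral_indicator hV.measurableSet] at this
        simp only [lintegral_const, Measure.restrict_apply_univ, one_mul] at this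
        rw [this]
        refine tsum_congr fun z => ?_
        rw [lintegral_indicator hV.measurableSet, Measure.restrict_restrict hV.measurableSet]
        simp [Set.inter_comm]

/-- The `L^p → L^q` estimate at one scale for functions with controlled `L^p` averages. -/
theorem lintegral_dilateConv_rpow_le_of_average [IsFiniteMeasure σ]
    (hsupp : σ (Metric.closedBall 0 1)ᶜ = 0) {p q : ℝ} (hp : 1 < p) (hpq : p < q)
    {A : ℝ≥0∞} (c : EuclideanSpace ℝ (Fin n)) (j : ℤ)
    (hA : ∀ (h : EuclideanSpace ℝ (Fin n) → ℝ≥0∞) (H : ℝ≥0), Measurable h →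
      (∀ x, h x ≤ H) → ∫⁻ x, h x ^ p ≠ ∞ →
      ∫⁻ x, dilateConv σ j h x ^ q ≤
        A ^ q * dyadicVolume n j * ((dyadicVolume n j)⁻¹ * ∫⁻ x, h x ^ p) ^ (q / p))
    {w : EuclideanSpace ℝ (Fin n) → ℝ≥0∞} {H : ℝ≥0} (hw : Measurable w) (hwH : ∀ x, w x ≤ H)
    (hfin : ∫⁻ x, w x ^ p ≠ ∞) {L : ℝ≥0∞}
    (hL : ∀ z, ∫⁻ x in (dyadicCube c j z).toSet, w x ^ p ≤ L * dyadicVolume n j) :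
    ∫⁻ x, dilateConv σ j w x ^ q ≤
      ((3 : ℝ≥0∞) ^ n) ^ (q - 1) * (A ^ q * L ^ (q / p - 1)) * ∫⁻ x, w x ^ p := by
  have hp0 : 0 < p := by linarith
  set V := dyadicVolume n j with hV
  have hV0 : V ≠ 0 := dyadicVolume_ne_zero n j
  have hVt : V ≠ ∞ := dyadicVolume_ne_top n j
  have hqp : 0 ≤ q / p - 1 := by rw [sub_nonneg, one_le_div hp0]; exact hpq.le
  have hm : ∀ z, Measurable ((dyadicCube c j z).toSet.indicator w) := fun z =>
    hw.indicator (Cube.measurableSet_toSet _)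
  have h1 := rpow_lintegral_le_of_neighbor c j (r := q) (φ := dilateConv σ j w)
    (ψ := fun z => dilateConv σ j ((dyadicCube c j z).toSet.indicator w))
    (fun z => measurable_dilateConv j (hm z)) (by linarith)
    (fun x => dilateConv_le_sum_neighbor hsupp j c hw x)
  refine h1.trans ?_
  rw [mul_assoc]
  gcongr
  rw [lintegral_eq_tsum_dyadicCube c j (fun x => w x ^ p), ← ENNReal.tsum_mul_left]
  refine ENNReal.tsum_le_tsum fun z => ?_
  set R := (dyadicCube c j z).toSet with hR
  have e1 : ∫⁻ x, R.indicator w x ^ p = ∫⁻ x in R, w x ^ p := by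
    rw [← lintegral_indicator (Cube.measurableSet_toSet _)]
    congr 1; ext x
    by_cases hx : x ∈ R
    · rw [Set.indicator_of_mem hx, Set.indicator_of_mem hx]
    · rw [Set.indicator_of_notMem hx, Set.indicator_of_notMem hx, ENNReal.zero_rpow_of_pos hp0]
  have h2 := hA (R.indicator w) H (hm z) (fun x => (Set.indicator_le_self _ _ x).trans (hwH x))
    (by rw [e1]; exact ne_top_of_le_ne_top hfin (setLIntegral_le_lintegral _ _))
  rw [e1] at h2
  refine h2.trans ?_
  set I := ∫⁻ x in R, w x ^ p with hI
  have e2 : q / p = (q / p - 1) + 1 := by ring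
  have e3 : V⁻¹ * I ≤ L := by
    rw [mul_comm, ← div_eq_mul_inv]
    exact ENNReal.div_le_of_le_mul (hL z)
  -- Only the surplus power `q/p - 1` of the average is estimated by `L`. One power stays as an
  -- integral, so that the sum over cubes is the full integral of `w^p`; this is where `p < q`
  -- enters.
  rw [e2, ENNReal.rpow_add_of_nonneg _ _ hqp zero_le_one, ENNReal.rpow_one]
  calc A ^ q * V * ((V⁻¹ * I) ^ (q / p - 1) * (V⁻¹ * I))
      = A ^ q * (V⁻¹ * I) ^ (q / p - 1) * (V * V⁻¹) * I := by ring
    _ ≤ A ^ q * L ^ (q / p - 1) * 1 * I := by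
        rw [ENNReal.mul_inv_cancel hV0 hVt]
        gcongr
    _ = _ := by ring_nf

end

/-! ### Maximal functions along a decreasing sequence of sets. -/

section

variable {n : ℕ} {σ : Measure (EuclideanSpace ℝ (Fin n))}

/-- The supremum is dominated by the `ℓ^r` sum, then Hölder. It serves with `r = q` for the near
parts and `r = 2` for the fluctuations, where the sums over scales are controlled. -/
theorem lintegral_iSup_mul_le {X : Type*} [MeasurableSpace X] {μ : Measure X} {φ : ℕ → X → ℝ≥0∞}
    (hφ : ∀ t, Measurable (φ t)) {k : X → ℝ≥0∞} (hk : Measurable k) {r r' : ℝ}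
    (hr : r.HolderConjugate r') :
    ∫⁻ x, (⨆ t, φ t x) * k x ∂μ ≤
      (∑' t, ∫⁻ x, φ t x ^ r ∂μ) ^ (1 / r) * (∫⁻ x, k x ^ r' ∂μ) ^ (1 / r') := by
  have hr0 : 0 < r := hr.pos
  have h1 := ENNReal.lintegral_mul_le_Lp_mul_Lq μ hr (f := fun x => ⨆ t, φ t x) (g := k)
    (Measurable.iSup hφ).aemeasurable hk.aemeasurable
  refine h1.trans ?_
  gcongr
  rw [← lintegral_tsum fun t => ((hφ t).pow_const r).aemeasurable]
  refine lintegral_mono fun x => ?_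
  have h2 : ⨆ t, φ t x ≤ (∑' t, φ t x ^ r) ^ (1 / r) := by
    refine iSup_le fun t => ?_
    rw [one_div, ENNReal.le_rpow_inv_iff hr0]
    exact ENNReal.le_tsum t
  rwa [one_div, ENNReal.le_rpow_inv_iff hr0] at h2

/-- A decomposition of a nonnegative function along a decreasing sequence of sets into a bounded
part and fluctuations at decreasing scales. -/
theorem indicator_le_add_sum_fluctuation {c : EuclideanSpace ℝ (Fin n)} {J : ℤ}
    {W : ℕ → Set (EuclideanSpace ℝ (Fin n))} (hW : Antitone W) {M : ℕ}
    (hM : ∀ t, M ≤ t → W t = ∅) {h : EuclideanSpace ℝ (Fin n) → ℝ≥0} {lam : ℝ≥0}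
    (hmean : ∀ (i : ℕ), ∀ x ∈ W i \ W (i + 1), dyadicMean c (J - i - 1) h x ≤ lam)
    (t : ℕ) (u : EuclideanSpace ℝ (Fin n)) :
    (W t).indicator (fun x => (h x : ℝ)) u ≤ lam + ∑ r ∈ Finset.range M,
      fluctuation c (J - (t + r : ℕ) - 1) (W (t + r) \ W (t + r + 1)) h u := by
  classical
  by_cases hu : u ∈ W t
  · have hex : ∃ r, u ∉ W (t + r + 1) := ⟨M, by rw [hM _ (by omega)]; simp⟩
    set r := Nat.find hex with hr
    have h1 : u ∉ W (t + r + 1) := Nat.find_spec hex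
    have h2 : u ∈ W (t + r) := by
      rcases Nat.eq_zero_or_pos r with h0 | h0
      · rwa [h0]
      · have h3 := Nat.find_min hex (m := r - 1) (by omega)
        have h4 : t + (r - 1) + 1 = t + r := by omega
        rw [h4] at h3
        exact not_not.1 h3
    have h3 : r < M := by
      by_contra hcon
      rw [hM (t + r) (by omega)] at h2
      exact h2
    rw [Finset.sum_eq_single_of_mem r (Finset.mem_range.2 h3)]
    · rw [Set.indicator_of_mem hu, fluctuation,
        Set.indicator_of_mem (show u ∈ W (t + r) \ W (t + r + 1) from ⟨h2, h1⟩)]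
      have h5 : (dyadicMean c (J - (t + r : ℕ) - 1) h u).toReal ≤ lam :=
        ENNReal.toReal_le_of_le_ofReal lam.2 (by simpa using hmean (t + r) u ⟨h2, h1⟩)
      linarith
    · intro r' _ hne
      rw [fluctuation, Set.indicator_of_notMem]
      rintro ⟨h5, h6⟩
      rcases lt_or_gt_of_ne hne with h7 | h7
      · exact h6 (hW (by omega : t + r' + 1 ≤ t + r) h2)
      · exact h1 (hW (by omega : t + r + 1 ≤ t + r') h5)
  · rw [Set.indicator_of_notMem hu, Finset.sum_eq_zero]
    · simp
    · intro r _
      rw [fluctuation, Set.indicator_of_notMem]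
      rintro ⟨h5, -⟩
      exact hu (hW (by omega : t ≤ t + r) h5)

/-- Averaging is positive, so the pointwise decomposition may be integrated. The means are bounded
by `lam` and cost only the total mass of `σ`, while the supremum over scales will act only on the
fluctuations. -/
theorem dilateConv_indicator_le [IsFiniteMeasure σ] {c : EuclideanSpace ℝ (Fin n)} {J : ℤ}
    {W : ℕ → Set (EuclideanSpace ℝ (Fin n))} (hW : Antitone W) (hWm : ∀ t, MeasurableSet (W t))
    {M : ℕ} (hM : ∀ t, M ≤ t → W t = ∅) {h : EuclideanSpace ℝ (Fin n) → ℝ≥0} (hm : Measurable h)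
    {H : ℝ≥0} (hH : ∀ x, h x ≤ H) {lam : ℝ≥0}
    (hmean : ∀ (i : ℕ), ∀ x ∈ W i \ W (i + 1), dyadicMean c (J - i - 1) h x ≤ lam)
    (j : ℤ) (t : ℕ) (x : EuclideanSpace ℝ (Fin n)) :
    dilateConv σ j ((W t).indicator fun y => (h y : ℝ≥0∞)) x ≤ lam * σ Set.univ +
      ∑' r : ℕ, ‖∫ y, fluctuation c (J - (t + r : ℕ) - 1) (W (t + r) \ W (t + r + 1)) h (x - y)
        ∂(dilate σ j)‖ₑ := by
  set b : ℕ → EuclideanSpace ℝ (Fin n) → ℝ := fun r =>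
    fluctuation c (J - (t + r : ℕ) - 1) (W (t + r) \ W (t + r + 1)) h with hb
  have hbi : ∀ r, Integrable (fun y => b r (x - y)) (dilate σ j) := fun r =>
    integrable_comp_sub_of_bound (measurable_fluctuation c _ ((hWm _).diff (hWm _)) hm)
      (abs_fluctuation_le c _ _ hH) x
  have pt : ∀ u, (W t).indicator (fun y => (h y : ℝ≥0∞)) u ≤
      ENNReal.ofReal (lam + ∑ r ∈ Finset.range M, b r u) := by
    intro u
    have h1 := indicator_le_add_sum_fluctuation hW hM hmean t u
    refine le_trans (le_of_eq ?_) (ENNReal.ofReal_le_ofReal h1)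
    by_cases hu : u ∈ W t
    · rw [Set.indicator_of_mem hu, Set.indicator_of_mem hu]; simp
    · rw [Set.indicator_of_notMem hu, Set.indicator_of_notMem hu]; simp
  have pos : ∀ u, 0 ≤ lam + ∑ r ∈ Finset.range M, b r u := by
    intro u
    have h1 := indicator_le_add_sum_fluctuation hW hM hmean t u
    refine le_trans (Set.indicator_nonneg (fun y _ => (h y).coe_nonneg) u) h1
  have hsum : Integrable (fun y => ∑ r ∈ Finset.range M, b r (x - y)) (dilate σ j) :=
    integrable_finsetSum _ fun r _ => hbi r
  calc dilateConv σ j ((W t).indicator fun y => (h y : ℝ≥0∞)) x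
      ≤ ∫⁻ y, ENNReal.ofReal (lam + ∑ r ∈ Finset.range M, b r (x - y)) ∂(dilate σ j) :=
        lintegral_mono fun y => pt _
    _ = ENNReal.ofReal (∫ y, (lam + ∑ r ∈ Finset.range M, b r (x - y)) ∂(dilate σ j)) := by
        exact (ofReal_integral_eq_lintegral_ofReal ((integrable_const _).add hsum)
          (Filter.Eventually.of_forall fun y => pos _)).symm
    _ = ENNReal.ofReal (lam * σ.real Set.univ +
          ∑ r ∈ Finset.range M, ∫ y, b r (x - y) ∂(dilate σ j)) := by
        rw [integral_add (integrable_const _) hsum, integral_finsetSum _ fun r _ => hbi r,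
          integral_const, smul_eq_mul, Measure.real, Measure.real, dilate_univ, mul_comm]
    -- Absolute values enter only now, after integration against `σ_j`; earlier they would destroy
    -- the mean-zero cancellation.
    _ ≤ ENNReal.ofReal (lam * σ.real Set.univ) +
          ∑ r ∈ Finset.range M, ‖∫ y, b r (x - y) ∂(dilate σ j)‖ₑ := by
        refine ENNReal.ofReal_add_le.trans ?_
        gcongr
        refine (ENNReal.ofReal_le_ofReal (le_abs_self _)).trans ?_
        rw [← Real.norm_eq_abs, ofReal_norm]
        exact enorm_sum_le _ _
    _ ≤ _ := by
        gcongr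
        · rw [ENNReal.ofReal_mul lam.coe_nonneg, ENNReal.ofReal_coe_nnreal, Measure.real,
            ENNReal.ofReal_toReal (measure_ne_top _ _)]
        · exact ENNReal.sum_le_tsum _

/-- If `t0` is the first index with `x ∈ W t0 \ W (t0 + N)`, then `x` has left every later `W t`
with `t ≥ t0 + N`: at most `N` indices count. -/
theorem tsum_indicator_diff_le {X : Type*} {W : ℕ → Set X} (hW : Antitone W) (N : ℕ)
    (f : X → ℝ≥0∞) (x : X) :
    ∑' t, (W t \ W (t + N)).indicator f x ≤ (W 0).indicator (fun y => N * f y) x := by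
  classical
  by_cases hex : ∃ t, x ∈ W t \ W (t + N)
  · set t0 := Nat.find hex with ht0
    have h0 : x ∈ W t0 \ W (t0 + N) := Nat.find_spec hex
    rw [tsum_eq_sum (s := Finset.Ico t0 (t0 + N))]
    · rw [Set.indicator_of_mem (hW (Nat.zero_le _) h0.1)]
      calc ∑ t ∈ Finset.Ico t0 (t0 + N), (W t \ W (t + N)).indicator f x
          ≤ ∑ _t ∈ Finset.Ico t0 (t0 + N), f x :=
            Finset.sum_le_sum fun t _ => Set.indicator_le_self _ _ x
        _ = N * f x := by simp
    · intro t ht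
      refine Set.indicator_of_notMem (fun hx => ht ?_) _
      rw [Finset.mem_Ico]
      refine ⟨Nat.find_min' hex hx, ?_⟩
      by_contra hcon
      exact h0.2 (hW (by omega : t0 + N ≤ t) hx.1)
  · push Not at hex
    rw [ENNReal.tsum_eq_zero.2 fun t => Set.indicator_of_notMem (hex t) _]
    exact zero_le

theorem tsum_measure_shell_le {W : ℕ → Set (EuclideanSpace ℝ (Fin n))} (hW : Antitone W)
    (hWm : ∀ t, MeasurableSet (W t)) (s : ℕ) :
    ∑' t, volume (W (t + s) \ W (t + s + 1)) ≤ volume (W 0) := by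
  rw [← measure_iUnion]
  · refine measure_mono (Set.iUnion_subset fun t => ?_)
    exact Set.sdiff_subset.trans (hW (Nat.zero_le _))
  · intro t t' hne
    refine Set.disjoint_left.2 fun x hx hx' => ?_
    rcases lt_or_gt_of_ne hne with h | h
    · exact hx.2 (hW (by omega : t + s + 1 ≤ t' + s) hx'.1)
    · exact hx'.2 (hW (by omega : t' + s + 1 ≤ t + s) hx.1)
  · exact fun t => (hWm _).diff (hWm _)

end

/-! ### Summation over scales of the near parts and of the fluctuations. -/

section

variable {n : ℕ} {σ : Measure (EuclideanSpace ℝ (Fin n))}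

theorem indicator_rpow {X : Type*} (S : Set X) (f : X → ℝ≥0∞) {p : ℝ} (hp : 0 < p) (x : X) :
    S.indicator f x ^ p = S.indicator (fun y => f y ^ p) x := by
  by_cases hx : x ∈ S
  · rw [Set.indicator_of_mem hx, Set.indicator_of_mem hx]
  · rw [Set.indicator_of_notMem hx, Set.indicator_of_notMem hx, ENNReal.zero_rpow_of_pos hp]

/-- A cube of side `2^{J-t}` either meets `W t`, and then `hL` bounds its average, or contributes
nothing. The improving estimate is therefore uniform in the scale, and overlap at most `N` sums the
scales. -/
theorem tsum_lintegral_dilateConv_shell_le [IsFiniteMeasure σ]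
    (hsupp : σ (Metric.closedBall 0 1)ᶜ = 0) {p q : ℝ} (hp : 1 < p) (hpq : p < q)
    {A : ℝ≥0∞} (hA : ∀ (j : ℤ) (h : EuclideanSpace ℝ (Fin n) → ℝ≥0∞) (H : ℝ≥0), Measurable h →
      (∀ x, h x ≤ H) → ∫⁻ x, h x ^ p ≠ ∞ →
      ∫⁻ x, dilateConv σ j h x ^ q ≤
        A ^ q * dyadicVolume n j * ((dyadicVolume n j)⁻¹ * ∫⁻ x, h x ^ p) ^ (q / p))
    {c : EuclideanSpace ℝ (Fin n)} {J : ℤ} {W : ℕ → Set (EuclideanSpace ℝ (Fin n))}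
    (hW : Antitone W) (hWd : ∀ t : ℕ, IsDyadicUnion c (J - t) (W t))
    {h : EuclideanSpace ℝ (Fin n) → ℝ≥0∞} {H : ℝ≥0} (hm : Measurable h) (hH : ∀ x, h x ≤ H)
    (hfin : ∫⁻ x in W 0, h x ^ p ≠ ∞) {L : ℝ≥0∞}
    (hL : ∀ t : ℕ, ∀ x ∈ W t, ∫⁻ y in (dyadicCube c (J - t) (dyadicIndex c (J - t) x)).toSet,
      h y ^ p ≤ L * dyadicVolume n (J - t)) (N : ℕ) :
    ∑' t : ℕ, ∫⁻ x, dilateConv σ (J - t) ((W t \ W (t + N)).indicator h) x ^ q ≤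
      ((3 : ℝ≥0∞) ^ n) ^ (q - 1) * (A ^ q * L ^ (q / p - 1)) *
        (N * ∫⁻ x in W 0, h x ^ p) := by
  have hp0 : 0 < p := by linarith
  have hWm : ∀ t, MeasurableSet (W t) := fun t => (hWd t).measurableSet
  have hwm : ∀ t, Measurable ((W t \ W (t + N)).indicator h) := fun t =>
    hm.indicator ((hWm _).diff (hWm _))
  have hle : ∀ t x, (W t \ W (t + N)).indicator h x ^ p ≤ (W 0).indicator (fun y => h y ^ p) x := by
    intro t x
    rw [indicator_rpow _ _ hp0]
    refine Set.indicator_le_indicator_of_subset ?_ (fun _ => zero_le) x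
    exact Set.sdiff_subset.trans (hW (Nat.zero_le t))
  calc ∑' t : ℕ, ∫⁻ x, dilateConv σ (J - t) ((W t \ W (t + N)).indicator h) x ^ q
      ≤ ∑' t : ℕ, ((3 : ℝ≥0∞) ^ n) ^ (q - 1) * (A ^ q * L ^ (q / p - 1)) *
          ∫⁻ x, (W t \ W (t + N)).indicator h x ^ p := by
        refine ENNReal.tsum_le_tsum fun t => ?_
        refine lintegral_dilateConv_rpow_le_of_average hsupp hp hpq c (J - t) (hA (J - t))
          (hwm t) (fun x => (Set.indicator_le_self _ _ x).trans (hH x)) ?_ ?_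
        · refine ne_top_of_le_ne_top hfin ?_
          rw [← lintegral_indicator (hWm 0)]
          exact lintegral_mono fun x => hle t x
        · intro z
          by_cases hz : ∃ x ∈ (dyadicCube c (J - t) z).toSet, x ∈ W t
          · obtain ⟨x, hx, hxW⟩ := hz
            have h1 := hL t x hxW
            rw [mem_dyadicCube.1 hx] at h1
            refine le_trans (lintegral_mono fun y => ?_) h1
            gcongr
            exact Set.indicator_le_self _ _ y
          · push Not at hz
            rw [setLIntegral_congr_fun (g := fun _ => 0) (Cube.measurableSet_toSet _)]
            · simp
            · intro x hx
              simp only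
              rw [Set.indicator_of_notMem (fun hx' => hz x hx hx'.1), ENNReal.zero_rpow_of_pos hp0]
    _ = ((3 : ℝ≥0∞) ^ n) ^ (q - 1) * (A ^ q * L ^ (q / p - 1)) *
          ∫⁻ x, ∑' t, (W t \ W (t + N)).indicator (fun y => h y ^ p) x := by
        rw [ENNReal.tsum_mul_left, lintegral_tsum fun t =>
          ((hm.pow_const p).indicator ((hWm _).diff (hWm _))).aemeasurable]
        simp only [indicator_rpow _ _ hp0]
    _ ≤ _ := by
        gcongr
        calc ∫⁻ x, ∑' t, (W t \ W (t + N)).indicator (fun y => h y ^ p) x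
            ≤ ∫⁻ x, (W 0).indicator (fun y => N * h y ^ p) x :=
              lintegral_mono fun x => tsum_indicator_diff_le hW N _ x
          _ = N * ∫⁻ x in W 0, h x ^ p := by
              rw [lintegral_indicator (hWm 0), lintegral_const_mul' _ _ (by simp)]

/-- At a fixed separation `s` the shells are disjoint as `t` varies, so their volumes sum to at most
that of `W 0`, and the gain depends only on `s`. -/
theorem tsum_lintegral_fluctuation_sq_le [IsFiniteMeasure σ]
    (hsupp : σ (Metric.closedBall 0 1)ᶜ = 0) {c : EuclideanSpace ℝ (Fin n)} {ε : ℝ} (hε : 0 < ε)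
    {K : ℝ≥0}
    (hK : ∀ (j : ℤ) (s : ℕ) (z : Fin n → ℤ) (b : EuclideanSpace ℝ (Fin n) → ℝ) (H : ℝ),
      Measurable b → (∀ x, |b x| ≤ H) → (∀ x ∉ (dyadicCube c j z).toSet, b x = 0) →
      (∀ w, ∫ x in (dyadicCube c (j - s) w).toSet, b x = 0) →
      ∫⁻ x, ‖∫ y, b (x - y) ∂(dilate σ j)‖ₑ ^ (2 : ℝ) ≤
        K * ENNReal.ofReal ((2 : ℝ) ^ (-ε * s)) * ∫⁻ x, ‖b x‖ₑ ^ (2 : ℝ))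
    {J : ℤ} {W : ℕ → Set (EuclideanSpace ℝ (Fin n))}
    (hW : Antitone W) (hWd : ∀ t : ℕ, IsDyadicUnion c (J - t) (W t))
    {h : EuclideanSpace ℝ (Fin n) → ℝ≥0} {H : ℝ≥0} (hm : Measurable h) (hH : ∀ x, h x ≤ H)
    (s : ℕ) :
    ∑' t : ℕ, ∫⁻ x, ‖∫ y, fluctuation c (J - (t + s : ℕ) - 1) (W (t + s) \ W (t + s + 1)) h (x - y)
        ∂(dilate σ (J - t))‖ₑ ^ (2 : ℝ) ≤
      3 ^ n * (K * ENNReal.ofReal ((2 : ℝ) ^ (-ε * s))) * (H ^ 2 * volume (W 0)) := by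
  have hWm : ∀ t, MeasurableSet (W t) := fun t => (hWd t).measurableSet
  calc ∑' t : ℕ, ∫⁻ x, ‖∫ y, fluctuation c (J - (t + s : ℕ) - 1)
          (W (t + s) \ W (t + s + 1)) h (x - y) ∂(dilate σ (J - t))‖ₑ ^ (2 : ℝ)
      ≤ ∑' t : ℕ, 3 ^ n * (K * ENNReal.ofReal ((2 : ℝ) ^ (-ε * s))) *
          (H ^ 2 * volume (W (t + s) \ W (t + s + 1))) := by
        refine ENNReal.tsum_le_tsum fun t => ?_
        have e1 : J - ((t + s : ℕ) : ℤ) - 1 = (J - t) - ((s + 1 : ℕ) : ℤ) := by push_cast; ring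
        have e2 : J - ((t + s + 1 : ℕ) : ℤ) = (J - t) - ((s + 1 : ℕ) : ℤ) := by push_cast; ring
        have hV : IsDyadicUnion c ((J - t) - ((s + 1 : ℕ) : ℤ)) (W (t + s) \ W (t + s + 1)) := by
          refine ((hWd (t + s)).of_le ?_).diff ?_
          · push_cast; omega
          · rw [← e2]; exact hWd _
        rw [e1]
        refine enorm_integral_fluctuation_sq_le hsupp hm hH hV fun z b H' h1 h2 h3 h4 => ?_
        refine (hK (J - t) (s + 1) z b H' h1 h2 h3 h4).trans ?_
        -- The shell at distance `s` is averaged one level lower, so the true separation is `s + 1`;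
        -- the extra gain is discarded.
        have e3 : (2 : ℝ) ^ (-ε * ((s + 1 : ℕ) : ℝ)) ≤ (2 : ℝ) ^ (-ε * (s : ℝ)) := by
          refine Real.rpow_le_rpow_of_exponent_le (by norm_num) ?_
          push_cast
          nlinarith
        gcongr
    _ ≤ _ := by
        rw [ENNReal.tsum_mul_left, ENNReal.tsum_mul_left]
        gcongr
        exact tsum_measure_shell_le hW hWm s

theorem tsum_geometric_rpow_ne_top {ε : ℝ} (hε : 0 < ε) :
    ∑' r : ℕ, ENNReal.ofReal ((2 : ℝ) ^ (-ε * r)) ^ (1 / 2 : ℝ) ≠ ∞ := by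
  set ρ : ℝ := (2 : ℝ) ^ (-ε / 2) with hρ
  have hρ0 : 0 < ρ := by positivity
  have hρ1 : ρ < 1 := Real.rpow_lt_one_of_one_lt_of_neg (by norm_num) (by linarith)
  have e : ∀ r : ℕ, ENNReal.ofReal ((2 : ℝ) ^ (-ε * r)) ^ (1 / 2 : ℝ) = ENNReal.ofReal ρ ^ r := by
    intro r
    rw [ENNReal.ofReal_rpow_of_pos (by positivity), ← ENNReal.ofReal_pow hρ0.le, hρ,
      ← Real.rpow_mul (by norm_num), ← Real.rpow_natCast, ← Real.rpow_mul (by norm_num)]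
    congr 2
    ring
  simp only [e]
  rw [ENNReal.tsum_geometric]
  refine ENNReal.inv_ne_top.2 ?_
  rw [Ne, tsub_eq_zero_iff_le, not_le]
  rwa [ENNReal.ofReal_lt_one]

end

/-! ### The localized estimate for one pair of level pieces. -/

section

variable {n : ℕ} {σ : Measure (EuclideanSpace ℝ (Fin n))}

theorem rpow_le_self_of_one_le {x : ℝ≥0∞} (hx : 1 ≤ x) {θ : ℝ} (hθ : θ ≤ 1) : x ^ θ ≤ x := by
  simpa using ENNReal.rpow_le_rpow_of_exponent_le hx hθ

/-- The hypothesis bounds averages on cubes of level `J - i`, while the shell is averaged on their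
children; passing to a child costs `2^n`. The root `1/p` of `2^n ℓ ≥ 1` is simply dropped. -/
theorem dyadicMean_shell_le {p : ℝ} (hp : 1 < p) {c : EuclideanSpace ℝ (Fin n)} {J : ℤ}
    {W : ℕ → Set (EuclideanSpace ℝ (Fin n))} {h : EuclideanSpace ℝ (Fin n) → ℝ≥0}
    (hm : Measurable h) {ℓ a : ℝ≥0} (hℓ : 1 ≤ ℓ)
    (hL : ∀ t : ℕ, ∀ x ∈ W t, ∫⁻ y in (dyadicCube c (J - t) (dyadicIndex c (J - t) x)).toSet,
      (h y : ℝ≥0∞) ^ p ≤ ℓ * (a : ℝ≥0∞) ^ p * dyadicVolume n (J - t)) (i : ℕ)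
    (x : EuclideanSpace ℝ (Fin n)) (hx : x ∈ W i) :
    dyadicMean c (J - i - 1) h x ≤ (2 ^ n * ℓ * a : ℝ≥0) := by
  have hp0 : 0 < p := by linarith
  have h1 : dyadicMean c (J - i - 1) h x ≤ ((2 ^ n * ℓ : ℝ≥0∞) * (a : ℝ≥0∞) ^ p) ^ (1 / p) := by
    refine dyadicMean_le_rpow hm hp ?_
    calc ∫⁻ y in (dyadicCube c (J - i - 1) (dyadicIndex c (J - i - 1) x)).toSet, (h y : ℝ≥0∞) ^ p
        ≤ ∫⁻ y in (dyadicCube c (J - i) (dyadicIndex c (J - i) x)).toSet, (h y : ℝ≥0∞) ^ p :=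
          lintegral_mono_set (dyadicCube_subset (by omega) (mem_dyadicCube_index c _ x)
            (mem_dyadicCube_index c _ x))
      _ ≤ ℓ * (a : ℝ≥0∞) ^ p * dyadicVolume n (J - i) := hL i x hx
      _ = _ := by
          have : J - (i : ℤ) = (J - i - 1) + 1 := by ring
          rw [this, dyadicVolume_succ]
          ring_nf
  refine h1.trans ?_
  rw [ENNReal.mul_rpow_of_nonneg _ _ (by positivity), ← ENNReal.rpow_mul,
    mul_one_div_cancel hp0.ne', ENNReal.rpow_one]
  push_cast
  gcongr
  refine rpow_le_self_of_one_le ?_ ?_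
  · exact one_le_mul (one_le_pow₀ (by norm_num)) (by exact_mod_cast hℓ)
  · rw [div_le_one hp0]; exact hp.le

/-- Three contributions are balanced by the gap `N = κ(m+l)`. Shells within `N` generations of the
averaging scale lose `(m+1)²(m+l)` through the improving bound, the means of deeper shells lose
`(m+1)²`, and the deeper fluctuations lose nothing because their `L²` decay beats the sup bounds
`4^m` and `4^l`. All losses fit under `(m+1)^4 (l+1)^4`. -/
theorem exists_localized_bound [IsFiniteMeasure σ] (hsupp : σ (Metric.closedBall 0 1)ᶜ = 0)
    {α : ℝ} (hα : 0 < α) (hdecay : HasFourierDecay σ α)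
    {p q : ℝ} (hp : 1 < p) (hpq : p < q) (hconv : ConvBounded σ p q) :
    ∃ C : ℝ≥0, ∀ (c : EuclideanSpace ℝ (Fin n)) (J : ℤ) (z : Fin n → ℤ)
      (W : ℕ → Set (EuclideanSpace ℝ (Fin n))) (M : ℕ) (h k : EuclideanSpace ℝ (Fin n) → ℝ≥0)
      (a b : ℝ≥0) (m l : ℕ), Measurable h → Measurable k → Antitone W →
      (∀ t : ℕ, IsDyadicUnion c (J - t) (W t)) → W 0 ⊆ (dyadicCube c J z).toSet →
      (∀ t, M ≤ t → W t = ∅) → (∀ x, h x ≤ 4 ^ m * a) → (∀ x, k x ≤ 4 ^ l * b) →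
      ∫⁻ x in (dyadicCube c J z).toSet, (h x : ℝ≥0∞) ^ p ≤ (a : ℝ≥0∞) ^ p * dyadicVolume n J →
      ∫⁻ x in (dyadicCube c J z).triple.toSet, (k x : ℝ≥0∞) ^ (Real.conjExponent q) ≤
        (b : ℝ≥0∞) ^ (Real.conjExponent q) * (3 ^ n * dyadicVolume n J) →
      (∀ t : ℕ, ∀ x ∈ W t, ∫⁻ y in (dyadicCube c (J - t) (dyadicIndex c (J - t) x)).toSet,
        (h y : ℝ≥0∞) ^ p ≤
          (4 * ((m : ℝ≥0) + 1) ^ 2 : ℝ≥0) * (a : ℝ≥0∞) ^ p * dyadicVolume n (J - t)) →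
      ∫⁻ x in (dyadicCube c J z).triple.toSet,
        (⨆ t : ℕ, dilateConv σ (J - t) ((W t).indicator fun y => (h y : ℝ≥0∞)) x) * k x ≤
        C * (((m : ℝ≥0∞) + 1) ^ 4 * ((l : ℝ≥0∞) + 1) ^ 4) * (a * b * dyadicVolume n J) := by
  obtain ⟨ε, K, hε, hK⟩ := exists_l2_decay hα hdecay
  obtain ⟨A, hA⟩ := exists_lintegral_dilateConv_rpow_le hp hpq hconv
  have hp0 : 0 < p := by linarith
  have hq1 : 1 < q := by linarith
  have hq0 : 0 < q := by linarith
  set q' := Real.conjExponent q with hq'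
  have hqq : q.HolderConjugate q' := Real.HolderConjugate.conjExponent hq1
  have hq'0 : 0 < q' := hqq.symm.pos
  have hadd : 1 / q + 1 / q' = 1 := by simpa [one_div] using hqq.inv_add_inv_eq_one
  set G : ℝ≥0∞ := ∑' r : ℕ, ENNReal.ofReal ((2 : ℝ) ^ (-ε * r)) ^ (1 / 2 : ℝ) with hG
  have hGt : G ≠ ∞ := tsum_geometric_rpow_ne_top hε
  -- With `εκ ≥ 4` the square root `2^{-εN/2}` of the `L²` gain is at most `4^{-(m+l)}`.
  set κ : ℕ := ⌈4 / ε⌉₊ with hκ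
  have hκε : 4 ≤ ε * κ := by
    have := Nat.le_ceil (4 / ε)
    rw [div_le_iff₀ hε] at this
    linarith
  set S := σ Set.univ with hS
  have hSt : S ≠ ∞ := measure_ne_top _ _
  -- One term each for the near parts, the means, and the fluctuations.
  set D : ℝ≥0∞ := 3 ^ n * 3 ^ n * A * 4 * κ + 2 ^ n * 4 * S * 3 ^ n
    + 3 ^ n * 3 ^ n * (K : ℝ≥0∞) ^ (1 / 2 : ℝ) * G with hD
  have h3t : (3 : ℝ≥0∞) ^ n ≠ ∞ := ENNReal.pow_ne_top (by norm_num)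
  have h2t : (2 : ℝ≥0∞) ^ n ≠ ∞ := ENNReal.pow_ne_top (by norm_num)
  have h31 : (1 : ℝ≥0∞) ≤ 3 ^ n := one_le_pow₀ (by norm_num)
  have hDt : D ≠ ∞ := by
    have hKt : (K : ℝ≥0∞) ^ (1 / 2 : ℝ) ≠ ∞ :=
      ENNReal.rpow_ne_top_of_nonneg (by norm_num) ENNReal.coe_ne_top
    rw [hD]
    finiteness
  refine ⟨D.toNNReal, ?_⟩
  rw [ENNReal.coe_toNNReal hDt]
  intro c J z W M h k a b m l hhm hkm hW hWd hW0 hM hh hk hhp hkq hL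
  set V := dyadicVolume n J with hV
  have hV0 : V ≠ 0 := dyadicVolume_ne_zero n J
  have hVt : V ≠ ∞ := dyadicVolume_ne_top n J
  set Q := (dyadicCube c J z).toSet with hQ
  set μ := volume.restrict (dyadicCube c J z).triple.toSet with hμ
  have hμ1 : μ Set.univ = 3 ^ n * V := by
    rw [hμ, Measure.restrict_apply_univ, Cube.volume_triple, volume_dyadicCube]
  have hWm : ∀ t, MeasurableSet (W t) := fun t => (hWd t).measurableSet
  set ℓ : ℝ≥0 := 4 * ((m : ℝ≥0) + 1) ^ 2 with hℓ
  have hℓ1 : 1 ≤ ℓ := by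
    rw [hℓ]
    exact one_le_mul (by norm_num) (one_le_pow₀ (by simp))
  set N : ℕ := κ * (m + l) with hN
  set he : EuclideanSpace ℝ (Fin n) → ℝ≥0∞ := fun y => (h y : ℝ≥0∞) with hhe
  have hem : Measurable he := by fun_prop
  have hkem : Measurable fun x => (k x : ℝ≥0∞) := by fun_prop
  set lam : ℝ≥0 := 2 ^ n * ℓ * a with hlam
  set near : ℕ → EuclideanSpace ℝ (Fin n) → ℝ≥0∞ := fun t =>
    dilateConv σ (J - t) ((W t \ W (t + N)).indicator he) with hnear
  set φ : ℕ → ℕ → EuclideanSpace ℝ (Fin n) → ℝ≥0∞ := fun r t x =>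
    ‖∫ y, fluctuation c (J - (t + (N + r) : ℕ) - 1) (W (t + (N + r)) \ W (t + (N + r) + 1)) h (x - y)
      ∂(dilate σ (J - t))‖ₑ with hφ
  have hnm : ∀ t, Measurable (near t) := fun t =>
    measurable_dilateConv _ (hem.indicator ((hWm _).diff (hWm _)))
  have hφm : ∀ r t, Measurable (φ r t) := fun r t =>
    measurable_enorm_integral_sub (measurable_fluctuation c _ ((hWm _).diff (hWm _)) hhm)
  -- the pointwise decomposition
  have pt : ∀ x, (⨆ t : ℕ, dilateConv σ (J - t) ((W t).indicator he) x) * k x ≤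
      (⨆ t, near t x) * k x + lam * S * k x + ∑' r, (⨆ t, φ r t x) * k x := by
    intro x
    rw [ENNReal.tsum_mul_right, ← add_mul, ← add_mul]
    gcongr
    refine iSup_le fun t => ?_
    have e : (W t).indicator he = fun y =>
        (W t \ W (t + N)).indicator he y + (W (t + N)).indicator he y := by
      ext y
      have hsub := hW (Nat.le_add_right t N)
      by_cases h1 : y ∈ W (t + N)
      · have h2 : y ∈ W t := hsub h1
        simp [h1, h2]
      · by_cases h2 : y ∈ W t <;> simp [h1, h2]
    rw [e, dilateConv_add _ (hem.indicator ((hWm _).diff (hWm _))), add_assoc]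
    refine add_le_add (le_iSup (fun t => near t x) t) ?_
    refine (dilateConv_indicator_le hW hWm hM hhm hh (lam := lam)
      (fun i x hx => dyadicMean_shell_le hp hhm hℓ1 hL i x hx.1) (J - t) (t + N) x).trans ?_
    gcongr with r
    refine le_trans (le_of_eq ?_) (le_iSup (fun t => φ r t x) t)
    simp only [hφ, add_assoc]
  have hkb : (∫⁻ x, (k x : ℝ≥0∞) ^ q' ∂μ) ^ (1 / q') ≤ b * (3 ^ n * V) ^ (1 / q') := by
    calc (∫⁻ x, (k x : ℝ≥0∞) ^ q' ∂μ) ^ (1 / q')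
        ≤ ((b : ℝ≥0∞) ^ q' * (3 ^ n * V)) ^ (1 / q') := by gcongr
      _ = _ := by
        rw [ENNReal.mul_rpow_of_nonneg _ _ (by positivity), ← ENNReal.rpow_mul,
          mul_one_div_cancel hq'0.ne', ENNReal.rpow_one]
  have h3V : (3 ^ n * V) ^ (1 / q) * (3 ^ n * V) ^ (1 / q') = 3 ^ n * V := by
    rw [← ENNReal.rpow_add _ _ (by positivity) (ENNReal.mul_ne_top h3t hVt), hadd, ENNReal.rpow_one]
  have hbound : ∫⁻ x, (k x : ℝ≥0∞) ∂μ ≤ b * (3 ^ n * V) := by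
    have h1 := ENNReal.lintegral_mul_le_Lp_mul_Lq μ hqq (f := fun _ => 1)
      (g := fun x => (k x : ℝ≥0∞)) aemeasurable_const hkem.aemeasurable
    simp only [Pi.mul_apply, one_mul, ENNReal.one_rpow, lintegral_const, hμ1] at h1
    calc ∫⁻ x, (k x : ℝ≥0∞) ∂μ ≤ (3 ^ n * V) ^ (1 / q) * (b * (3 ^ n * V) ^ (1 / q')) :=
          h1.trans (by gcongr)
      _ = b * ((3 ^ n * V) ^ (1 / q) * (3 ^ n * V) ^ (1 / q')) := by ring
      _ = _ := by rw [h3V]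
  have hnearb : ∫⁻ x, (⨆ t, near t x) * k x ∂μ ≤
      3 ^ n * A * ℓ * N * a * (b * (3 ^ n * V)) := by
    set X : ℝ≥0∞ := 3 ^ n * A * ℓ * N * a with hX
    have h1 := lintegral_iSup_mul_le (μ := μ) hnm hkem hqq
    have hI : ∫⁻ x in W 0, he x ^ p ≤ (a : ℝ≥0∞) ^ p * V := (lintegral_mono_set hW0).trans hhp
    have hIt : ∫⁻ x in W 0, he x ^ p ≠ ∞ := ne_top_of_le_ne_top
      (ENNReal.mul_ne_top (ENNReal.rpow_ne_top_of_nonneg hp0.le ENNReal.coe_ne_top) hVt) hI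
    have h2 := tsum_lintegral_dilateConv_shell_le hsupp hp hpq hA hW hWd hem
      (H := 4 ^ m * a) (fun x => ENNReal.coe_le_coe.2 (hh x)) hIt hL N
    have hqp : 0 ≤ q / p - 1 := by rw [sub_nonneg, one_le_div hp0]; exact hpq.le
    have h3 : ∑' t, ∫⁻ x, near t x ^ q ∂μ ≤ X ^ q * V := by
      calc ∑' t, ∫⁻ x, near t x ^ q ∂μ ≤ ∑' t, ∫⁻ x, near t x ^ q :=
            ENNReal.tsum_le_tsum fun t => setLIntegral_le_lintegral _ _
        _ ≤ _ := h2
        _ ≤ ((3 : ℝ≥0∞) ^ n) ^ (q - 1) * ((A : ℝ≥0∞) ^ q *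
              ((ℓ : ℝ≥0∞) * (a : ℝ≥0∞) ^ p) ^ (q / p - 1)) * (N * ((a : ℝ≥0∞) ^ p * V)) := by
            gcongr
        _ = ((3 : ℝ≥0∞) ^ n) ^ (q - 1) * (A : ℝ≥0∞) ^ q * (ℓ : ℝ≥0∞) ^ (q / p - 1) * N *
              (a : ℝ≥0∞) ^ q * V := by
            have e1 : (a : ℝ≥0∞) ^ q = ((a : ℝ≥0∞) ^ p) ^ (q / p - 1) * (a : ℝ≥0∞) ^ p := by
              rw [← ENNReal.rpow_mul, ← ENNReal.rpow_add_of_nonneg _ _ (by positivity) hp0.le]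
              congr 1
              field_simp
              ring
            rw [e1, ENNReal.mul_rpow_of_nonneg _ _ hqp]
            ring
        -- All exponents are raised to `q` so that a `q`-th root can be taken termwise. For `N` this
        -- uses that it is `0` or at least `1`.
        _ ≤ ((3 : ℝ≥0∞) ^ n) ^ q * (A : ℝ≥0∞) ^ q * (ℓ : ℝ≥0∞) ^ q * (N : ℝ≥0∞) ^ q *
              (a : ℝ≥0∞) ^ q * V := by
            have e1 : ((3 : ℝ≥0∞) ^ n) ^ (q - 1) ≤ ((3 : ℝ≥0∞) ^ n) ^ q :=
              ENNReal.rpow_le_rpow_of_exponent_le h31 (by linarith)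
            have e2 : (ℓ : ℝ≥0∞) ^ (q / p - 1) ≤ (ℓ : ℝ≥0∞) ^ q := by
              refine ENNReal.rpow_le_rpow_of_exponent_le (by exact_mod_cast hℓ1) ?_
              have : q / p ≤ q := div_le_self hq0.le hp.le
              linarith
            have e3 : (N : ℝ≥0∞) ≤ (N : ℝ≥0∞) ^ q := by
              rcases Nat.eq_zero_or_pos N with h0 | h0
              · simp [h0]
              · have h1N : (1 : ℝ≥0∞) ≤ N := by exact_mod_cast h0
                simpa using ENNReal.rpow_le_rpow_of_exponent_le h1N hq1.le
            gcongr
        _ = X ^ q * V := by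
            rw [hX]
            simp only [ENNReal.mul_rpow_of_nonneg _ _ hq0.le]
    calc ∫⁻ x, (⨆ t, near t x) * k x ∂μ
        ≤ (X ^ q * V) ^ (1 / q) * (b * (3 ^ n * V) ^ (1 / q')) := by
          refine h1.trans ?_
          gcongr
      _ = X * V ^ (1 / q) * (b * (3 ^ n * V) ^ (1 / q')) := by
          rw [ENNReal.mul_rpow_of_nonneg _ _ (by positivity), ← ENNReal.rpow_mul,
            mul_one_div_cancel hq0.ne', ENNReal.rpow_one]
      _ ≤ X * (3 ^ n * V) ^ (1 / q) * (b * (3 ^ n * V) ^ (1 / q')) := by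
          gcongr
          exact le_mul_of_one_le_left zero_le h31
      _ = X * (b * ((3 ^ n * V) ^ (1 / q) * (3 ^ n * V) ^ (1 / q'))) := by ring
      _ = _ := by rw [h3V]
  have hfar : ∑' r, ∫⁻ x, (⨆ t, φ r t x) * k x ∂μ ≤
      3 ^ n * 3 ^ n * (K : ℝ≥0∞) ^ (1 / 2 : ℝ) * G * (a * b * V) := by
    have hk2 : ∫⁻ x, (k x : ℝ≥0∞) ^ (2 : ℝ) ∂μ ≤ (4 ^ l * b : ℝ≥0∞) ^ (2 : ℝ) * (3 ^ n * V) := by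
      rw [← hμ1, ← lintegral_const]
      refine lintegral_mono fun x => ?_
      gcongr
      exact_mod_cast hk x
    have hvol : volume (W 0) ≤ V := (measure_mono hW0).trans (volume_dyadicCube c J z).le
    have one : ∀ r, ∫⁻ x, (⨆ t, φ r t x) * k x ∂μ ≤
        3 ^ n * 3 ^ n * (K : ℝ≥0∞) ^ (1 / 2 : ℝ) *
          ENNReal.ofReal ((2 : ℝ) ^ (-ε * r)) ^ (1 / 2 : ℝ) * (a * b * V) := by
      intro r
      have h1 := lintegral_iSup_mul_le (μ := μ) (hφm r) hkem Real.HolderConjugate.two_two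
      have h2 : ∑' t, ∫⁻ x, φ r t x ^ (2 : ℝ) ∂μ ≤
          3 ^ n * (K * ENNReal.ofReal ((2 : ℝ) ^ (-ε * (N + r : ℕ)))) *
            ((4 ^ m * a : ℝ≥0∞) ^ 2 * V) := by
        calc ∑' t, ∫⁻ x, φ r t x ^ (2 : ℝ) ∂μ ≤ ∑' t, ∫⁻ x, φ r t x ^ (2 : ℝ) :=
              ENNReal.tsum_le_tsum fun t => setLIntegral_le_lintegral _ _
          _ ≤ _ := tsum_lintegral_fluctuation_sq_le hsupp hε (fun j s => hK c j s) hW hWd hhm hh (N + r)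
          _ ≤ _ := by
            push_cast
            gcongr
      -- The choice of `κ` is spent here; the part `r` beyond `N` is kept and is summable.
      have e4 : ENNReal.ofReal ((2 : ℝ) ^ (-ε * (N + r : ℕ))) ^ (1 / 2 : ℝ) * 4 ^ m * 4 ^ l ≤
          ENNReal.ofReal ((2 : ℝ) ^ (-ε * r)) ^ (1 / 2 : ℝ) := by
        have h4 : (4 : ℝ≥0∞) ^ m * 4 ^ l = ENNReal.ofReal ((4 : ℝ) ^ (m + l)) := by
          rw [← pow_add, ENNReal.ofReal_pow (by norm_num)]
          norm_num
        rw [mul_assoc, h4, ENNReal.ofReal_rpow_of_pos (by positivity),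
          ENNReal.ofReal_rpow_of_pos (by positivity), ← ENNReal.ofReal_mul (by positivity)]
        refine ENNReal.ofReal_le_ofReal ?_
        have h5 : (4 : ℝ) ^ (m + l) = (2 : ℝ) ^ (2 * ((m : ℝ) + l)) := by
          rw [Real.rpow_mul (by norm_num)]
          norm_num
          rw [← Real.rpow_natCast]
          push_cast
          rfl
        rw [h5, ← Real.rpow_mul (by norm_num), ← Real.rpow_mul (by norm_num),
          ← Real.rpow_add (by norm_num)]
        refine Real.rpow_le_rpow_of_exponent_le (by norm_num) ?_
        have h6 : ((N : ℕ) : ℝ) = κ * (m + l) := by rw [hN]; push_cast; ring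
        push_cast
        rw [h6]
        have h7 : (0 : ℝ) ≤ (m : ℝ) + l := by positivity
        nlinarith
      refine h1.trans ?_
      calc (∑' t, ∫⁻ x, φ r t x ^ (2 : ℝ) ∂μ) ^ (1 / 2 : ℝ) *
            (∫⁻ x, (k x : ℝ≥0∞) ^ (2 : ℝ) ∂μ) ^ (1 / 2 : ℝ)
          ≤ (3 ^ n * (K * ENNReal.ofReal ((2 : ℝ) ^ (-ε * (N + r : ℕ)))) *
            ((4 ^ m * a : ℝ≥0∞) ^ 2 * (3 ^ n * V))) ^ (1 / 2 : ℝ) *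
            ((4 ^ l * b : ℝ≥0∞) ^ (2 : ℝ) * (3 ^ n * V)) ^ (1 / 2 : ℝ) := by
            gcongr
            refine h2.trans ?_
            gcongr
            exact le_mul_of_one_le_left zero_le h31
        _ = ((3 : ℝ≥0∞) ^ n) ^ (1 / 2 : ℝ) * (3 ^ n * V) * (K : ℝ≥0∞) ^ (1 / 2 : ℝ) *
            (ENNReal.ofReal ((2 : ℝ) ^ (-ε * (N + r : ℕ))) ^ (1 / 2 : ℝ) * 4 ^ m * 4 ^ l) *
              (a * b) := by
            have e5 : ∀ y : ℝ≥0∞, (y ^ (2 : ℝ)) ^ (1 / 2 : ℝ) = y := fun y => by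
              rw [← ENNReal.rpow_mul]; norm_num
            have e6 : ∀ y : ℝ≥0∞, y ^ 2 = y ^ (2 : ℝ) := fun y => (ENNReal.rpow_two y).symm
            have e7 : ∀ y : ℝ≥0∞, y ^ (1 / 2 : ℝ) * y ^ (1 / 2 : ℝ) = y := fun y => by
              rw [← ENNReal.rpow_add_of_nonneg _ _ (by norm_num) (by norm_num)]; norm_num
            have e8 := e7 (3 ^ n * V)
            rw [e6]
            rw [ENNReal.mul_rpow_of_nonneg (3 ^ n * (K * ENNReal.ofReal ((2 : ℝ) ^ (-ε * (N + r : ℕ)))))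
                _ (by norm_num : (0 : ℝ) ≤ 1 / 2),
              ENNReal.mul_rpow_of_nonneg (3 ^ n) (K * ENNReal.ofReal ((2 : ℝ) ^ (-ε * (N + r : ℕ))))
                (by norm_num : (0 : ℝ) ≤ 1 / 2),
              ENNReal.mul_rpow_of_nonneg (K : ℝ≥0∞) _ (by norm_num : (0 : ℝ) ≤ 1 / 2),
              ENNReal.mul_rpow_of_nonneg ((4 ^ m * a : ℝ≥0∞) ^ (2 : ℝ)) _
                (by norm_num : (0 : ℝ) ≤ 1 / 2),
              ENNReal.mul_rpow_of_nonneg ((4 ^ l * b : ℝ≥0∞) ^ (2 : ℝ)) _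
                (by norm_num : (0 : ℝ) ≤ 1 / 2), e5, e5]
            calc _ = ((3 : ℝ≥0∞) ^ n) ^ (1 / 2 : ℝ) *
                  ((3 ^ n * V) ^ (1 / 2 : ℝ) * (3 ^ n * V) ^ (1 / 2 : ℝ)) * (K : ℝ≥0∞) ^ (1 / 2 : ℝ) *
                  (ENNReal.ofReal ((2 : ℝ) ^ (-ε * (N + r : ℕ))) ^ (1 / 2 : ℝ) * 4 ^ m * 4 ^ l) *
                  (a * b) := by ring
              _ = _ := by rw [e8]
        _ ≤ (3 : ℝ≥0∞) ^ n * (3 ^ n * V) * (K : ℝ≥0∞) ^ (1 / 2 : ℝ) *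
            ENNReal.ofReal ((2 : ℝ) ^ (-ε * r)) ^ (1 / 2 : ℝ) * (a * b) := by
            gcongr
            exact rpow_le_self_of_one_le h31 (by norm_num)
        _ = _ := by ring
    calc ∑' r, ∫⁻ x, (⨆ t, φ r t x) * k x ∂μ
        ≤ ∑' r : ℕ, 3 ^ n * 3 ^ n * (K : ℝ≥0∞) ^ (1 / 2 : ℝ) *
          ENNReal.ofReal ((2 : ℝ) ^ (-ε * r)) ^ (1 / 2 : ℝ) * (a * b * V) :=
          ENNReal.tsum_le_tsum one
      _ = _ := by rw [ENNReal.tsum_mul_right, ENNReal.tsum_mul_left]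
  set P : ℝ≥0∞ := ((m : ℝ≥0∞) + 1) ^ 4 * ((l : ℝ≥0∞) + 1) ^ 4 with hP
  have hP1 : ((m : ℝ≥0∞) + 1) ^ 2 * (m + l) ≤ P := by
    have : (m + 1) ^ 2 * (m + l) ≤ (m + 1) ^ 4 * (l + 1) ^ 4 := by
      have h1 : m + l ≤ (m + 1) * (l + 1) := by nlinarith
      calc (m + 1) ^ 2 * (m + l) ≤ (m + 1) ^ 2 * ((m + 1) * (l + 1)) := by gcongr
        _ = (m + 1) ^ 3 * (l + 1) ^ 1 := by ring
        _ ≤ _ := by gcongr <;> omega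
    rw [hP]; exact_mod_cast this
  have hP2 : ((m : ℝ≥0∞) + 1) ^ 2 ≤ P := by
    have : (m + 1) ^ 2 * 1 ≤ (m + 1) ^ 4 * (l + 1) ^ 4 := by
      gcongr
      · omega
      · omega
      · exact Nat.one_le_pow _ _ (by omega)
    rw [mul_one] at this
    rw [hP]; exact_mod_cast this
  have hP3 : 1 ≤ P := by
    rw [hP]
    exact one_le_mul (one_le_pow₀ (by simp)) (one_le_pow₀ (by simp))
  calc ∫⁻ x, (⨆ t : ℕ, dilateConv σ (J - t) ((W t).indicator he) x) * k x ∂μ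
      ≤ ∫⁻ x, ((⨆ t, near t x) * k x + lam * S * k x + ∑' r, (⨆ t, φ r t x) * k x) ∂μ :=
        lintegral_mono pt
    _ = ∫⁻ x, (⨆ t, near t x) * k x ∂μ + lam * S * ∫⁻ x, k x ∂μ +
          ∑' r, ∫⁻ x, (⨆ t, φ r t x) * k x ∂μ := by
        have m1 : Measurable fun x => (⨆ t, near t x) * (k x : ℝ≥0∞) :=
          (Measurable.iSup hnm).mul hkem
        have m2 : ∀ r, Measurable fun x => (⨆ t, φ r t x) * (k x : ℝ≥0∞) := fun r =>
          (Measurable.iSup (hφm r)).mul hkem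
        have m3 : Measurable fun x => (⨆ t, near t x) * (k x : ℝ≥0∞) + lam * S * k x :=
          m1.add (hkem.const_mul _)
        rw [lintegral_add_left m3, lintegral_add_left m1,
          lintegral_const_mul _ hkem, lintegral_tsum fun r => (m2 r).aemeasurable]
    _ ≤ 3 ^ n * A * ℓ * N * a * (b * (3 ^ n * V)) + lam * S * (b * (3 ^ n * V)) +
          3 ^ n * 3 ^ n * (K : ℝ≥0∞) ^ (1 / 2 : ℝ) * G * (a * b * V) := by gcongr
    _ = (3 ^ n * 3 ^ n * A * 4 * κ * (((m : ℝ≥0∞) + 1) ^ 2 * (m + l)) +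
          2 ^ n * 4 * S * 3 ^ n * ((m : ℝ≥0∞) + 1) ^ 2 +
          3 ^ n * 3 ^ n * (K : ℝ≥0∞) ^ (1 / 2 : ℝ) * G * 1) * (a * b * V) := by
        rw [hlam, hℓ, hN]
        push_cast
        ring
    _ ≤ (3 ^ n * 3 ^ n * A * 4 * κ * P + 2 ^ n * 4 * S * 3 ^ n * P +
          3 ^ n * 3 ^ n * (K : ℝ≥0∞) ^ (1 / 2 : ℝ) * G * P) * (a * b * V) := by gcongr
    _ = D * P * (a * b * V) := by rw [hD]; ring

end

/-! ### Level pieces and their normalizations. -/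

section

variable {n : ℕ} {σ : Measure (EuclideanSpace ℝ (Fin n))}

theorem measurable_levelPiece (Q : Cube n) (r : ℝ) {f : EuclideanSpace ℝ (Fin n) → ℂ}
    (hf : Measurable f) (m : ℕ) : Measurable (levelPiece Q r f m) := by
  have he : Measurable fun x => ‖f x‖ₑ := by fun_prop
  cases m with
  | zero =>
    exact hf.indicator (Q.measurableSet_toSet.inter (measurableSet_le he measurable_const))
  | succ m =>
    exact hf.indicator (Q.measurableSet_toSet.inter
      ((measurableSet_lt measurable_const he).inter (measurableSet_le he measurable_const)))

theorem enorm_levelPiece_le_self (Q : Cube n) (r : ℝ) (f : EuclideanSpace ℝ (Fin n) → ℂ) (m : ℕ)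
    (x : EuclideanSpace ℝ (Fin n)) : ‖levelPiece Q r f m x‖ₑ ≤ ‖f x‖ₑ := by
  cases m <;> exact enorm_indicator_le_enorm_self _ _

theorem enorm_levelPiece_le (Q : Cube n) (r : ℝ) (f : EuclideanSpace ℝ (Fin n) → ℂ) (m : ℕ)
    (x : EuclideanSpace ℝ (Fin n)) : ‖levelPiece Q r f m x‖ₑ ≤ 2 ^ m * lpAvg Q r f := by
  cases m with
  | zero =>
    simp only [levelPiece]
    by_cases hx : x ∈ {x | x ∈ Q.toSet ∧ ‖f x‖ₑ ≤ lpAvg Q r f}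
    · rw [Set.indicator_of_mem hx]; simpa using hx.2
    · rw [Set.indicator_of_notMem hx]; simp
  | succ m =>
    simp only [levelPiece]
    by_cases hx : x ∈ {x | x ∈ Q.toSet ∧ 2 ^ m * lpAvg Q r f < ‖f x‖ₑ ∧
      ‖f x‖ₑ ≤ 2 ^ (m + 1) * lpAvg Q r f}
    · rw [Set.indicator_of_mem hx]; exact hx.2.2
    · rw [Set.indicator_of_notMem hx]; simp

theorem levelPiece_eq_zero (Q : Cube n) (r : ℝ) (f : EuclideanSpace ℝ (Fin n) → ℂ) (m : ℕ)
    {x : EuclideanSpace ℝ (Fin n)} (hx : x ∉ Q.toSet) : levelPiece Q r f m x = 0 := by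
  cases m <;> exact Set.indicator_of_notMem (fun h => hx h.1) _

theorem lpAvg_eq_zero_iff (Q : Cube n) {r : ℝ} (hr : 0 < r) {f : EuclideanSpace ℝ (Fin n) → ℂ}
    (hf : Measurable f) : lpAvg Q r f = 0 ↔ ∀ᵐ x ∂(volume.restrict Q.toSet), f x = 0 := by
  have he : Measurable fun x => ‖f x‖ₑ ^ r := by fun_prop
  unfold lpAvg
  rw [ENNReal.rpow_eq_zero_iff_of_pos (by positivity), mul_eq_zero,
    or_iff_right (ENNReal.inv_ne_zero.2 Q.volume_ne_top), lintegral_eq_zero_iff he]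
  refine Filter.eventually_congr (Filter.Eventually.of_forall fun x => ?_)
  simp [hr]

/-- An exceptional set arises only when the average is zero: all thresholds are then zero and
nonzero values belong to no piece, but such values occur on a null set. An infinite average puts
everything in piece `0`. -/
theorem ae_exists_levelPiece_eq (Q : Cube n) {r : ℝ} (hr : 0 < r)
    {f : EuclideanSpace ℝ (Fin n) → ℂ} (hf : Measurable f) :
    ∀ᵐ x ∂(volume.restrict Q.toSet), ∃ m, levelPiece Q r f m x = f x := by
  classical
  have hmem : ∀ᵐ x ∂(volume.restrict Q.toSet), x ∈ Q.toSet :=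
    ae_restrict_mem Q.measurableSet_toSet
  by_cases h0 : lpAvg Q r f = 0
  · filter_upwards [hmem, (lpAvg_eq_zero_iff Q hr hf).1 h0] with x hx hx0
    exact ⟨0, Set.indicator_of_mem (show x ∈ {x | x ∈ Q.toSet ∧ ‖f x‖ₑ ≤ lpAvg Q r f} from
      ⟨hx, by simp [hx0]⟩) _⟩
  · filter_upwards [hmem] with x hx
    have hex : ∃ m : ℕ, ‖f x‖ₑ ≤ 2 ^ m * lpAvg Q r f := by
      obtain ⟨m, hm⟩ := ENNReal.exists_nat_gt
        (r := ‖f x‖ₑ / lpAvg Q r f) (ENNReal.div_ne_top (by simp) h0)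
      refine ⟨m, ?_⟩
      have h1 : ‖f x‖ₑ / lpAvg Q r f ≤ 2 ^ m :=
        hm.le.trans (by exact_mod_cast Nat.lt_two_pow_self.le)
      rcases eq_or_ne (lpAvg Q r f) ∞ with ht | ht
      · rw [ht, ENNReal.mul_top (by positivity)]; exact le_top
      · rwa [ENNReal.div_le_iff h0 ht] at h1
    rcases hm : Nat.find hex with _ | m
    · have h1 := Nat.find_spec hex
      rw [hm] at h1
      refine ⟨0, Set.indicator_of_mem (show x ∈ {x | x ∈ Q.toSet ∧ ‖f x‖ₑ ≤ lpAvg Q r f} from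
        ⟨hx, by simpa using h1⟩) _⟩
    · have h1 := Nat.find_spec hex
      rw [hm] at h1
      have h2 := Nat.find_min hex (m := m) (by omega)
      exact ⟨m + 1, Set.indicator_of_mem (show x ∈ {x | x ∈ Q.toSet ∧
        2 ^ m * lpAvg Q r f < ‖f x‖ₑ ∧ ‖f x‖ₑ ≤ 2 ^ (m + 1) * lpAvg Q r f} from
          ⟨hx, not_le.1 h2, h1⟩) _⟩

/-- Write `a^r = a · a^{r-1}` and bound the second factor by the same power of the whole sum. -/
theorem tsum_rpow_le (a : ℕ → ℝ≥0∞) {r : ℝ} (hr : 1 ≤ r) : ∑' m, a m ^ r ≤ (∑' m, a m) ^ r := by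
  have e : ∀ y : ℝ≥0∞, y ^ r = y * y ^ (r - 1) := by
    intro y
    have h : r = 1 + (r - 1) := by ring
    conv_lhs => rw [h, ENNReal.rpow_add_of_nonneg _ _ zero_le_one (by linarith), ENNReal.rpow_one]
  calc ∑' m, a m ^ r ≤ ∑' m, a m * (∑' m, a m) ^ (r - 1) := by
        refine ENNReal.tsum_le_tsum fun m => ?_
        rw [e]
        gcongr
        exact ENNReal.le_tsum m
    _ = _ := by rw [ENNReal.tsum_mul_right, ← e]

theorem lpAvg_le_tsum (Q : Cube n) {r : ℝ} (hr : 1 ≤ r) {f : EuclideanSpace ℝ (Fin n) → ℂ}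
    (hf : Measurable f) : lpAvg Q r f ≤ ∑' m, lpAvg Q r (levelPiece Q r f m) := by
  have hr0 : 0 < r := by linarith
  have hpm : ∀ m, Measurable fun x => ‖levelPiece Q r f m x‖ₑ ^ r := fun m => by
    have := measurable_levelPiece Q r hf m
    fun_prop
  have h1 : (volume Q.toSet)⁻¹ * ∫⁻ x in Q.toSet, ‖f x‖ₑ ^ r ≤
      ∑' m, lpAvg Q r (levelPiece Q r f m) ^ r := by
    calc (volume Q.toSet)⁻¹ * ∫⁻ x in Q.toSet, ‖f x‖ₑ ^ r
        ≤ (volume Q.toSet)⁻¹ * ∫⁻ x in Q.toSet, ∑' m, ‖levelPiece Q r f m x‖ₑ ^ r := by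
          refine mul_le_mul_right (lintegral_mono_ae ?_) _
          filter_upwards [ae_exists_levelPiece_eq Q hr0 hf] with x ⟨m, hm⟩
          refine le_trans (le_of_eq ?_) (ENNReal.le_tsum m)
          rw [hm]
      _ = _ := by
          rw [lintegral_tsum fun m => (hpm m).aemeasurable, ← ENNReal.tsum_mul_left]
          refine tsum_congr fun m => ?_
          rw [lpAvg, ← ENNReal.rpow_mul, one_div_mul_cancel hr0.ne', ENNReal.rpow_one]
  unfold lpAvg at h1 ⊢
  rw [one_div, ENNReal.rpow_inv_le_iff hr0]
  refine h1.trans ?_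
  simpa using tsum_rpow_le _ hr

theorem tsum_lpAvg_le_plusAvg (Q : Cube n) (r : ℝ) (f : EuclideanSpace ℝ (Fin n) → ℂ) :
    ∑' m, lpAvg Q r (levelPiece Q r f m) ≤ plusAvg Q r f := by
  refine ENNReal.tsum_le_tsum fun m => ?_
  exact le_mul_of_one_le_left zero_le (one_le_pow₀ (by simp))

theorem lpAvg_le_plusAvg (Q : Cube n) {r : ℝ} (hr : 1 ≤ r) {f : EuclideanSpace ℝ (Fin n) → ℂ}
    (hf : Measurable f) : lpAvg Q r f ≤ plusAvg Q r f :=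
  (lpAvg_le_tsum Q hr hf).trans (tsum_lpAvg_le_plusAvg Q r f)

theorem lpAvg_mono (Q : Cube n) {r : ℝ} (hr : 0 < r) {f g : EuclideanSpace ℝ (Fin n) → ℂ}
    (h : ∀ x, ‖f x‖ₑ ≤ ‖g x‖ₑ) : lpAvg Q r f ≤ lpAvg Q r g := by
  unfold lpAvg
  gcongr with x
  exact h x

theorem setLIntegral_enorm_rpow (Q : Cube n) {r : ℝ} (hr : 0 < r)
    (f : EuclideanSpace ℝ (Fin n) → ℂ) :
    ∫⁻ x in Q.toSet, ‖f x‖ₑ ^ r = lpAvg Q r f ^ r * volume Q.toSet := by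
  rw [lpAvg, ← ENNReal.rpow_mul, one_div_mul_cancel hr.ne', ENNReal.rpow_one, mul_comm, ← mul_assoc,
    ENNReal.mul_inv_cancel Q.volume_ne_zero Q.volume_ne_top, one_mul]

/-- The normalization `max (⟨|f_Q^m|⟩_{Q,r}) (2^{-m} ⟨|f|⟩_{Q,r})` of the piece `f_Q^m`. -/
def pieceBound (Q : Cube n) (r : ℝ) (f : EuclideanSpace ℝ (Fin n) → ℂ) (m : ℕ) : ℝ≥0∞ :=
  max (lpAvg Q r (levelPiece Q r f m)) (2⁻¹ ^ m * lpAvg Q r f)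

theorem pieceBound_ne_top {Q : Cube n} {r : ℝ} (hr : 0 < r) {f : EuclideanSpace ℝ (Fin n) → ℂ}
    (hf : lpAvg Q r f ≠ ∞) (m : ℕ) : pieceBound Q r f m ≠ ∞ := by
  refine (max_lt ?_ ?_).ne
  · exact (lpAvg_mono Q hr (enorm_levelPiece_le_self Q r f m)).trans_lt hf.lt_top
  · exact ENNReal.mul_lt_top (ENNReal.pow_lt_top (by simp)) hf.lt_top

/-- This is the purpose of the second entry of the maximum: the average of a piece may be tiny
compared with its values, and the floor `2^{-m} ⟨|f|⟩` limits the ratio of sup to normalization to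
`4^m`. -/
theorem enorm_levelPiece_le_pieceBound (Q : Cube n) (r : ℝ) (f : EuclideanSpace ℝ (Fin n) → ℂ)
    (m : ℕ) (x : EuclideanSpace ℝ (Fin n)) :
    ‖levelPiece Q r f m x‖ₑ ≤ 4 ^ m * pieceBound Q r f m := by
  refine (enorm_levelPiece_le Q r f m x).trans ?_
  calc 2 ^ m * lpAvg Q r f = 4 ^ m * (2⁻¹ ^ m * lpAvg Q r f) := by
        have : (4 : ℝ≥0∞) * 2⁻¹ = 2 := by
          rw [show (4 : ℝ≥0∞) = 2 * 2 by norm_num, mul_assoc,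
            ENNReal.mul_inv_cancel (by norm_num) (by norm_num), mul_one]
        rw [← mul_assoc, ← mul_pow, this]
    _ ≤ _ := by gcongr; exact le_max_right _ _

/-- The floors add only `∑ (m+1)^4 2^{-m}` times the ordinary average, which is itself at most the
restricted-type one. -/
theorem exists_tsum_pieceBound_le : ∃ C : ℝ≥0, ∀ (n : ℕ) (Q : Cube n) (r : ℝ)
    (f : EuclideanSpace ℝ (Fin n) → ℂ), 1 ≤ r → Measurable f →
    ∑' m : ℕ, ((m : ℝ≥0∞) + 1) ^ 4 * pieceBound Q r f m ≤ C * plusAvg Q r f := by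
  set B : ℝ≥0∞ := ∑' m : ℕ, ((m : ℝ≥0∞) + 1) ^ 4 * 2⁻¹ ^ m with hB
  have hBt : B ≠ ∞ := by
    have h1 : Summable fun m : ℕ => ((m : ℝ) + 1) ^ 4 * (1 / 2) ^ m := by
      have h2 := (summable_nat_add_iff 1).2
        (summable_pow_mul_geometric_of_norm_lt_one 4 (r := (1 / 2 : ℝ)) (by norm_num))
      refine (h2.mul_left 2).congr fun m => ?_
      push_cast
      ring
    have h3 : B = ENNReal.ofReal (∑' m : ℕ, ((m : ℝ) + 1) ^ 4 * (1 / 2) ^ m) := by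
      rw [ENNReal.ofReal_tsum_of_nonneg (fun m => by positivity) h1]
      refine tsum_congr fun m => ?_
      rw [ENNReal.ofReal_mul (by positivity), ENNReal.ofReal_pow (by positivity),
        ENNReal.ofReal_pow (by positivity), ENNReal.ofReal_add (by positivity) (by norm_num),
        ENNReal.ofReal_natCast, one_div, ENNReal.ofReal_inv_of_pos (by norm_num)]
      simp
    rw [h3]; exact ENNReal.ofReal_ne_top
  refine ⟨(1 + B).toNNReal, fun n Q r f hr hf => ?_⟩
  rw [ENNReal.coe_toNNReal (ENNReal.add_ne_top.2 ⟨ENNReal.one_ne_top, hBt⟩), add_mul, one_mul]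
  calc ∑' m : ℕ, ((m : ℝ≥0∞) + 1) ^ 4 * pieceBound Q r f m
      ≤ ∑' m : ℕ, (((m : ℝ≥0∞) + 1) ^ 4 * lpAvg Q r (levelPiece Q r f m) +
          ((m : ℝ≥0∞) + 1) ^ 4 * 2⁻¹ ^ m * lpAvg Q r f) := by
        refine ENNReal.tsum_le_tsum fun m => ?_
        rw [mul_assoc, ← mul_add]
        gcongr
        exact max_le_add_of_nonneg zero_le zero_le
    _ = plusAvg Q r f + B * lpAvg Q r f := by
        rw [ENNReal.tsum_add, ENNReal.tsum_mul_right]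
        rfl
    _ ≤ _ := by
        gcongr
        exact lpAvg_le_plusAvg Q hr hf

theorem dilateConv_ae_mono [IsFiniteMeasure σ] (j : ℤ)
    {h h' : EuclideanSpace ℝ (Fin n) → ℝ≥0∞} (hh : ∀ᵐ x ∂volume, h x ≤ h' x) :
    ∀ᵐ x ∂volume, dilateConv σ j h x ≤ dilateConv σ j h' x := by
  have h1 : (fun x => max (h x) (h' x)) =ᵐ[volume] h' := by
    filter_upwards [hh] with x hx using max_eq_right hx
  filter_upwards [dilateConv_ae_congr (σ := σ) j h1] with x hx
  rw [← hx]
  exact dilateConv_mono j (fun y => le_max_left _ _) x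

end

/-! ### The estimate on one cube: regular scales and a single scale. -/

section

variable {n : ℕ} {σ : Measure (EuclideanSpace ℝ (Fin n))}

/-- A cube `R` is exceptional for `f` relative to `Q` if one of the pieces `f_Q^m` has a large
average on `R`. -/
def IsExceptional (Q : Cube n) (p : ℝ) (f : EuclideanSpace ℝ (Fin n) → ℂ) (R : Cube n) : Prop :=
  ∃ m : ℕ, (4 * ((m : ℝ≥0) + 1) ^ 2 : ℝ≥0) * lpAvg Q p (levelPiece Q p f m) ^ p * volume R.toSet <
    ∫⁻ x in R.toSet, ‖levelPiece Q p f m x‖ₑ ^ p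

/-- The union of the dyadic subcubes of sidelength `2^(J-t)` of a dyadic cube of sidelength `2^J`
that are not contained in an exceptional dyadic subcube. -/
def regularSet (c : EuclideanSpace ℝ (Fin n)) (p : ℝ) (f : EuclideanSpace ℝ (Fin n) → ℂ) (J : ℤ)
    (z : Fin n → ℤ) (t : ℕ) : Set (EuclideanSpace ℝ (Fin n)) :=
  {x | x ∈ (dyadicCube c J z).toSet ∧ ∀ k : ℤ, J - t ≤ k → k ≤ J →
    ¬ IsExceptional (dyadicCube c J z) p f (dyadicCube c k (dyadicIndex c k x))}

theorem regularSet_subset (c : EuclideanSpace ℝ (Fin n)) (p : ℝ)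
    (f : EuclideanSpace ℝ (Fin n) → ℂ) (J : ℤ) (z : Fin n → ℤ) (t : ℕ) :
    regularSet c p f J z t ⊆ (dyadicCube c J z).toSet := fun _ hx => hx.1

theorem regularSet_antitone (c : EuclideanSpace ℝ (Fin n)) (p : ℝ)
    (f : EuclideanSpace ℝ (Fin n) → ℂ) (J : ℤ) (z : Fin n → ℤ) :
    Antitone (regularSet c p f J z) := by
  intro t t' htt x hx
  exact ⟨hx.1, fun k h1 h2 => hx.2 k (by omega) h2⟩

theorem isDyadicUnion_regularSet (c : EuclideanSpace ℝ (Fin n)) (p : ℝ)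
    (f : EuclideanSpace ℝ (Fin n) → ℂ) (J : ℤ) (z : Fin n → ℤ) (t : ℕ) :
    IsDyadicUnion c (J - t) (regularSet c p f J z t) := by
  intro x y hxy hx
  refine ⟨isDyadicUnion_dyadicCube c (by omega) z x y hxy hx.1, fun k h1 h2 => ?_⟩
  rw [← dyadicIndex_eq_of_le h1 hxy]
  exact hx.2 k h1 h2

/-- Regularity is exactly the average bound demanded by `exists_localized_bound`, for all pieces of
`f₁` simultaneously. The polynomial loss factors into a weight in `m` times a weight in `l`, so the
double sum is a product. -/
theorem exists_regular_bound [IsFiniteMeasure σ] (hsupp : σ (Metric.closedBall 0 1)ᶜ = 0)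
    {α : ℝ} (hα : 0 < α) (hdecay : HasFourierDecay σ α)
    {p q : ℝ} (hp : 1 < p) (hpq : p < q) (hconv : ConvBounded σ p q) :
    ∃ C : ℝ≥0, ∀ (c : EuclideanSpace ℝ (Fin n)) (J : ℤ) (z : Fin n → ℤ)
      (f₁ f₂ : EuclideanSpace ℝ (Fin n) → ℂ), Measurable f₁ → Measurable f₂ →
      lpAvg (dyadicCube c J z) p f₁ ≠ ∞ →
      lpAvg (dyadicCube c J z).triple (Real.conjExponent q) f₂ ≠ ∞ →
      ∫⁻ x in (dyadicCube c J z).triple.toSet,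
        (⨆ t : ℕ, dilateConv σ (J - t) ((regularSet c p f₁ J z t).indicator fun y => ‖f₁ y‖ₑ) x) *
          ‖f₂ x‖ₑ ≤
        C * (volume (dyadicCube c J z).toSet * plusAvg (dyadicCube c J z) p f₁ *
          plusAvg (dyadicCube c J z).triple (Real.conjExponent q) f₂) := by
  obtain ⟨C, hC⟩ := exists_localized_bound hsupp hα hdecay hp hpq hconv
  obtain ⟨B, hB⟩ := exists_tsum_pieceBound_le
  have hp0 : 0 < p := by linarith
  have hq1 : 1 < q := by linarith
  set q' := Real.conjExponent q with hq'
  have hqq : q.HolderConjugate q' := Real.HolderConjugate.conjExponent hq1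
  have hq'1 : 1 < q' := hqq.symm.lt
  have hq'0 : 0 < q' := hqq.symm.pos
  refine ⟨C * B * B, ?_⟩
  intro c J z f₁ f₂ hf₁ hf₂ hA₁ hA₂
  set Q := dyadicCube c J z with hQ
  set W := regularSet c p f₁ J z with hW
  set V := dyadicVolume n J with hV
  have hVQ : volume Q.toSet = V := volume_dyadicCube c J z
  have hWm : ∀ t, MeasurableSet (W t) := fun t =>
    (isDyadicUnion_regularSet c p f₁ J z t).measurableSet
  set h : ℕ → EuclideanSpace ℝ (Fin n) → ℝ≥0 := fun m x => ‖levelPiece Q p f₁ m x‖₊ with hh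
  set k : ℕ → EuclideanSpace ℝ (Fin n) → ℝ≥0 := fun l x => ‖levelPiece Q.triple q' f₂ l x‖₊ with hk
  have hhm : ∀ m, Measurable (h m) := fun m => (measurable_levelPiece Q p hf₁ m).nnnorm
  have hkm : ∀ l, Measurable (k l) := fun l => (measurable_levelPiece Q.triple q' hf₂ l).nnnorm
  have hhem : ∀ m, Measurable fun x => (h m x : ℝ≥0∞) := fun m => (hhm m).coe_nnreal_ennreal
  have hkem : ∀ l, Measurable fun x => (k l x : ℝ≥0∞) := fun m => (hkm m).coe_nnreal_ennreal
  set a : ℕ → ℝ≥0∞ := pieceBound Q p f₁ with ha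
  set b : ℕ → ℝ≥0∞ := pieceBound Q.triple q' f₂ with hb
  have hat : ∀ m, a m ≠ ∞ := pieceBound_ne_top hp0 hA₁
  have hbt : ∀ l, b l ≠ ∞ := pieceBound_ne_top hq'0 hA₂
  have hWim : ∀ t m, Measurable ((W t).indicator fun y => (h m y : ℝ≥0∞)) := fun t m =>
    (hhem m).indicator (hWm t)
  set T : ℕ → EuclideanSpace ℝ (Fin n) → ℝ≥0∞ := fun m x =>
    ⨆ t : ℕ, dilateConv σ (J - t) ((W t).indicator fun y => (h m y : ℝ≥0∞)) x with hT
  have hTm : ∀ m, Measurable (T m) := fun m =>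
    Measurable.iSup fun t => measurable_dilateConv _ (hWim t m)
  -- each pair of pieces
  have pair : ∀ m l, ∫⁻ x in Q.triple.toSet, T m x * k l x ≤
      C * (((m : ℝ≥0∞) + 1) ^ 4 * ((l : ℝ≥0∞) + 1) ^ 4) * (a m * b l * V) := by
    intro m l
    -- The localized estimate requires the sets to be eventually empty. Truncation after `M` scales
    -- achieves this with a constant independent of `M`, and monotone convergence removes the
    -- truncation.
    set U : ℕ → ℕ → Set (EuclideanSpace ℝ (Fin n)) := fun M t => if t < M then W t else ∅ with hU
    have hUm : ∀ M t, MeasurableSet (U M t) := by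
      intro M t
      simp only [hU]
      split_ifs
      · exact hWm t
      · exact MeasurableSet.empty
    have hUW : ∀ M t, U M t ⊆ W t := by
      intro M t
      simp only [hU]
      split_ifs
      · exact subset_rfl
      · exact Set.empty_subset _
    set TM : ℕ → EuclideanSpace ℝ (Fin n) → ℝ≥0∞ := fun M x =>
      ⨆ t : ℕ, dilateConv σ (J - t) ((U M t).indicator fun y => (h m y : ℝ≥0∞)) x with hTM
    have hTMm : ∀ M, Measurable (TM M) := fun M =>
      Measurable.iSup fun t => measurable_dilateConv _ ((hhem m).indicator (hUm M t))
    have mono : Monotone TM := by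
      intro M M' hMM x
      refine iSup_mono fun t => dilateConv_mono _ (fun y => ?_) x
      refine Set.indicator_le_indicator_of_subset ?_ (fun _ => zero_le) y
      simp only [hU]
      split_ifs with h1 h2
      · exact subset_rfl
      · omega
      · exact Set.empty_subset _
      · exact subset_rfl
    have hsup : ∀ x, T m x * k l x ≤ ⨆ M, TM M x * k l x := by
      intro x
      rw [← ENNReal.iSup_mul]
      gcongr
      refine iSup_le fun t => ?_
      refine le_trans ?_ (le_iSup _ (t + 1))
      refine le_trans (le_of_eq ?_) (le_iSup _ t)
      have : U (t + 1) t = W t := by simp [hU]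
      rw [this]
    refine (lintegral_mono hsup).trans ?_
    have hprod : ∀ M, Measurable fun x => TM M x * (k l x : ℝ≥0∞) := fun M =>
      (hTMm M).mul (hkem l)
    have hmono : Monotone fun M x => TM M x * (k l x : ℝ≥0∞) := fun M M' hMM x =>
      mul_le_mul_left (mono hMM x) _
    rw [lintegral_iSup hprod hmono]
    refine iSup_le fun M => ?_
    have key := hC c J z (U M) M (h m) (k l) (a m).toNNReal (b l).toNNReal m l (hhm m) (hkm l)
      ?_ ?_ ?_ ?_ ?_ ?_ ?_ ?_ ?_
    · rwa [ENNReal.coe_toNNReal (hat m), ENNReal.coe_toNNReal (hbt l)] at key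
    · intro t t' htt
      simp only [hU]
      split_ifs with h1 h2
      · exact regularSet_antitone c p f₁ J z htt
      · omega
      · exact Set.empty_subset _
      · exact subset_rfl
    · intro t
      simp only [hU]
      split_ifs
      · exact isDyadicUnion_regularSet c p f₁ J z t
      · intro x y _ hx
        exact hx
    · exact (hUW M 0).trans (regularSet_subset c p f₁ J z 0)
    · intro t ht
      simp only [hU]
      rw [if_neg (by omega)]
    · intro x
      rw [← ENNReal.coe_le_coe]
      push_cast
      rw [ENNReal.coe_toNNReal (hat m)]
      exact enorm_levelPiece_le_pieceBound Q p f₁ m x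
    · intro x
      rw [← ENNReal.coe_le_coe]
      push_cast
      rw [ENNReal.coe_toNNReal (hbt l)]
      exact enorm_levelPiece_le_pieceBound Q.triple q' f₂ l x
    · rw [ENNReal.coe_toNNReal (hat m)]
      have := setLIntegral_enorm_rpow Q hp0 (levelPiece Q p f₁ m)
      rw [hVQ] at this
      refine (le_of_eq this).trans ?_
      gcongr
      exact le_max_left _ _
    · rw [ENNReal.coe_toNNReal (hbt l)]
      have := setLIntegral_enorm_rpow Q.triple hq'0 (levelPiece Q.triple q' f₂ l)
      rw [Cube.volume_triple, hVQ] at this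
      refine (le_of_eq this).trans ?_
      gcongr
      exact le_max_left _ _
    · intro t x hx
      rw [ENNReal.coe_toNNReal (hat m)]
      have h1 := (hUW M t hx).2 (J - t) le_rfl (by omega)
      simp only [IsExceptional, not_exists, not_lt] at h1
      refine (h1 m).trans ?_
      rw [volume_dyadicCube]
      gcongr
      exact le_max_left _ _
  -- summation over the pieces
  have ae1 : ∀ᵐ x ∂(volume.restrict Q.triple.toSet),
      (⨆ t : ℕ, dilateConv σ (J - t) ((W t).indicator fun y => ‖f₁ y‖ₑ) x) ≤ ∑' m, T m x := by
    have h1 : ∀ᵐ x ∂volume, x ∈ Q.toSet → ∃ m, levelPiece Q p f₁ m x = f₁ x :=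
      (ae_restrict_iff' Q.measurableSet_toSet).1 (ae_exists_levelPiece_eq Q hp0 hf₁)
    have h2 : ∀ t : ℕ, ∀ᵐ x ∂volume, (W t).indicator (fun y => ‖f₁ y‖ₑ) x ≤
        ∑' m, (W t).indicator (fun y => (h m y : ℝ≥0∞)) x := by
      intro t
      filter_upwards [h1] with x hx
      by_cases hxW : x ∈ W t
      · obtain ⟨m, hm⟩ := hx (regularSet_subset c p f₁ J z t hxW)
        refine le_trans (le_of_eq ?_) (ENNReal.le_tsum m)
        rw [Set.indicator_of_mem hxW, Set.indicator_of_mem hxW, ← hm]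
        rfl
      · rw [Set.indicator_of_notMem hxW]; exact zero_le
    have h3 : ∀ᵐ x ∂volume, ∀ t : ℕ,
        dilateConv σ (J - t) ((W t).indicator fun y => ‖f₁ y‖ₑ) x ≤
          dilateConv σ (J - t) (fun x => ∑' m, (W t).indicator (fun y => (h m y : ℝ≥0∞)) x) x :=
      ae_all_iff.2 fun t => dilateConv_ae_mono _ (h2 t)
    refine ae_restrict_of_ae ?_
    filter_upwards [h3] with x hx
    refine iSup_le fun t => (hx t).trans ?_
    rw [dilateConv_tsum _ (fun m => hWim t m)]
    exact ENNReal.tsum_le_tsum fun m => le_iSup (fun t : ℕ =>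
      dilateConv σ (J - t) ((W t).indicator fun y => (h m y : ℝ≥0∞)) x) t
  have ae2 : ∀ᵐ x ∂(volume.restrict Q.triple.toSet), ‖f₂ x‖ₑ ≤ ∑' l, (k l x : ℝ≥0∞) := by
    filter_upwards [ae_exists_levelPiece_eq Q.triple hq'0 hf₂] with x ⟨l, hl⟩
    refine le_trans (le_of_eq ?_) (ENNReal.le_tsum l)
    rw [← hl]; rfl
  calc ∫⁻ x in Q.triple.toSet,
        (⨆ t : ℕ, dilateConv σ (J - t) ((W t).indicator fun y => ‖f₁ y‖ₑ) x) * ‖f₂ x‖ₑ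
      ≤ ∫⁻ x in Q.triple.toSet, ∑' m, ∑' l, T m x * k l x := by
        refine lintegral_mono_ae ?_
        filter_upwards [ae1, ae2] with x h1 h2
        simp only [ENNReal.tsum_mul_left, ENNReal.tsum_mul_right]
        gcongr
    _ = ∑' m, ∑' l, ∫⁻ x in Q.triple.toSet, T m x * k l x := by
        have hm1 : ∀ m l, Measurable fun x => T m x * k l x := fun m l => (hTm m).mul (hkem l)
        rw [lintegral_tsum fun m => (Measurable.tsum (hm1 m)).aemeasurable]
        exact tsum_congr fun m => lintegral_tsum fun l => (hm1 m l).aemeasurable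
    _ ≤ ∑' m : ℕ, ∑' l : ℕ, C * V * (((m : ℝ≥0∞) + 1) ^ 4 * a m) * (((l : ℝ≥0∞) + 1) ^ 4 * b l) := by
        refine ENNReal.tsum_le_tsum fun m => ENNReal.tsum_le_tsum fun l => ?_
        refine (pair m l).trans (le_of_eq ?_)
        ring
    _ = C * V * (∑' m : ℕ, ((m : ℝ≥0∞) + 1) ^ 4 * a m) * ∑' l : ℕ, ((l : ℝ≥0∞) + 1) ^ 4 * b l := by
        simp only [ENNReal.tsum_mul_left, ENNReal.tsum_mul_right]
    _ ≤ C * V * (B * plusAvg Q p f₁) * (B * plusAvg Q.triple q' f₂) := by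
        gcongr
        · exact hB n Q p f₁ hp.le hf₁
        · exact hB n Q.triple q' f₂ hq'1.le hf₂
    _ = _ := by
        rw [hVQ]
        push_cast
        ring

/-- The single scale estimate on a cube of the corresponding size. -/
theorem exists_single_scale_bound [IsFiniteMeasure σ] (hsupp : σ (Metric.closedBall 0 1)ᶜ = 0)
    {p q : ℝ} (hp : 1 < p) (hpq : p < q) (hconv : ConvBounded σ p q) :
    ∃ C : ℝ≥0, ∀ (c : EuclideanSpace ℝ (Fin n)) (J : ℤ) (z : Fin n → ℤ)
      (f₁ f₂ : EuclideanSpace ℝ (Fin n) → ℂ), Measurable f₁ → Measurable f₂ →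
      (∀ x ∉ (dyadicCube c J z).toSet, f₁ x = 0) →
      lpAvg (dyadicCube c J z) p f₁ ≠ ∞ →
      ∫⁻ x, dilateConv σ J (fun y => ‖f₁ y‖ₑ) x * ‖f₂ x‖ₑ ≤
        C * (volume (dyadicCube c J z).toSet * plusAvg (dyadicCube c J z) p f₁ *
          plusAvg (dyadicCube c J z).triple (Real.conjExponent q) f₂) := by
  obtain ⟨A, hA⟩ := exists_lintegral_dilateConv_rpow_le hp hpq hconv
  have hp0 : 0 < p := by linarith
  have hq1 : 1 < q := by linarith
  have hq0 : 0 < q := by linarith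
  set q' := Real.conjExponent q with hq'
  have hqq : q.HolderConjugate q' := Real.HolderConjugate.conjExponent hq1
  have hq'1 : 1 < q' := hqq.symm.lt
  have hq'0 : 0 < q' := hqq.symm.pos
  have hadd : 1 / q + 1 / q' = 1 := by simpa [one_div] using hqq.inv_add_inv_eq_one
  refine ⟨A * 3 ^ n, ?_⟩
  intro c J z f₁ f₂ hf₁ hf₂ hsupp₁ hA₁
  set Q := dyadicCube c J z with hQ
  set V := dyadicVolume n J with hV
  have hV0 : V ≠ 0 := dyadicVolume_ne_zero n J
  have hVt : V ≠ ∞ := dyadicVolume_ne_top n J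
  have h3t : (3 : ℝ≥0∞) ^ n ≠ ∞ := ENNReal.pow_ne_top (by norm_num)
  have h31 : (1 : ℝ≥0∞) ≤ 3 ^ n := one_le_pow₀ (by norm_num)
  have hVQ : volume Q.toSet = V := volume_dyadicCube c J z
  set h : ℕ → EuclideanSpace ℝ (Fin n) → ℝ≥0∞ := fun m x => ‖levelPiece Q p f₁ m x‖ₑ with hh
  have hhm : ∀ m, Measurable (h m) := fun m => (measurable_levelPiece Q p hf₁ m).enorm
  have hf₂m : Measurable fun x => ‖f₂ x‖ₑ := hf₂.enorm
  have hle : ∀ m x, h m x ≤ 2 ^ m * lpAvg Q p f₁ := enorm_levelPiece_le Q p f₁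
  have hplt : ∀ m, lpAvg Q p (levelPiece Q p f₁ m) ≠ ∞ := fun m =>
    ((lpAvg_mono Q hp0 (enorm_levelPiece_le_self Q p f₁ m)).trans_lt hA₁.lt_top).ne
  have hint : ∀ m, ∫⁻ x, h m x ^ p = lpAvg Q p (levelPiece Q p f₁ m) ^ p * V := by
    intro m
    rw [← hVQ, ← setLIntegral_enorm_rpow Q hp0, ← lintegral_indicator Q.measurableSet_toSet]
    refine lintegral_congr fun x => ?_
    by_cases hx : x ∈ Q.toSet
    · rw [Set.indicator_of_mem hx]
    · rw [Set.indicator_of_notMem hx, hh]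
      simp only
      rw [levelPiece_eq_zero Q p f₁ m hx, enorm_zero, ENNReal.zero_rpow_of_pos hp0]
  -- `f₁` is cut into level pieces only because the improving bound is available for bounded
  -- functions. With one scale there is no supremum, so `f₂` need not be decomposed.
  have piece : ∀ m, ∫⁻ x, dilateConv σ J (h m) x * ‖f₂ x‖ₑ ≤
      A * 3 ^ n * V * lpAvg Q p (levelPiece Q p f₁ m) * lpAvg Q.triple q' f₂ := by
    intro m
    set e := lpAvg Q p (levelPiece Q p f₁ m) with he
    have h1 : ∫⁻ x, dilateConv σ J (h m) x ^ q ≤ (A * e : ℝ≥0∞) ^ q * V := by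
      have hHt : 2 ^ m * lpAvg Q p f₁ ≠ ∞ := ENNReal.mul_ne_top (by simp) hA₁
      refine (hA J (h m) (2 ^ m * lpAvg Q p f₁).toNNReal (hhm m) (fun x => ?_) ?_).trans
        (le_of_eq ?_)
      · rw [ENNReal.coe_toNNReal hHt]; exact hle m x
      · rw [hint]
        exact ENNReal.mul_ne_top (ENNReal.rpow_ne_top_of_nonneg hp0.le (hplt m)) hVt
      · rw [hint, ← hV, mul_comm (e ^ p), ← mul_assoc, ENNReal.inv_mul_cancel hV0 hVt, one_mul,
          ← ENNReal.rpow_mul, mul_div_cancel₀ _ hp0.ne', ENNReal.mul_rpow_of_nonneg _ _ hq0.le]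
        ring
    have h2 : ∫⁻ x, dilateConv σ J (h m) x * ‖f₂ x‖ₑ =
        ∫⁻ x in Q.triple.toSet, dilateConv σ J (h m) x * ‖f₂ x‖ₑ := by
      rw [← lintegral_indicator Q.triple.measurableSet_toSet]
      refine lintegral_congr fun x => ?_
      by_cases hx : x ∈ Q.triple.toSet
      · rw [Set.indicator_of_mem hx]
      · rw [Set.indicator_of_notMem hx, dilateConv_eq_zero hsupp le_rfl (c := c) (z := z) ?_ hx,
          zero_mul]
        intro y hy
        simp only [hh]
        rw [levelPiece_eq_zero Q p f₁ m hy, enorm_zero]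
    rw [h2]
    have h3 := ENNReal.lintegral_mul_le_Lp_mul_Lq (volume.restrict Q.triple.toSet) hqq
      (measurable_dilateConv (σ := σ) J (hhm m)).aemeasurable hf₂m.aemeasurable
    refine h3.trans ?_
    rw [setLIntegral_enorm_rpow Q.triple hq'0, Cube.volume_triple, hVQ]
    calc (∫⁻ x in Q.triple.toSet, dilateConv σ J (h m) x ^ q) ^ (1 / q) *
          (lpAvg Q.triple q' f₂ ^ q' * (3 ^ n * V)) ^ (1 / q')
        ≤ ((A * e : ℝ≥0∞) ^ q * (3 ^ n * V)) ^ (1 / q) *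
          (lpAvg Q.triple q' f₂ ^ q' * (3 ^ n * V)) ^ (1 / q') := by
          gcongr
          refine (setLIntegral_le_lintegral _ _).trans (h1.trans ?_)
          gcongr
          exact le_mul_of_one_le_left zero_le h31
      _ = A * e * lpAvg Q.triple q' f₂ * ((3 ^ n * V) ^ (1 / q) * (3 ^ n * V) ^ (1 / q')) := by
          rw [ENNReal.mul_rpow_of_nonneg _ _ (by positivity), ENNReal.mul_rpow_of_nonneg _ (3 ^ n * V)
            (by positivity : 0 ≤ 1 / q'), ← ENNReal.rpow_mul, ← ENNReal.rpow_mul,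
            mul_one_div_cancel hq0.ne', mul_one_div_cancel hq'0.ne', ENNReal.rpow_one,
            ENNReal.rpow_one]
          ring
      _ = _ := by
          rw [← ENNReal.rpow_add _ _ (by positivity) (ENNReal.mul_ne_top h3t hVt), hadd,
            ENNReal.rpow_one]
          ring
  have ae1 : ∀ᵐ x ∂volume, dilateConv σ J (fun y => ‖f₁ y‖ₑ) x ≤ ∑' m, dilateConv σ J (h m) x := by
    have h1 : ∀ᵐ x ∂volume, x ∈ Q.toSet → ∃ m, levelPiece Q p f₁ m x = f₁ x :=
      (ae_restrict_iff' Q.measurableSet_toSet).1 (ae_exists_levelPiece_eq Q hp0 hf₁)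
    have h2 : ∀ᵐ x ∂volume, ‖f₁ x‖ₑ ≤ ∑' m, h m x := by
      filter_upwards [h1] with x hx
      by_cases hxQ : x ∈ Q.toSet
      · obtain ⟨m, hm⟩ := hx hxQ
        refine le_trans (le_of_eq ?_) (ENNReal.le_tsum m)
        rw [← hm]
      · rw [hsupp₁ x hxQ]; simp
    filter_upwards [dilateConv_ae_mono (σ := σ) J h2] with x hx
    rwa [dilateConv_tsum J hhm] at hx
  calc ∫⁻ x, dilateConv σ J (fun y => ‖f₁ y‖ₑ) x * ‖f₂ x‖ₑ
      ≤ ∫⁻ x, ∑' m, dilateConv σ J (h m) x * ‖f₂ x‖ₑ := by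
        refine lintegral_mono_ae ?_
        filter_upwards [ae1] with x hx
        rw [ENNReal.tsum_mul_right]
        gcongr
    _ = ∑' m, ∫⁻ x, dilateConv σ J (h m) x * ‖f₂ x‖ₑ :=
        lintegral_tsum fun m => ((measurable_dilateConv J (hhm m)).mul hf₂m).aemeasurable
    _ ≤ ∑' m, A * 3 ^ n * V * lpAvg Q p (levelPiece Q p f₁ m) * lpAvg Q.triple q' f₂ :=
        ENNReal.tsum_le_tsum piece
    _ = A * 3 ^ n * V * (∑' m, lpAvg Q p (levelPiece Q p f₁ m)) * lpAvg Q.triple q' f₂ := by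
        rw [ENNReal.tsum_mul_right, ENNReal.tsum_mul_left]
    _ ≤ A * 3 ^ n * V * plusAvg Q p f₁ * plusAvg Q.triple q' f₂ := by
        gcongr
        · exact tsum_lpAvg_le_plusAvg Q p f₁
        · exact lpAvg_le_plusAvg Q.triple hq'1.le hf₂
    _ = _ := by
        rw [hVQ]
        push_cast
        ring

end

/-! ### The stopping-time construction. -/

section

variable {n : ℕ} {σ : Measure (EuclideanSpace ℝ (Fin n))}

/-- The dyadic cube with index `d = (k, z)`. -/
def gridCube (c : EuclideanSpace ℝ (Fin n)) (d : ℤ × (Fin n → ℤ)) : Cube n := dyadicCube c d.1 d.2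

theorem mem_gridCube {c : EuclideanSpace ℝ (Fin n)} {d : ℤ × (Fin n → ℤ)}
    {x : EuclideanSpace ℝ (Fin n)} : x ∈ (gridCube c d).toSet ↔ dyadicIndex c d.1 x = d.2 :=
  mem_dyadicCube

theorem gridCube_injective (c : EuclideanSpace ℝ (Fin n)) : Function.Injective (gridCube c) :=
  dyadicCube_injective c

/-- The maximal exceptional dyadic subcubes of a dyadic cube. -/
def stoppingFamily (c : EuclideanSpace ℝ (Fin n)) (p : ℝ) (f : EuclideanSpace ℝ (Fin n) → ℂ)
    (d : ℤ × (Fin n → ℤ)) : Set (ℤ × (Fin n → ℤ)) :=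
  {e | ∃ x ∈ (gridCube c d).toSet, e.1 ≤ d.1 ∧ dyadicIndex c e.1 x = e.2 ∧
    IsExceptional (gridCube c d) p f (gridCube c e) ∧
    ∀ k : ℤ, e.1 < k → k ≤ d.1 →
      ¬ IsExceptional (gridCube c d) p f (dyadicCube c k (dyadicIndex c k x))}

/-- The threshold is at least the average itself. Consequently stopping cubes are strictly smaller,
and the descent makes progress. -/
theorem not_isExceptional_self (Q : Cube n) {p : ℝ} (hp : 0 < p)
    (f : EuclideanSpace ℝ (Fin n) → ℂ) : ¬ IsExceptional Q p f Q := by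
  rintro ⟨m, hm⟩
  refine absurd hm (not_lt.2 ?_)
  rw [setLIntegral_enorm_rpow Q hp, mul_assoc]
  refine le_mul_of_one_le_left zero_le ?_
  have : (1 : ℝ≥0) ≤ 4 * ((m : ℝ≥0) + 1) ^ 2 :=
    one_le_mul (by norm_num) (one_le_pow₀ (by simp))
  exact_mod_cast this

theorem stoppingFamily_lt {c : EuclideanSpace ℝ (Fin n)} {p : ℝ} (hp : 0 < p)
    {f : EuclideanSpace ℝ (Fin n) → ℂ} {d e : ℤ × (Fin n → ℤ)} (he : e ∈ stoppingFamily c p f d) :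
    e.1 < d.1 := by
  obtain ⟨x, hx, h1, h2, h3, -⟩ := he
  refine lt_of_le_of_ne h1 fun h => ?_
  have : e = d := by
    refine Prod.ext h ?_
    rw [← h2, ← mem_gridCube.1 hx, h]
  rw [this] at h3
  exact not_isExceptional_self _ hp f h3

theorem stoppingFamily_subset {c : EuclideanSpace ℝ (Fin n)} {p : ℝ}
    {f : EuclideanSpace ℝ (Fin n) → ℂ} {d e : ℤ × (Fin n → ℤ)} (he : e ∈ stoppingFamily c p f d) :
    (gridCube c e).toSet ⊆ (gridCube c d).toSet := by
  obtain ⟨x, hx, h1, h2, -⟩ := he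
  exact dyadicCube_subset h1 (mem_gridCube.2 h2) hx

/-- If `e'` were larger than `e`, it would be an exceptional ancestor of `e`, contrary to the
maximality of `e`. -/
theorem stoppingFamily_level_le {c : EuclideanSpace ℝ (Fin n)} {p : ℝ}
    {f : EuclideanSpace ℝ (Fin n) → ℂ} {d e e' : ℤ × (Fin n → ℤ)}
    (he : e ∈ stoppingFamily c p f d) (he' : e' ∈ stoppingFamily c p f d)
    {y : EuclideanSpace ℝ (Fin n)} (hy : y ∈ (gridCube c e).toSet)
    (hy' : y ∈ (gridCube c e').toSet) : e'.1 ≤ e.1 := by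
  obtain ⟨x, hx, h1, h2, h3, h4⟩ := he
  obtain ⟨x', hx', h1', h2', h3', h4'⟩ := he'
  by_contra hlt
  push Not at hlt
  refine h4 e'.1 hlt h1' ?_
  have e1 : dyadicIndex c e'.1 x = dyadicIndex c e'.1 y :=
    dyadicIndex_eq_of_le hlt.le (h2.trans (mem_gridCube.1 hy).symm)
  rw [e1, mem_gridCube.1 hy']
  exact h3'

theorem stoppingFamily_eq_of_mem {c : EuclideanSpace ℝ (Fin n)} {p : ℝ}
    {f : EuclideanSpace ℝ (Fin n) → ℂ} {d e e' : ℤ × (Fin n → ℤ)}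
    (he : e ∈ stoppingFamily c p f d) (he' : e' ∈ stoppingFamily c p f d)
    {y : EuclideanSpace ℝ (Fin n)} (hy : y ∈ (gridCube c e).toSet)
    (hy' : y ∈ (gridCube c e').toSet) : e = e' := by
  have h : e.1 = e'.1 :=
    le_antisymm (stoppingFamily_level_le he' he hy' hy) (stoppingFamily_level_le he he' hy hy')
  refine Prod.ext h ?_
  rw [← mem_gridCube.1 hy, ← mem_gridCube.1 hy', h]

/-- Among the exceptional levels above `x` the greatest exists, since levels are bounded by that of
`d`; its cube is maximal. -/
theorem exists_mem_stoppingFamily {c : EuclideanSpace ℝ (Fin n)} {p : ℝ}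
    {f : EuclideanSpace ℝ (Fin n) → ℂ} {d : ℤ × (Fin n → ℤ)} {t : ℕ}
    {x : EuclideanSpace ℝ (Fin n)} (hx : x ∈ (gridCube c d).toSet)
    (hxt : x ∉ regularSet c p f d.1 d.2 t) :
    ∃ e ∈ stoppingFamily c p f d, x ∈ (gridCube c e).toSet ∧ d.1 - t ≤ e.1 := by
  have hex : ∃ k : ℤ, d.1 - t ≤ k ∧ k ≤ d.1 ∧
      IsExceptional (gridCube c d) p f (dyadicCube c k (dyadicIndex c k x)) := by
    by_contra hcon
    push Not at hcon
    exact hxt ⟨hx, hcon⟩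
  obtain ⟨k, ⟨h1, h2, h3⟩, hmax⟩ := Int.exists_greatest_of_bdd ⟨d.1, fun k hk => hk.2.1⟩ hex
  refine ⟨(k, dyadicIndex c k x), ⟨x, hx, h2, rfl, h3, fun k' hk' hk'd hE => ?_⟩,
    mem_gridCube.2 rfl, h1⟩
  have h4 : k < k' := hk'
  have := hmax k' ⟨by omega, hk'd, hE⟩
  omega

/-- The sum is `π²/24` by the Basel identity. The factor `4` in the exceptional threshold is what
brings it below one half. -/
theorem tsum_inv_sq_le : ∑' m : ℕ, ((4 * ((m : ℝ≥0) + 1) ^ 2 : ℝ≥0) : ℝ≥0∞)⁻¹ ≤ 1 / 2 := by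
  have h0 := (hasSum_nat_add_iff' 1).2 hasSum_zeta_two
  have h1 : HasSum (fun m : ℕ => (1 / 4 : ℝ) * (1 / ((m : ℝ) + 1) ^ 2)) (1 / 4 * (Real.pi ^ 2 / 6)) := by
    refine HasSum.mul_left _ ?_
    simpa using h0
  have h2 : ∑' m : ℕ, ((4 * ((m : ℝ≥0) + 1) ^ 2 : ℝ≥0) : ℝ≥0∞)⁻¹
      = ENNReal.ofReal (1 / 4 * (Real.pi ^ 2 / 6)) := by
    rw [← h1.tsum_eq, ENNReal.ofReal_tsum_of_nonneg (fun m => by positivity) h1.summable]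
    refine tsum_congr fun m => ?_
    have e : (1 / 4 : ℝ) * (1 / ((m : ℝ) + 1) ^ 2) = ((4 * ((m : ℝ≥0) + 1) ^ 2 : ℝ≥0) : ℝ)⁻¹ := by
      push_cast
      field_simp
    rw [e, ENNReal.ofReal_inv_of_pos, ENNReal.ofReal_coe_nnreal]
    exact_mod_cast (by positivity : (0 : ℝ≥0) < 4 * ((m : ℝ≥0) + 1) ^ 2)
  rw [h2]
  have h3 : (1 / 2 : ℝ≥0∞) = ENNReal.ofReal (1 / 2) := by
    rw [one_div, one_div, ENNReal.ofReal_inv_of_pos (by norm_num)]; simp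
  rw [h3]
  refine ENNReal.ofReal_le_ofReal ?_
  have := Real.pi_lt_d2
  have := Real.pi_pos
  nlinarith

/-- Chebyshev's inequality for a piece witnessing exceptionality, enlarged to the sum over all
pieces to avoid choosing one. Disjointness of the stopping cubes sums each piece to its integral
over `Q`, leaving the series of inverse thresholds. -/
theorem volume_stoppingFamily_le (c : EuclideanSpace ℝ (Fin n)) {p : ℝ} (hp : 0 < p)
    {f : EuclideanSpace ℝ (Fin n) → ℂ} (d : ℤ × (Fin n → ℤ)) :
    volume (⋃ e ∈ stoppingFamily c p f d, (gridCube c e).toSet) ≤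
      volume (gridCube c d).toSet / 2 := by
  set Q := gridCube c d with hQ
  set S := stoppingFamily c p f d with hS
  set h : ℕ → EuclideanSpace ℝ (Fin n) → ℝ≥0∞ := fun m x => ‖levelPiece Q p f m x‖ₑ ^ p with hh
  set B : ℕ → ℝ≥0∞ := fun m => lpAvg Q p (levelPiece Q p f m) ^ p with hB
  set ℓ : ℕ → ℝ≥0 := fun m => 4 * ((m : ℝ≥0) + 1) ^ 2 with hℓ
  have hℓ0 : ∀ m, (ℓ m : ℝ≥0∞) ≠ 0 := fun m => by
    have : (0 : ℝ≥0) < ℓ m := by simp only [hℓ]; positivity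
    exact_mod_cast this.ne'
  have one : ∀ e ∈ S, volume (gridCube c e).toSet ≤
      ∑' m, (ℓ m * B m)⁻¹ * ∫⁻ x in (gridCube c e).toSet, h m x := by
    rintro e ⟨x, -, -, -, ⟨m, hm⟩, -⟩
    refine le_trans ?_ (ENNReal.le_tsum m)
    -- The strict inequality in exceptionality excludes both a vanishing integral over the cube and
    -- an infinite threshold, so the division is legitimate.
    rw [mul_comm, ← div_eq_mul_inv, ENNReal.le_div_iff_mul_le]
    · rw [mul_comm]; exact hm.le
    · exact Or.inr (pos_of_gt hm).ne'
    · refine Or.inl fun htop => ?_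
      have h1 : (ℓ m * B m) * volume (gridCube c e).toSet = ∞ := by
        rw [htop, ENNReal.top_mul (Cube.volume_ne_zero _)]
      exact absurd hm (by rw [h1]; exact not_top_lt)
  have disj : ∀ m, ∑' e : S, ∫⁻ x in (gridCube c e.1).toSet, h m x ≤ ∫⁻ x in Q.toSet, h m x := by
    intro m
    rw [← lintegral_iUnion (fun e : S => Cube.measurableSet_toSet (gridCube c e.1))]
    · exact lintegral_mono_set (Set.iUnion_subset fun e => stoppingFamily_subset e.2)
    · intro e e' hne
      refine Set.disjoint_left.2 fun y hy hy' => hne (Subtype.ext ?_)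
      exact stoppingFamily_eq_of_mem e.2 e'.2 hy hy'
  calc volume (⋃ e ∈ S, (gridCube c e).toSet)
      ≤ ∑' e : S, volume (gridCube c e.1).toSet :=
        measure_biUnion_le volume (Set.to_countable S) _
    _ ≤ ∑' e : S, ∑' m, (ℓ m * B m)⁻¹ * ∫⁻ x in (gridCube c e.1).toSet, h m x :=
        ENNReal.tsum_le_tsum fun e => one e.1 e.2
    _ = ∑' m, (ℓ m * B m)⁻¹ * ∑' e : S, ∫⁻ x in (gridCube c e.1).toSet, h m x := by
        rw [ENNReal.tsum_comm]
        exact tsum_congr fun m => ENNReal.tsum_mul_left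
    _ ≤ ∑' m, (ℓ m : ℝ≥0∞)⁻¹ * volume Q.toSet := by
        refine ENNReal.tsum_le_tsum fun m => ?_
        calc (ℓ m * B m)⁻¹ * ∑' e : S, ∫⁻ x in (gridCube c e.1).toSet, h m x
            ≤ (ℓ m * B m)⁻¹ * (B m * volume Q.toSet) := by
              gcongr
              refine (disj m).trans (le_of_eq ?_)
              exact setLIntegral_enorm_rpow Q hp _
          _ = (ℓ m : ℝ≥0∞)⁻¹ * ((B m)⁻¹ * B m) * volume Q.toSet := by
              rw [ENNReal.mul_inv (Or.inl (hℓ0 m)) (Or.inl ENNReal.coe_ne_top)]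
              ring
          _ ≤ (ℓ m : ℝ≥0∞)⁻¹ * 1 * volume Q.toSet := by
              gcongr
              exact ENNReal.inv_mul_le_one _
          _ = _ := by rw [mul_one]
    _ = (∑' m, (ℓ m : ℝ≥0∞)⁻¹) * volume Q.toSet := ENNReal.tsum_mul_right
    _ ≤ 1 / 2 * volume Q.toSet := by
        gcongr
        exact tsum_inv_sq_le
    _ = _ := by rw [one_div, mul_comm, ← div_eq_mul_inv]

/-- The generations of the stopping time construction that starts at the dyadic cube `d`. -/
def stoppingGeneration (c : EuclideanSpace ℝ (Fin n)) (p : ℝ)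
    (f : EuclideanSpace ℝ (Fin n) → ℂ) (d : ℤ × (Fin n → ℤ)) : ℕ → Set (ℤ × (Fin n → ℤ))
  | 0 => {d}
  | i + 1 => {e | ∃ r ∈ stoppingGeneration c p f d i, e ∈ stoppingFamily c p f r}

theorem stoppingGeneration_eq_of_mem {c : EuclideanSpace ℝ (Fin n)} {p : ℝ}
    {f : EuclideanSpace ℝ (Fin n) → ℂ} {d : ℤ × (Fin n → ℤ)} (i : ℕ) {e e' : ℤ × (Fin n → ℤ)}
    (he : e ∈ stoppingGeneration c p f d i) (he' : e' ∈ stoppingGeneration c p f d i)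
    {y : EuclideanSpace ℝ (Fin n)} (hy : y ∈ (gridCube c e).toSet)
    (hy' : y ∈ (gridCube c e').toSet) : e = e' := by
  induction i generalizing e e' with
  | zero => rw [Set.mem_singleton_iff.1 he, Set.mem_singleton_iff.1 he']
  | succ i ih =>
    obtain ⟨r, hr, her⟩ := he
    obtain ⟨r', hr', her'⟩ := he'
    have : r = r' := ih hr hr' (stoppingFamily_subset her hy) (stoppingFamily_subset her' hy')
    subst this
    exact stoppingFamily_eq_of_mem her her' hy hy'

theorem exists_mem_stoppingGeneration_of_le {c : EuclideanSpace ℝ (Fin n)} {p : ℝ}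
    {f : EuclideanSpace ℝ (Fin n) → ℂ} {d : ℤ × (Fin n → ℤ)} {i j : ℕ} (hij : i ≤ j)
    {e : ℤ × (Fin n → ℤ)} (he : e ∈ stoppingGeneration c p f d j)
    {y : EuclideanSpace ℝ (Fin n)} (hy : y ∈ (gridCube c e).toSet) :
    ∃ r ∈ stoppingGeneration c p f d i, y ∈ (gridCube c r).toSet := by
  induction j, hij using Nat.le_induction generalizing e with
  | base => exact ⟨e, he, hy⟩
  | succ j _ ih =>
    obtain ⟨r, hr, her⟩ := he
    exact ih hr (stoppingFamily_subset her hy)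

/-- The part of a dyadic cube outside its stopping cubes. -/
def stoppingComplement (c : EuclideanSpace ℝ (Fin n)) (p : ℝ)
    (f : EuclideanSpace ℝ (Fin n) → ℂ) (d : ℤ × (Fin n → ℤ)) : Set (EuclideanSpace ℝ (Fin n)) :=
  (gridCube c d).toSet \ ⋃ e ∈ stoppingFamily c p f d, (gridCube c e).toSet

/-- A point of a later cube lies in some cube of generation `i + 1`, whose parent must be `d`; that
cube was removed from `d`. -/
theorem stoppingComplement_disjoint_of_lt {c : EuclideanSpace ℝ (Fin n)} {p : ℝ}
    {f : EuclideanSpace ℝ (Fin n) → ℂ} {d₀ d e : ℤ × (Fin n → ℤ)} {i j : ℕ} (hij : i < j)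
    (hd : d ∈ stoppingGeneration c p f d₀ i) (he : e ∈ stoppingGeneration c p f d₀ j) :
    Disjoint (stoppingComplement c p f d) (gridCube c e).toSet := by
  refine Set.disjoint_left.2 fun y hy hye => hy.2 ?_
  obtain ⟨r, ⟨s, hs, hrs⟩, hyr⟩ :=
    exists_mem_stoppingGeneration_of_le (show i + 1 ≤ j by omega) he hye
  have : s = d := stoppingGeneration_eq_of_mem i hs hd (stoppingFamily_subset hrs hyr) hy.1
  subst this
  exact Set.mem_biUnion hrs hyr

theorem stoppingComplement_disjoint {c : EuclideanSpace ℝ (Fin n)} {p : ℝ}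
    {f : EuclideanSpace ℝ (Fin n) → ℂ} {d₀ d e : ℤ × (Fin n → ℤ)} {i j : ℕ}
    (hd : d ∈ stoppingGeneration c p f d₀ i) (he : e ∈ stoppingGeneration c p f d₀ j)
    (hne : d ≠ e) : Disjoint (stoppingComplement c p f d) (stoppingComplement c p f e) := by
  rcases lt_trichotomy i j with h | h | h
  · exact (stoppingComplement_disjoint_of_lt h hd he).mono_right Set.sdiff_subset
  · subst h
    exact Set.disjoint_left.2 fun y hy hy' =>
      hne (stoppingGeneration_eq_of_mem i hd he hy.1 hy'.1)
  · exact ((stoppingComplement_disjoint_of_lt h he hd).mono_right Set.sdiff_subset).symm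

theorem measurableSet_stoppingComplement (c : EuclideanSpace ℝ (Fin n)) (p : ℝ)
    (f : EuclideanSpace ℝ (Fin n) → ℂ) (d : ℤ × (Fin n → ℤ)) :
    MeasurableSet (stoppingComplement c p f d) :=
  (Cube.measurableSet_toSet _).diff (MeasurableSet.biUnion (Set.to_countable _)
    fun _ _ => Cube.measurableSet_toSet _)

theorem half_volume_le_of_subset {Q : Cube n} {S : Set (EuclideanSpace ℝ (Fin n))}
    (hS : volume S ≤ volume Q.toSet / 2) : volume Q.toSet / 2 ≤ volume (Q.toSet \ S) := by
  have h1 : volume Q.toSet - volume S ≤ volume (Q.toSet \ S) := le_measure_sdiff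
  refine le_trans ?_ h1
  refine le_trans ?_ (tsub_le_tsub_left hS _)
  rw [ENNReal.sub_half Q.volume_ne_top]

theorem stoppingGeneration_subset {c : EuclideanSpace ℝ (Fin n)} {p : ℝ}
    {f : EuclideanSpace ℝ (Fin n) → ℂ} {d e : ℤ × (Fin n → ℤ)} {i : ℕ}
    (he : e ∈ stoppingGeneration c p f d i) : (gridCube c e).toSet ⊆ (gridCube c d).toSet := by
  intro y hy
  obtain ⟨r, hr, hyr⟩ := exists_mem_stoppingGeneration_of_le (Nat.zero_le i) he hy
  rwa [Set.mem_singleton_iff.1 hr] at hyr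

theorem stoppingGeneration_level_le {c : EuclideanSpace ℝ (Fin n)} {p : ℝ} (hp : 0 < p)
    {f : EuclideanSpace ℝ (Fin n) → ℂ} {d e : ℤ × (Fin n → ℤ)} {i : ℕ}
    (he : e ∈ stoppingGeneration c p f d i) : e.1 ≤ d.1 := by
  induction i generalizing e with
  | zero => rw [Set.mem_singleton_iff.1 he]
  | succ i ih =>
    obtain ⟨r, hr, her⟩ := he
    exact (stoppingFamily_lt hp her).le.trans (ih hr)

/-- Every dyadic subcube is regular with respect to one of the stopping cubes. -/
theorem exists_mem_regularSet {c : EuclideanSpace ℝ (Fin n)} {p : ℝ} (hp : 0 < p)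
    {f : EuclideanSpace ℝ (Fin n) → ℂ} {d : ℤ × (Fin n → ℤ)} {j : ℤ} (hj : j ≤ d.1)
    {x : EuclideanSpace ℝ (Fin n)} (hx : x ∈ (gridCube c d).toSet) :
    ∃ e ∈ ⋃ i, stoppingGeneration c p f d i, j ≤ e.1 ∧
      x ∈ regularSet c p f e.1 e.2 (e.1 - j).toNat := by
  have hex : ∃ k : ℤ, j ≤ k ∧ ∃ e ∈ ⋃ i, stoppingGeneration c p f d i, e.1 = k ∧
      x ∈ (gridCube c e).toSet :=
    ⟨d.1, hj, d, Set.mem_iUnion.2 ⟨0, rfl⟩, rfl, hx⟩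
  -- Take the smallest stopping cube of level at least `j` containing `x`. If `x` were irregular for
  -- it down to level `j`, one of its own stopping cubes would contain `x` at a lower admissible
  -- level.
  obtain ⟨k, ⟨hjk, e, he, rfl, hxe⟩, hmin⟩ := Int.exists_least_of_bdd ⟨j, fun k hk => hk.1⟩ hex
  refine ⟨e, he, hjk, ?_⟩
  by_contra hcon
  obtain ⟨r, hr, hxr, hlev⟩ := exists_mem_stoppingFamily hxe hcon
  obtain ⟨i, hi⟩ := Set.mem_iUnion.1 he
  have h1 := hmin r.1 ⟨by omega, r, Set.mem_iUnion.2 ⟨i + 1, e, hi, hr⟩, rfl, hxr⟩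
  have h2 := stoppingFamily_lt hp hr
  omega

end

/-! ### The sparse family and the global bound. -/

section

variable {n : ℕ} {σ : Measure (EuclideanSpace ℝ (Fin n))}

theorem gridCube_zero_subset (c : EuclideanSpace ℝ (Fin n)) {k j : ℤ} (hkj : k ≤ j) :
    (gridCube c (k, 0)).toSet ⊆ (gridCube c (j, 0)).toSet := by
  have h : ∀ i : ℤ, c ∈ (dyadicCube c i 0).toSet := fun i => by
    rw [mem_dyadicCube]; ext l; simp [dyadicIndex]
  exact dyadicCube_subset hkj (h k) (h j)

/-- The indices of the stopping cubes inside `(k, 0)` together with all the larger cubes with the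
same corner. -/
def sparseIndices (c : EuclideanSpace ℝ (Fin n)) (p : ℝ) (f : EuclideanSpace ℝ (Fin n) → ℂ)
    (k : ℤ) : Set (ℤ × (Fin n → ℤ)) :=
  (⋃ i, stoppingGeneration c p f (k, 0) i) ∪ Set.range fun i : ℕ => (k + i + 1, 0)

theorem isSparse_of_index {c : EuclideanSpace ℝ (Fin n)} {D : Set (ℤ × (Fin n → ℤ))}
    (F : ℤ × (Fin n → ℤ) → Set (EuclideanSpace ℝ (Fin n)))
    (h1 : ∀ d ∈ D, MeasurableSet (F d) ∧ F d ⊆ (gridCube c d).toSet ∧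
      volume (gridCube c d).toSet / 2 ≤ volume (F d))
    (h2 : ∀ d ∈ D, ∀ e ∈ D, d ≠ e → Disjoint (F d) (F e)) : IsSparse (gridCube c '' D) := by
  have hinj := gridCube_injective (n := n) c
  refine ⟨Function.extend (gridCube c) F fun _ => ∅, ?_, ?_⟩
  · rintro _ ⟨d, hd, rfl⟩
    rw [hinj.extend_apply]
    exact h1 d hd
  · rintro _ ⟨d, hd, rfl⟩ _ ⟨e, he, rfl⟩ hne
    simp only [Function.onFun]
    rw [hinj.extend_apply, hinj.extend_apply]
    exact h2 d hd e he fun h => hne (by rw [h])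

theorem isSparse_sparseIndices (hn : 0 < n) (c : EuclideanSpace ℝ (Fin n)) {p : ℝ} (hp : 0 < p)
    (f : EuclideanSpace ℝ (Fin n) → ℂ) (k : ℤ) :
    IsSparse (gridCube c '' sparseIndices c p f k) := by
  -- A stopping cube keeps what its stopping children leave; a larger cube keeps what the preceding
  -- cube of the chain leaves.
  set F : ℤ × (Fin n → ℤ) → Set (EuclideanSpace ℝ (Fin n)) := fun d =>
    if d.1 ≤ k then stoppingComplement c p f d
    else (gridCube c d).toSet \ (gridCube c (d.1 - 1, 0)).toSet with hF
  have hF1 : ∀ (i : ℕ), ∀ d ∈ stoppingGeneration c p f (k, 0) i, F d = stoppingComplement c p f d :=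
    fun i d hd => if_pos (stoppingGeneration_level_le hp hd)
  have hF2 : ∀ i : ℕ, F (k + i + 1, 0) =
      (gridCube c (k + i + 1, 0)).toSet \ (gridCube c (k + i, 0)).toSet := by
    intro i
    simp only [hF]
    rw [if_neg (by omega)]
    congr 4
    ring
  have mixed : ∀ (i j : ℕ), ∀ d ∈ stoppingGeneration c p f (k, 0) i,
      Disjoint (F d) (F (k + j + 1, 0)) := by
    intro i j d hd
    rw [hF1 i d hd, hF2 j]
    refine Set.disjoint_left.2 fun y hy hy' => hy'.2 ?_
    exact gridCube_zero_subset c (by omega) (stoppingGeneration_subset hd hy.1)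
  have top : ∀ i j : ℕ, i < j → Disjoint (F (k + i + 1, 0)) (F (k + j + 1, 0)) := by
    intro i j hij
    rw [hF2 i, hF2 j]
    refine Set.disjoint_left.2 fun y hy hy' => hy'.2 ?_
    exact gridCube_zero_subset c (by omega) hy.1
  refine isSparse_of_index F ?_ ?_
  · rintro d (hd | ⟨i, rfl⟩)
    · obtain ⟨i, hi⟩ := Set.mem_iUnion.1 hd
      rw [hF1 i d hi]
      exact ⟨measurableSet_stoppingComplement c p f d, Set.sdiff_subset,
        half_volume_le_of_subset (volume_stoppingFamily_le c hp d)⟩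
    · simp only
      rw [hF2]
      refine ⟨(Cube.measurableSet_toSet _).diff (Cube.measurableSet_toSet _), Set.sdiff_subset,
        half_volume_le_of_subset ?_⟩
      simp only [gridCube]
      rw [volume_dyadicCube, volume_dyadicCube, dyadicVolume_succ, ENNReal.le_div_iff_mul_le
        (Or.inl (by norm_num)) (Or.inl (by norm_num)), mul_comm]
      gcongr
      -- Doubling the side at least doubles the volume because `n ≥ 1`; so each cube of the chain
      -- occupies at most half of the next.
      calc (2 : ℝ≥0∞) = 2 ^ 1 := (pow_one _).symm
        _ ≤ 2 ^ n := pow_le_pow_right₀ (by norm_num) hn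
  · rintro d (hd | ⟨i, rfl⟩) e (he | ⟨j, rfl⟩) hne
    · obtain ⟨i, hi⟩ := Set.mem_iUnion.1 hd
      obtain ⟨j, hj⟩ := Set.mem_iUnion.1 he
      rw [hF1 i d hi, hF1 j e hj]
      exact stoppingComplement_disjoint hi hj hne
    · obtain ⟨i, hi⟩ := Set.mem_iUnion.1 hd
      exact mixed i j d hi
    · obtain ⟨j, hj⟩ := Set.mem_iUnion.1 he
      exact (mixed j i e hj).symm
    · rcases lt_trichotomy i j with h | h | h
      · exact top i j h
      · subst h; exact absurd rfl hne
      · exact (top j i h).symm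

/-- The maximal function is controlled by the regular parts of the stopping cubes and the averages
at large scales. -/
theorem iSup_dilateConv_le (hsupp : σ (Metric.closedBall 0 1)ᶜ = 0) {p : ℝ} (hp : 0 < p)
    (c : EuclideanSpace ℝ (Fin n)) (k : ℤ) {f : EuclideanSpace ℝ (Fin n) → ℂ} (hf : Measurable f)
    (hf0 : ∀ x ∉ (gridCube c (k, 0)).toSet, f x = 0) (x : EuclideanSpace ℝ (Fin n)) :
    ⨆ j : ℤ, dilateConv σ j (fun y => ‖f y‖ₑ) x ≤
      ∑' d : (⋃ i, stoppingGeneration c p f (k, 0) i : Set (ℤ × (Fin n → ℤ))),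
        (gridCube c d.1).triple.toSet.indicator (fun x => ⨆ t : ℕ, dilateConv σ (d.1.1 - t)
          ((regularSet c p f d.1.1 d.1.2 t).indicator fun y => ‖f y‖ₑ) x) x +
      ∑' i : ℕ, dilateConv σ (k + i + 1) (fun y => ‖f y‖ₑ) x := by
  refine iSup_le fun j => ?_
  rcases le_or_gt j k with hj | hj
  · refine le_trans ?_ le_self_add
    set D : Set (ℤ × (Fin n → ℤ)) := ⋃ i, stoppingGeneration c p f (k, 0) i with hD
    have hfe : Measurable fun y => ‖f y‖ₑ := hf.enorm
    -- At the fixed scale `2^j` each stopping cube of level at least `j` receives its regular part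
    -- down to that scale. These parts cover the support of `f`.
    set g : D → EuclideanSpace ℝ (Fin n) → ℝ≥0∞ := fun d =>
      if j ≤ d.1.1 then
        (regularSet c p f d.1.1 d.1.2 (d.1.1 - j).toNat).indicator fun y => ‖f y‖ₑ
      else 0 with hg
    have hgm : ∀ d, Measurable (g d) := by
      intro d
      simp only [hg]
      split_ifs
      · exact hfe.indicator (isDyadicUnion_regularSet c p f _ _ _).measurableSet
      · exact measurable_const
    have hle : ∀ y, ‖f y‖ₑ ≤ ∑' d, g d y := by
      intro y
      by_cases hy : y ∈ (gridCube c (k, 0)).toSet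
      · obtain ⟨e, he, hje, hye⟩ := exists_mem_regularSet (f := f) hp (d := (k, 0)) hj hy
        refine le_trans (le_of_eq ?_) (ENNReal.le_tsum (⟨e, he⟩ : D))
        simp only [hg]
        rw [if_pos hje, Set.indicator_of_mem hye]
      · rw [hf0 y hy]; simp
    refine (dilateConv_mono j hle x).trans ?_
    rw [dilateConv_tsum j hgm]
    refine ENNReal.tsum_le_tsum fun d => ?_
    by_cases hjd : j ≤ d.1.1
    · have hgd : g d = (regularSet c p f d.1.1 d.1.2 (d.1.1 - j).toNat).indicator fun y => ‖f y‖ₑ := by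
        simp only [hg]; rw [if_pos hjd]
      by_cases hx : x ∈ (gridCube c d.1).triple.toSet
      · rw [Set.indicator_of_mem hx, hgd]
        refine le_trans (le_of_eq ?_) (le_iSup _ (d.1.1 - j).toNat)
        congr 1
        omega
      -- The averaging scale does not exceed the side of the cube, so nothing reaches beyond its
      -- triple.
      · rw [dilateConv_eq_zero hsupp hjd (c := c) (z := d.1.2) ?_ hx]
        · exact zero_le
        · intro y hy
          rw [hgd]
          exact Set.indicator_of_notMem (fun h => hy (regularSet_subset c p f _ _ _ h)) _
    · have hgd : g d = 0 := by
        simp only [hg]; rw [if_neg hjd]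
      rw [hgd]
      simp [dilateConv]
  · refine le_trans ?_ le_add_self
    refine le_trans (le_of_eq ?_) (ENNReal.le_tsum (j - k - 1).toNat)
    congr 1
    omega

theorem lpAvg_ne_top_of_le {Q R : Cube n} {r : ℝ} (hr : 0 < r)
    {f : EuclideanSpace ℝ (Fin n) → ℂ} (hf : ∀ x ∉ Q.toSet, f x = 0) (hQ : lpAvg Q r f ≠ ∞) :
    lpAvg R r f ≠ ∞ := by
  have h1 : ∫⁻ x in R.toSet, ‖f x‖ₑ ^ r ≤ ∫⁻ x in Q.toSet, ‖f x‖ₑ ^ r := by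
    rw [← lintegral_indicator Q.measurableSet_toSet]
    refine (setLIntegral_le_lintegral _ _).trans (lintegral_mono fun x => ?_)
    by_cases hx : x ∈ Q.toSet
    · rw [Set.indicator_of_mem hx]
    · rw [hf x hx, enorm_zero, ENNReal.zero_rpow_of_pos hr]; exact zero_le
  have h2 : ∫⁻ x in Q.toSet, ‖f x‖ₑ ^ r ≠ ∞ := by
    rw [setLIntegral_enorm_rpow Q hr]
    exact ENNReal.mul_ne_top (ENNReal.rpow_ne_top_of_nonneg hr.le hQ) Q.volume_ne_top
  unfold lpAvg
  exact ENNReal.rpow_ne_top_of_nonneg (by positivity)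
    (ENNReal.mul_ne_top (ENNReal.inv_ne_top.2 R.volume_ne_zero) (ne_top_of_le_ne_top h2 h1))

theorem lpAvg_congr_ae (Q : Cube n) (r : ℝ) {f g : EuclideanSpace ℝ (Fin n) → ℂ}
    (h : f =ᵐ[volume] g) : lpAvg Q r f = lpAvg Q r g := by
  unfold lpAvg
  congr 2
  refine lintegral_congr_ae (ae_restrict_of_ae ?_)
  filter_upwards [h] with x hx
  rw [hx]

theorem plusAvg_congr_ae (Q : Cube n) (r : ℝ) {f g : EuclideanSpace ℝ (Fin n) → ℂ}
    (h : f =ᵐ[volume] g) : plusAvg Q r f = plusAvg Q r g := by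
  unfold plusAvg
  refine tsum_congr fun m => ?_
  congr 1
  refine lpAvg_congr_ae Q r ?_
  filter_upwards [h] with x hx
  have hl := lpAvg_congr_ae Q r h
  have key : ∀ S T : Set (EuclideanSpace ℝ (Fin n)), (x ∈ S ↔ x ∈ T) →
      S.indicator f x = T.indicator g x := by
    intro S T hST
    by_cases hS : x ∈ S
    · rw [Set.indicator_of_mem hS, Set.indicator_of_mem (hST.1 hS), hx]
    · rw [Set.indicator_of_notMem hS, Set.indicator_of_notMem fun h => hS (hST.2 h)]
  cases m <;> exact key _ _ (by simp only [Set.mem_ofPred_eq, hx, hl])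

theorem maximalAvg_congr_ae [IsFiniteMeasure σ] {f g : EuclideanSpace ℝ (Fin n) → ℂ}
    (h : f =ᵐ[volume] g) : maximalAvg σ f =ᵐ[volume] maximalAvg σ g := by
  have h1 : (fun x => ‖f x‖ₑ) =ᵐ[volume] fun x => ‖g x‖ₑ := by
    filter_upwards [h] with x hx
    rw [hx]
  filter_upwards [ae_all_iff.2 fun j : ℤ => dilateConv_ae_congr (σ := σ) j h1] with x hx
  exact iSup_congr hx

theorem isSparse_empty : IsSparse (∅ : Set (Cube n)) :=
  ⟨fun _ => ∅, by simp, by simp⟩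

theorem isSparse_singleton (Q : Cube n) : IsSparse ({Q} : Set (Cube n)) :=
  ⟨fun R => R.toSet, fun R _ => ⟨R.measurableSet_toSet, subset_rfl, ENNReal.half_le_self⟩, by simp⟩

theorem exists_sparse_bound (hn : 0 < n) [IsFiniteMeasure σ]
    (hsupp : σ (Metric.closedBall 0 1)ᶜ = 0) {α : ℝ} (hα : 0 < α) (hdecay : HasFourierDecay σ α)
    {p q : ℝ} (hp : 1 < p) (hpq : p < q) (hconv : ConvBounded σ p q) :
    ∃ C : ℝ≥0, ∀ (c : EuclideanSpace ℝ (Fin n)) (k : ℤ) (f₁ f₂ : EuclideanSpace ℝ (Fin n) → ℂ),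
      Measurable f₁ → Measurable f₂ →
      (∀ x ∉ (gridCube c (k, 0)).toSet, f₁ x = 0) →
      (∀ x ∉ (gridCube c (k, 0)).toSet, f₂ x = 0) →
      ∃ 𝒬 : Set (Cube n), IsSparse 𝒬 ∧
        ∫⁻ x, maximalAvg σ f₁ x * ‖f₂ x‖ₑ ≤
          C * ∑' Q : 𝒬, volume (Q : Cube n).toSet * plusAvg (Q : Cube n) p f₁ *
            plusAvg (Q : Cube n).triple (Real.conjExponent q) f₂ := by
  obtain ⟨C₁, hC₁⟩ := exists_regular_bound hsupp hα hdecay hp hpq hconv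
  obtain ⟨C₂, hC₂⟩ := exists_single_scale_bound hsupp hp hpq hconv
  have hp0 : 0 < p := by linarith
  have hq1 : 1 < q := by linarith
  set q' := Real.conjExponent q with hq'
  have hqq : q.HolderConjugate q' := Real.HolderConjugate.conjExponent hq1
  have hq'1 : 1 < q' := hqq.symm.lt
  have hq'0 : 0 < q' := hqq.symm.pos
  -- The summand `1` keeps the constant positive, so that it times an infinite sum is infinite.
  refine ⟨C₁ + C₂ + 1, fun c k f₁ f₂ hf₁ hf₂ h₁ h₂ => ?_⟩
  set Q := gridCube c (k, 0) with hQ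
  have hQ3 : Q.toSet ⊆ Q.triple.toSet := by
    intro x hx i
    have h := hx i
    have h' := Q.side_pos
    simp only [Cube.triple]
    constructor <;> linarith
  have h₂' : ∀ x ∉ Q.triple.toSet, f₂ x = 0 := fun x hx => h₂ x fun h => hx (hQ3 h)
  have vanish : ∀ (R : Cube n) (r : ℝ) (f : EuclideanSpace ℝ (Fin n) → ℂ), 0 < r → Measurable f →
      (∀ x ∉ R.toSet, f x = 0) → lpAvg R r f = 0 → f =ᵐ[volume] 0 := by
    intro R r f hr hf hR h0
    filter_upwards [(ae_restrict_iff' R.measurableSet_toSet).1 ((lpAvg_eq_zero_iff R hr hf).1 h0)]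
      with x hx
    by_cases hxR : x ∈ R.toSet
    · exact hx hxR
    · exact hR x hxR
  -- If either function vanishes almost everywhere, the left side is zero and the empty family
  -- suffices. Excluding this also prevents `0 · ∞` below.
  by_cases z1 : lpAvg Q p f₁ = 0
  · refine ⟨∅, isSparse_empty, ?_⟩
    rw [lintegral_eq_zero_of_ae_eq_zero]
    · exact zero_le
    · filter_upwards [maximalAvg_congr_ae (σ := σ) (vanish Q p f₁ hp0 hf₁ h₁ z1)] with x hx
      rw [hx]
      simp [maximalAvg]
  by_cases z2 : lpAvg Q.triple q' f₂ = 0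
  · refine ⟨∅, isSparse_empty, ?_⟩
    rw [lintegral_eq_zero_of_ae_eq_zero]
    · exact zero_le
    · filter_upwards [vanish Q.triple q' f₂ hq'0 hf₂ h₂' z2] with x hx
      rw [hx]
      simp
  -- With nonzero averages, one of them infinite, the single cube `Q` already makes the right side
  -- infinite. Afterwards finiteness passes to all cubes, because the functions vanish outside the
  -- initial one.
  by_cases ht : lpAvg Q p f₁ = ∞ ∨ lpAvg Q.triple q' f₂ = ∞
  · refine ⟨{Q}, isSparse_singleton Q, ?_⟩
    have e : ∑' R : ({Q} : Set (Cube n)), volume (R : Cube n).toSet * plusAvg (R : Cube n) p f₁ *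
        plusAvg (R : Cube n).triple q' f₂ = ∞ := by
      rw [tsum_singleton Q (fun R : Cube n => volume R.toSet * plusAvg R p f₁ *
        plusAvg R.triple q' f₂)]
      have a1 := lpAvg_le_plusAvg Q hp.le hf₁
      have a2 := lpAvg_le_plusAvg Q.triple hq'1.le hf₂
      have b1 : plusAvg Q p f₁ ≠ 0 := (lt_of_lt_of_le (pos_iff_ne_zero.2 z1) a1).ne'
      have b2 : plusAvg Q.triple q' f₂ ≠ 0 := (lt_of_lt_of_le (pos_iff_ne_zero.2 z2) a2).ne'
      rcases ht with ht | ht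
      · rw [ht, top_le_iff] at a1
        rw [a1, ENNReal.mul_top Q.volume_ne_zero, ENNReal.top_mul b2]
      · rw [ht, top_le_iff] at a2
        rw [a2, ENNReal.mul_top (mul_ne_zero Q.volume_ne_zero b1)]
    rw [e, ENNReal.mul_top]
    · exact le_top
    · push_cast
      positivity
  push Not at ht
  obtain ⟨ht1, ht2⟩ := ht
  have hfe₁ : Measurable fun x => ‖f₁ x‖ₑ := hf₁.enorm
  have hfe₂ : Measurable fun x => ‖f₂ x‖ₑ := hf₂.enorm
  set Φ : Cube n → ℝ≥0∞ := fun R => volume R.toSet * plusAvg R p f₁ * plusAvg R.triple q' f₂ with hΦ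
  set D : Set (ℤ × (Fin n → ℤ)) := ⋃ i, stoppingGeneration c p f₁ (k, 0) i with hD
  set E := sparseIndices c p f₁ k with hE
  refine ⟨gridCube c '' E, isSparse_sparseIndices hn c hp0 f₁ k, ?_⟩
  rw [tsum_image Φ (gridCube_injective c).injOn]
  set T : D → EuclideanSpace ℝ (Fin n) → ℝ≥0∞ := fun d x => ⨆ t : ℕ, dilateConv σ (d.1.1 - t)
    ((regularSet c p f₁ d.1.1 d.1.2 t).indicator fun y => ‖f₁ y‖ₑ) x with hT
  have hTm : ∀ d, Measurable (T d) := fun d => Measurable.iSup fun t =>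
    measurable_dilateConv _ (hfe₁.indicator (isDyadicUnion_regularSet c p f₁ _ _ _).measurableSet)
  have hTi : ∀ d : D, Measurable fun x =>
      (gridCube c d.1).triple.toSet.indicator (T d) x * ‖f₂ x‖ₑ := fun d =>
    ((hTm d).indicator (Cube.measurableSet_toSet _)).mul hfe₂
  have hSm : ∀ i : ℕ, Measurable fun x =>
      dilateConv σ (k + i + 1) (fun y => ‖f₁ y‖ₑ) x * ‖f₂ x‖ₑ := fun i =>
    (measurable_dilateConv _ hfe₁).mul hfe₂
  have tree : ∑' d : D, ∫⁻ x, (gridCube c d.1).triple.toSet.indicator (T d) x * ‖f₂ x‖ₑ ≤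
      C₁ * ∑' d : E, Φ (gridCube c d) := by
    calc ∑' d : D, ∫⁻ x, (gridCube c d.1).triple.toSet.indicator (T d) x * ‖f₂ x‖ₑ
        ≤ ∑' d : D, C₁ * Φ (gridCube c d) := by
          refine ENNReal.tsum_le_tsum fun d => ?_
          have e : ∀ x, (gridCube c d.1).triple.toSet.indicator (T d) x * ‖f₂ x‖ₑ =
              (gridCube c d.1).triple.toSet.indicator (fun x => T d x * ‖f₂ x‖ₑ) x := by
            intro x
            by_cases hx : x ∈ (gridCube c d.1).triple.toSet <;> simp [hx]
          simp only [e]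
          rw [lintegral_indicator (Cube.measurableSet_toSet _)]
          exact hC₁ c d.1.1 d.1.2 f₁ f₂ hf₁ hf₂ (lpAvg_ne_top_of_le hp0 h₁ ht1)
            (lpAvg_ne_top_of_le hq'0 h₂' ht2)
      _ = C₁ * ∑' d : D, Φ (gridCube c d) := ENNReal.tsum_mul_left
      _ ≤ _ := by
          gcongr
          exact ENNReal.tsum_mono_subtype (fun d => Φ (gridCube c d)) Set.subset_union_left
  have tops : ∑' i : ℕ, ∫⁻ x, dilateConv σ (k + i + 1) (fun y => ‖f₁ y‖ₑ) x * ‖f₂ x‖ₑ ≤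
      C₂ * ∑' d : E, Φ (gridCube c d) := by
    calc ∑' i : ℕ, ∫⁻ x, dilateConv σ (k + i + 1) (fun y => ‖f₁ y‖ₑ) x * ‖f₂ x‖ₑ
        ≤ ∑' i : ℕ, C₂ * Φ (gridCube c (k + i + 1, 0)) := by
          refine ENNReal.tsum_le_tsum fun i => ?_
          exact hC₂ c (k + i + 1) 0 f₁ f₂ hf₁ hf₂
            (fun x hx => h₁ x fun h => hx (gridCube_zero_subset c (by omega) h))
            (lpAvg_ne_top_of_le hp0 h₁ ht1)
      _ = C₂ * ∑' i : ℕ, Φ (gridCube c (k + i + 1, 0)) := ENNReal.tsum_mul_left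
      _ = C₂ * ∑' d : Set.range (fun i : ℕ => ((k + i + 1, 0) : ℤ × (Fin n → ℤ))),
            Φ (gridCube c d) := by
          rw [tsum_range (g := fun i : ℕ => ((k + i + 1, 0) : ℤ × (Fin n → ℤ)))
            (fun d => Φ (gridCube c d))]
          intro i j hij
          have := congrArg Prod.fst hij
          simpa using this
      _ ≤ _ := by
          gcongr
          exact ENNReal.tsum_mono_subtype (fun d => Φ (gridCube c d)) Set.subset_union_right
  calc ∫⁻ x, maximalAvg σ f₁ x * ‖f₂ x‖ₑ
      ≤ ∫⁻ x, ((∑' d : D, (gridCube c d.1).triple.toSet.indicator (T d) x * ‖f₂ x‖ₑ) +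
          ∑' i : ℕ, dilateConv σ (k + i + 1) (fun y => ‖f₁ y‖ₑ) x * ‖f₂ x‖ₑ) := by
        refine lintegral_mono fun x => ?_
        simp only
        rw [ENNReal.tsum_mul_right, ENNReal.tsum_mul_right, ← add_mul]
        gcongr
        exact iSup_dilateConv_le hsupp hp0 c k hf₁ h₁ x
    _ = (∑' d : D, ∫⁻ x, (gridCube c d.1).triple.toSet.indicator (T d) x * ‖f₂ x‖ₑ) +
          ∑' i : ℕ, ∫⁻ x, dilateConv σ (k + i + 1) (fun y => ‖f₁ y‖ₑ) x * ‖f₂ x‖ₑ := by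
        rw [lintegral_add_left (Measurable.tsum hTi), lintegral_tsum fun d => (hTi d).aemeasurable,
          lintegral_tsum fun i => (hSm i).aemeasurable]
    _ ≤ C₁ * ∑' d : E, Φ (gridCube c d) + C₂ * ∑' d : E, Φ (gridCube c d) := add_le_add tree tops
    _ ≤ _ := by
        rw [← add_mul]
        push_cast
        exact mul_le_mul' le_self_add le_rfl

/-- Every bounded set is contained in a dyadic cube of a suitable grid. -/
theorem exists_gridCube_superset {K : Set (EuclideanSpace ℝ (Fin n))}
    (hK : Bornology.IsBounded K) :
    ∃ (c : EuclideanSpace ℝ (Fin n)) (k : ℤ), K ⊆ (gridCube c (k, 0)).toSet := by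
  obtain ⟨R, hR⟩ := hK.exists_norm_le
  obtain ⟨N, hN⟩ := pow_unbounded_of_one_lt R (one_lt_two (α := ℝ))
  refine ⟨WithLp.toLp 2 fun _ => -(2 : ℝ) ^ N, ((N + 1 : ℕ) : ℤ), fun x hx i => ?_⟩
  have h1 : |x i| ≤ R := (PiLp.norm_apply_le x i).trans (hR x hx)
  have h2 := abs_le.1 h1
  have h3 : (2 : ℝ) ^ ((N + 1 : ℕ) : ℤ) = 2 * 2 ^ N := by
    rw [zpow_natCast, pow_succ]; ring
  simp only [gridCube, dyadicCube, h3, Pi.zero_apply, Int.cast_zero, mul_zero, add_zero]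
  constructor <;> linarith

end

end SparseMaximal

end

/-! ### Reduction to measurable functions supported in one dyadic cube. -/

theorem theorem3 {n : ℕ} (hn : 0 < n)
    (σ : Measure (EuclideanSpace ℝ (Fin n))) [IsFiniteMeasure σ]
    (hsupp : σ (Metric.closedBall 0 1)ᶜ = 0)
    (α : ℝ) (hα : 0 < α) (hdecay : SparseMaximal.HasFourierDecay σ α)
    (p q : ℝ) (hp : 1 < p) (hpq : p < q) (hconv : SparseMaximal.ConvBounded σ p q) :
    ∃ C : ℝ≥0, ∀ f₁ f₂ : EuclideanSpace ℝ (Fin n) → ℂ,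
      AEStronglyMeasurable f₁ volume → HasCompactSupport f₁ →
      AEStronglyMeasurable f₂ volume → HasCompactSupport f₂ →
      ∃ 𝒬 : Set (SparseMaximal.Cube n), SparseMaximal.IsSparse 𝒬 ∧
        ∫⁻ x, SparseMaximal.maximalAvg σ f₁ x * ‖f₂ x‖ₑ ≤
          C * ∑' Q : 𝒬, volume (Q : SparseMaximal.Cube n).toSet *
            SparseMaximal.plusAvg (Q : SparseMaximal.Cube n) p f₁ *
            SparseMaximal.plusAvg (Q : SparseMaximal.Cube n).triple
              (Real.conjExponent q) f₂ := by
  obtain ⟨C, hC⟩ := SparseMaximal.exists_sparse_bound hn hsupp hα hdecay hp hpq hconv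
  refine ⟨C, fun f₁ f₂ hf₁ hs₁ hf₂ hs₂ => ?_⟩
  obtain ⟨c, k, hck⟩ := SparseMaximal.exists_gridCube_superset
    (hs₁.isCompact.isBounded.union hs₂.isCompact.isBounded)
  set R := (SparseMaximal.gridCube c (k, 0)).toSet with hR
  have hRm : MeasurableSet R := SparseMaximal.Cube.measurableSet_toSet _
  -- A measurable representative, cut off to the cube, replaces each function. The averages depend
  -- only on the almost everywhere class, and the maximal function changes only on a null set even
  -- for singular `σ`.
  have modify : ∀ f : EuclideanSpace ℝ (Fin n) → ℂ, ∀ hf : AEStronglyMeasurable f volume,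
      tsupport f ⊆ R → R.indicator (hf.mk f) =ᵐ[volume] f := by
    intro f hf hfR
    filter_upwards [hf.ae_eq_mk] with x hx
    by_cases hxR : x ∈ R
    · rw [Set.indicator_of_mem hxR, hx]
    · rw [Set.indicator_of_notMem hxR, image_eq_zero_of_notMem_tsupport fun h => hxR (hfR h)]
  have e₁ := modify f₁ hf₁ (Set.subset_union_left.trans hck)
  have e₂ := modify f₂ hf₂ (Set.subset_union_right.trans hck)
  obtain ⟨𝒬, h𝒬, hle⟩ := hC c k (R.indicator (hf₁.mk f₁)) (R.indicator (hf₂.mk f₂))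
    (hf₁.stronglyMeasurable_mk.measurable.indicator hRm)
    (hf₂.stronglyMeasurable_mk.measurable.indicator hRm)
    (fun x hx => Set.indicator_of_notMem hx _) (fun x hx => Set.indicator_of_notMem hx _)
  refine ⟨𝒬, h𝒬, ?_⟩
  simp only [SparseMaximal.plusAvg_congr_ae _ _ e₁, SparseMaximal.plusAvg_congr_ae _ _ e₂] at hle
  refine le_trans (le_of_eq ?_) hle
  refine lintegral_congr_ae ?_
  filter_upwards [SparseMaximal.maximalAvg_congr_ae (σ := σ) e₁, e₂] with x h1 h2
  rw [h1, h2]
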